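/- All graphs are finite and simple. A graph is $K_{1,t}$-free if it has no induced subgraph isomorphic to the star $K_{1,t}$. An induced packing of $k$ cycles in a graph $G$ is a set of $k$ pairwise vertex-disjoint cycles of $G$ such that no edge of $G$ joins two distinct cycles of the set. A tree-decomposition of $G$ is a pair $(T,\beta)$ of a tree $T$ and a map $\beta\colon V(T)\to 2^{V(G)}$ such that $\bigcup_{a\in V(T)}\beta(a)=V(G)$, every edge of $G$ has both ends in some bag $\beta(a)$, and for every $v\in V(G)$ the set $\{a\in V(T): v\in\beta(a)\}$ induces a (nonempty) subtree of $T$. Its independence number is $\max_{a\in V(T)}\alpha(G[\beta(a)])$, where $\alpha$ denotes the maximum size of an independent set. Theorem. There are a constant $C$ and an algorithm that, given positive integers $t$ and $k$ (written in binary) and a $K_{1,t}$-free graph $G$ (given by its adjacency matrix), outputs, in time polynomial in $|V(G)|+\log t+\log k$, either an induced packing of $k$ cycles in $G$ or a tree-decomposition of $G$ with independence number at most $C\,t\,k\log(k+1)$. Running time is counted as the number of steps of a random access machine with addition and truncated subtraction as its arithmetic operations (a model that is polynomially equivalent to Turing machines). -/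

import Mathlib

/-! ### A random access machine

Programs are structured programs for a random access machine whose cells hold natural numbers of
arbitrary size. The only arithmetic operations are addition and truncated subtraction, so counting
one step per operation is polynomially equivalent to counting steps of a Turing machine (there is
no multiplication, hence `T` steps lengthen numbers by at most `O(T)` bits). -/

/-- The memory of the machine: scalar registers and one-dimensional arrays, both named by natural
numbers. A program mentions only finitely many of these names. -/
structure Store where
  var : ℕ → ℕ
  arr : ℕ → ℕ → ℕ

/-- Write the value `v` into register `x`. -/
def Store.setVar (s : Store) (x v : ℕ) : Store where
  var := Function.update s.var x v
  arr := s.arr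

/-- Write the value `v` into cell `i` of array `a`. -/
def Store.setArr (s : Store) (a i v : ℕ) : Store where
  var := s.var
  arr := Function.update s.arr a (Function.update (s.arr a) i v)

/-- Expressions: constants, registers, array cells with a computed index (indirect addressing),
sums and truncated differences. -/
inductive Expr where
  | const (c : ℕ)
  | var (x : ℕ)
  | get (a : ℕ) (i : Expr)
  | add (e f : Expr)
  | sub (e f : Expr)

/-- The value of an expression in a given memory. -/
def Expr.eval (s : Store) : Expr → ℕ
  | .const c => c
  | .var x => s.var x
  | .get a i => s.arr a (i.eval s)
  | .add e f => e.eval s + f.eval s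
  | .sub e f => e.eval s - f.eval s

/-- The number of steps needed to evaluate an expression: one for every node. -/
def Expr.cost : Expr → ℕ
  | .const _ => 1
  | .var _ => 1
  | .get _ i => i.cost + 1
  | .add e f => e.cost + f.cost + 1
  | .sub e f => e.cost + f.cost + 1

/-- Programs. A test `e` counts as true when the value of `e` is not zero. -/
inductive Prog where
  | skip
  | assign (x : ℕ) (e : Expr)
  | store (a : ℕ) (i e : Expr)
  | seq (p q : Prog)
  | ite (e : Expr) (p q : Prog)
  | loop (e : Expr) (p : Prog)

/-- `Prog.Exec p s c s'`: started with memory `s`, the program `p` halts with memory `s'` after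
exactly `c` steps. `Prog.loop e p` repeats `p` as long as `e` is not zero. -/
inductive Prog.Exec : Prog → Store → ℕ → Store → Prop
  | skip (s : Store) : Prog.Exec .skip s 1 s
  | assign (s : Store) (x : ℕ) (e : Expr) :
      Prog.Exec (.assign x e) s (e.cost + 1) (s.setVar x (e.eval s))
  | store (s : Store) (a : ℕ) (i e : Expr) :
      Prog.Exec (.store a i e) s (i.cost + e.cost + 1) (s.setArr a (i.eval s) (e.eval s))
  | seq {p q : Prog} {s s₁ s₂ : Store} {c₁ c₂ : ℕ} :
      Prog.Exec p s c₁ s₁ → Prog.Exec q s₁ c₂ s₂ → Prog.Exec (.seq p q) s (c₁ + c₂) s₂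
  | ite_true {e : Expr} {p q : Prog} {s s₁ : Store} {c : ℕ} :
      e.eval s ≠ 0 → Prog.Exec p s c s₁ → Prog.Exec (.ite e p q) s (e.cost + 1 + c) s₁
  | ite_false {e : Expr} {p q : Prog} {s s₁ : Store} {c : ℕ} :
      e.eval s = 0 → Prog.Exec q s c s₁ → Prog.Exec (.ite e p q) s (e.cost + 1 + c) s₁
  | loop_done {e : Expr} {p : Prog} {s : Store} :
      e.eval s = 0 → Prog.Exec (.loop e p) s (e.cost + 1) s
  | loop_step {e : Expr} {p : Prog} {s s₁ s₂ : Store} {c₁ c₂ : ℕ} :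
      e.eval s ≠ 0 → Prog.Exec p s c₁ s₁ → Prog.Exec (.loop e p) s₁ c₂ s₂ →
        Prog.Exec (.loop e p) s (e.cost + 1 + c₁ + c₂) s₂

/-- The machine is deterministic: the step count and the final memory are determined by the
program and the initial memory. -/
theorem Prog.Exec.deterministic {p : Prog} {s s₁ s₂ : Store} {c₁ c₂ : ℕ}
    (h₁ : Prog.Exec p s c₁ s₁) (h₂ : Prog.Exec p s c₂ s₂) : c₁ = c₂ ∧ s₁ = s₂ := by
  induction h₁ generalizing c₂ s₂ with
  | skip => cases h₂; exact ⟨rfl, rfl⟩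
  | assign => cases h₂; exact ⟨rfl, rfl⟩
  | store => cases h₂; exact ⟨rfl, rfl⟩
  | seq _ _ ih₁ ih₂ =>
    cases h₂ with
    | seq hp hq =>
      obtain ⟨rfl, rfl⟩ := ih₁ hp
      obtain ⟨rfl, rfl⟩ := ih₂ hq
      exact ⟨rfl, rfl⟩
  | ite_true he _ ih =>
    cases h₂ with
    | ite_true _ hp => obtain ⟨rfl, rfl⟩ := ih hp; exact ⟨rfl, rfl⟩
    | ite_false he₂ _ => exact absurd he₂ he
  | ite_false he _ ih =>
    cases h₂ with
    | ite_true he₂ _ => exact absurd he he₂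
    | ite_false _ hq => obtain ⟨rfl, rfl⟩ := ih hq; exact ⟨rfl, rfl⟩
  | loop_done he =>
    cases h₂ with
    | loop_done _ => exact ⟨rfl, rfl⟩
    | loop_step he₂ _ _ => exact absurd he he₂
  | loop_step he _ _ ih₁ ih₂ =>
    cases h₂ with
    | loop_done he₂ => exact absurd he₂ he
    | loop_step _ hp hq =>
      obtain ⟨rfl, rfl⟩ := ih₁ hp
      obtain ⟨rfl, rfl⟩ := ih₂ hq
      exact ⟨rfl, rfl⟩

/-! ### Induced packings of cycles and tree-decompositions -/

/-- A family of `k` cycles of `G` forming an induced packing: distinct members of the family have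
no common vertex, and `G` has no edge between them. -/
structure IsInducedCyclePacking {V : Type*} (G : SimpleGraph V) {k : ℕ} (root : Fin k → V)
    (cyc : ∀ i, G.Walk (root i) (root i)) : Prop where
  isCycle : ∀ i, (cyc i).IsCycle
  disjoint : ∀ i j, i ≠ j → ∀ u ∈ (cyc i).support, u ∉ (cyc j).support
  no_edge : ∀ i j, i ≠ j → ∀ u ∈ (cyc i).support, ∀ v ∈ (cyc j).support, ¬ G.Adj u v

/-- A tree-decomposition of `G` whose tree has the node set `ι`. -/
structure TreeDecomposition {V : Type*} (G : SimpleGraph V) (ι : Type*) where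
  tree : SimpleGraph ι
  bag : ι → Set V
  isTree : tree.IsTree
  cover : ⋃ a, bag a = Set.univ
  edge : ∀ u v, G.Adj u v → ∃ a, {u, v} ⊆ bag a
  subtree : ∀ v, (tree.induce {a | v ∈ bag a}).Connected

/-- The independence number of a tree-decomposition: the maximum over all nodes of the
independence number of the subgraph induced by the bag. -/
noncomputable def TreeDecomposition.independenceNumber {V ι : Type*} [Fintype ι]
    {G : SimpleGraph V} (D : TreeDecomposition G ι) : ℕ :=
  Finset.univ.sup fun a => (G.induce (D.bag a)).indepNum

/-! ### Input and output formats -/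

open Classical in
/-- The initial memory on input `(G, t, k)`: the registers 0, 1, 2 hold `n`, `t`, `k`, and array 0
holds the adjacency matrix of `G`, row by row. Everything else is zero. -/
noncomputable def inputStore {n : ℕ} (G : SimpleGraph (Fin n)) (t k : ℕ) : Store where
  var x := if x = 0 then n else if x = 1 then t else if x = 2 then k else 0
  arr a i := if a = 0 ∧ ∃ u v : Fin n, i = u * n + v ∧ G.Adj u v then 1 else 0

/-- The size of the input `(G, t, k)`: the number of vertices of `G` plus the numbers of binary
digits of `t` and of `k`. -/
def inputSize (n t k : ℕ) : ℕ := n + Nat.size t + Nat.size k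

/-- The memory presents a family of `k` closed walks: register 3 holds 1, cell `i` of array 1 holds
the length of walk `i`, and the `i`-th row, of width `n`, of array 2 starts with the
successive vertices of walk `i` (the return to the first vertex is not repeated). -/
def Store.PresentsCycles {n : ℕ} {G : SimpleGraph (Fin n)} (s : Store) {k : ℕ}
    {root : Fin k → Fin n} (cyc : ∀ i, G.Walk (root i) (root i)) : Prop :=
  s.var 3 = 1 ∧
  ∀ i : Fin k, s.arr 1 i = (cyc i).length ∧
    ∀ j < (cyc i).length, s.arr 2 (i * n + j) = (cyc i).getVert j

open Classical in
/-- The memory presents a tree-decomposition with node set `{0, ..., m - 1}`: register 3 holds 2,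
register 4 holds `m`, array 3 holds the adjacency matrix of the tree row by row, and array 4 holds,
row by row, the incidence matrix of nodes and vertices of `G` that records the bags. -/
def Store.PresentsTreeDecomposition {n : ℕ} {G : SimpleGraph (Fin n)} (s : Store) {m : ℕ}
    (D : TreeDecomposition G (Fin m)) : Prop :=
  s.var 3 = 2 ∧ s.var 4 = m ∧
  (∀ a b : Fin m, s.arr 3 (a * m + b) = if D.tree.Adj a b then 1 else 0) ∧
  (∀ (a : Fin m) (v : Fin n), s.arr 4 (a * n + v) = if v ∈ D.bag a then 1 else 0)

/-! The algorithm is greedy. While some remaining vertex has at most one remaining neighbour, it is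
deleted. Otherwise the remaining graph has minimum degree two; a cycle with as few branch vertices
(degree at least three in the remaining graph) as possible is chosen, and the closed neighbourhoods
of its branch vertices and of its root are deleted. `X` collects these centres, `Z` everything
deleted around them, and `τ` records deletion times.

Packing. A vertex left over from a chosen cycle had degree two when the cycle was chosen. If it
survived until the minimum degree is again two, so would both its neighbours on the cycle, and so on
around to the root, which was deleted. Hence later cycles are disjoint from and not adjacent to
earlier ones (`ChosenAt.lt_of_mem_support`, `ChosenAt.not_adj`). If `k` cycles were chosen, they
form the packing.

Decomposition. The vertices outside `Z` were deleted with at most one remaining neighbour, so they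
span a forest. Adding `Z` to all bags of a tree-decomposition of this forest gives bags covered by
`X.card` closed neighbourhoods and two more vertices, hence independence number at most `X.card * t
+ 2` in a graph without induced star.

Counting centres. If fewer than `k` cycles were chosen, it remains to see that `X.card` is of order
`k log (k + 1)`. At each choice, the remaining graph has minimum degree two and is dismantled by
deleting stars with centres in `X` and vertices of degree at most one. Such a graph has a cycle with
only logarithmically many (in `X.card`) branch vertices: `exists_cycle_of_elimination` finds a
subset with more edges than vertices, the excess being proportional to the number of heavy clusters,
and `exists_cycle_of_dense` finds a cheap cycle in it by region growing. So each choice adds `O(log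
X.card)` centres, and the inequality is solved for `X.card` in `IsDismantling.card_le_log`.

Machine. The algorithm is written in a language whose only loops run over `0, ..., n - 1`, so that
its running time is a polynomial in `n` by construction. The cycle is found by shortest paths with
vertex weights that make one branch vertex outweigh any difference in length. -/

section

open scoped Classical

/-! ### Sets that are cheap to reach span few edges. -/

namespace ShortCycles

variable {V : Type*}

section
variable [DecidableEq V]

/-- The number of vertices of `β` on a walk. -/
def cost {H : SimpleGraph V} (β : Finset V) {u v : V} (w : H.Walk u v) : ℕ :=
  (w.support.toFinset ∩ β).card

theorem cost_le_of_subset {H H' : SimpleGraph V} (β : Finset V) {u v x y : V} (w : H.Walk u v)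
    (w' : H'.Walk x y) (h : w.support ⊆ w'.support) : cost β w ≤ cost β w' :=
  Finset.card_le_card (Finset.inter_subset_inter_right (fun a ha => by
    simp only [List.mem_toFinset] at *; exact h ha))

theorem cost_concat_le {H : SimpleGraph V} (β : Finset V) {u v x : V} (w : H.Walk u v)
    (h : H.Adj v x) : cost β (w.concat h) ≤ cost β w + 1 := by
  have : (w.concat h).support.toFinset ∩ β ⊆ insert x (w.support.toFinset ∩ β) := by
    intro a
    simp only [SimpleGraph.Walk.support_concat, Finset.mem_inter,
      List.mem_toFinset, List.mem_append, List.mem_singleton, Finset.mem_insert]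
    tauto
  exact (Finset.card_le_card this).trans (Finset.card_insert_le _ _)

theorem cost_concat_of_notMem {H : SimpleGraph V} (β : Finset V) {u v x : V} (w : H.Walk u v)
    (h : H.Adj v x) (hx : x ∉ β) : cost β (w.concat h) ≤ cost β w := by
  refine Finset.card_le_card ?_
  intro a
  simp only [SimpleGraph.Walk.support_concat, Finset.mem_inter,
      List.mem_toFinset, List.mem_append, List.mem_singleton]
  rintro ⟨h1 | rfl, h2⟩
  · exact ⟨h1, h2⟩
  · exact absurd h2 hx

/-- In a graph without cheap cycles, cheap paths are determined by their ends. -/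
theorem path_unique {H : SimpleGraph V} (β : Finset V) {L : ℕ}
    (hcyc : ∀ u (c : H.Walk u u), c.IsCycle → L < cost β c) {u v : V} (p q : H.Walk u v)
    (hp : p.IsPath) (hq : q.IsPath) (h : cost β p + cost β q ≤ L) : p = q := by
  -- `T` is the union of the two paths. A cycle in `T` has all its vertices on `p` or `q`, so it
  -- would cost at most `L`; hence `T` is acyclic, and paths in it are unique.
  let T : SimpleGraph V := SimpleGraph.fromEdgeSet {e | e ∈ p.edges ∨ e ∈ q.edges}
  have hTe : ∀ e, e ∈ p.edges ∨ e ∈ q.edges → e ∈ T.edgeSet := by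
    intro e he
    rw [SimpleGraph.edgeSet_fromEdgeSet]
    refine ⟨he, ?_⟩
    have : e ∈ H.edgeSet := he.elim (fun h => p.edges_subset_edgeSet h)
      (fun h => q.edges_subset_edgeSet h)
    exact H.not_isDiag_of_mem_edgeSet this
  have hTH : T ≤ H := by
    intro a b hab
    rw [SimpleGraph.fromEdgeSet_adj] at hab
    exact hab.1.elim (fun h => p.edges_subset_edgeSet h) (fun h => q.edges_subset_edgeSet h)
  have hac : T.IsAcyclic := by
    intro a c hc
    have h1 := hcyc a (c.mapLe hTH) (hc.mapLe hTH)
    have h2 : (c.mapLe hTH).support.toFinset ∩ β ⊆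
        (p.support.toFinset ∩ β) ∪ (q.support.toFinset ∩ β) := by
      intro x hx
      simp only [SimpleGraph.Walk.support_mapLe_eq_support, Finset.mem_inter, List.mem_toFinset,
        Finset.mem_union] at hx ⊢
      obtain ⟨e, he, hxe⟩ := (SimpleGraph.Walk.mem_support_iff_exists_mem_edges_of_not_nil
        hc.not_nil).1 hx.1
      have := c.edges_subset_edgeSet he
      rw [SimpleGraph.edgeSet_fromEdgeSet] at this
      rcases this.1 with h | h
      · exact Or.inl ⟨SimpleGraph.Walk.mem_support_of_mem_edges h hxe, hx.2⟩
      · exact Or.inr ⟨SimpleGraph.Walk.mem_support_of_mem_edges h hxe, hx.2⟩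
    have h3 := (Finset.card_le_card h2).trans (Finset.card_union_le _ _)
    unfold cost at *
    omega
  have := hac.subsingleton_path u v
  have e1 := Subsingleton.elim (α := T.Path u v) ⟨p.transfer T (fun e he => hTe e (Or.inl he)), hp.transfer _⟩
    ⟨q.transfer T (fun e he => hTe e (Or.inr he)), hq.transfer _⟩
  have e2 := congrArg (fun x : T.Path u v => x.1.support) e1
  simp only [SimpleGraph.Walk.support_transfer] at e2
  exact SimpleGraph.Walk.ext_support e2

end

/-- The number of ordered pairs in `S × T` that are adjacent. -/
noncomputable def pairs (H : SimpleGraph V) (S T : Finset V) : ℕ :=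
  ∑ u ∈ S, (T.filter (H.Adj u)).card

theorem pairs_comm (H : SimpleGraph V) (S T : Finset V) : pairs H S T = pairs H T S := by
  simp only [pairs, Finset.card_filter]
  rw [Finset.sum_comm]
  simp only [H.adj_comm]

theorem card_le_pairs (H : SimpleGraph V) (S T : Finset V) (P : Finset (V × V))
    (h : ∀ e ∈ P, e.1 ∈ S ∧ e.2 ∈ T ∧ H.Adj e.1 e.2) : P.card ≤ pairs H S T := by
  have : pairs H S T = (S.sigma fun u => T.filter (H.Adj u)).card := by
    rw [Finset.card_sigma]; rfl
  rw [this]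
  refine Finset.card_le_card_of_injOn (fun e => ⟨e.1, e.2⟩) ?_ ?_
  · intro e he
    have := h e he
    simpa using this
  · intro e _ e' _ hee
    simp only [Sigma.mk.injEq, heq_eq_eq] at hee
    exact Prod.ext hee.1 hee.2

theorem pairs_le_card (H : SimpleGraph V) (S T : Finset V) (P : Finset (V × V))
    (h : ∀ u ∈ S, ∀ v ∈ T, H.Adj u v → (u, v) ∈ P) : pairs H S T ≤ P.card := by
  have : pairs H S T = (S.sigma fun u => T.filter (H.Adj u)).card := by
    rw [Finset.card_sigma]; rfl
  rw [this]
  refine Finset.card_le_card_of_injOn (fun e => (e.1, e.2)) ?_ ?_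
  · intro e he
    simp only [Finset.coe_sigma, Set.mem_sigma_iff, Finset.mem_coe, Finset.mem_filter] at he
    exact h _ he.1 _ he.2.1 he.2.2
  · rintro ⟨a, b⟩ _ ⟨a', b'⟩ _ hee
    simp only [Prod.mk.injEq] at hee
    obtain ⟨rfl, rfl⟩ := hee
    rfl

variable [DecidableEq V]

theorem pairs_union_left (H : SimpleGraph V) {S S' : Finset V} (T : Finset V)
    (h : Disjoint S S') : pairs H (S ∪ S') T = pairs H S T + pairs H S' T := by
  rw [pairs, Finset.sum_union h]; rfl

theorem pairs_union_right (H : SimpleGraph V) {S S' : Finset V} (T : Finset V)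
    (h : Disjoint S S') : pairs H T (S ∪ S') = pairs H T S + pairs H T S' := by
  rw [pairs_comm, pairs_union_left H T h, pairs_comm H S, pairs_comm H S']

theorem pairs_union_self (H : SimpleGraph V) {S S' : Finset V} (h : Disjoint S S') :
    pairs H (S ∪ S') (S ∪ S') = pairs H S S + 2 * pairs H S S' + pairs H S' S' := by
  rw [pairs_union_left H _ h, pairs_union_right H _ h, pairs_union_right H _ h, pairs_comm H S' S]
  ring

/-- If all cycles are expensive, then a set of vertices that are cheap to reach from a root spans
at most as many edges as a tree. -/
theorem pairs_le_of_reachable {H : SimpleGraph V} (β : Finset V) {D : ℕ}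
    (hcyc : ∀ u (c : H.Walk u u), c.IsCycle → 2 * D + 1 < cost β c) (root : V) (A : Finset V)
    (hroot : root ∈ A) (hA : ∀ v ∈ A, ∃ w : H.Walk root v, cost β w ≤ D) :
    pairs H A A + 2 ≤ 2 * A.card := by
  -- Outside `A` there need not be any walk from the root; the summand `Unit` provides a value
  -- there, so that `choose` applies.
  have hA' : ∀ v, ∃ w : H.Walk root v ⊕ Unit, v ∈ A → ∃ p, w = Sum.inl p ∧ p.IsPath ∧
      cost β p ≤ D := by
    intro v
    by_cases hv : v ∈ A
    · obtain ⟨w, hw⟩ := hA v hv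
      exact ⟨Sum.inl w.bypass, fun _ => ⟨_, rfl, w.bypass_isPath,
        (cost_le_of_subset β _ _ w.support_bypass_subset_support).trans hw⟩⟩
    · exact ⟨Sum.inr (), fun h => absurd h hv⟩
  choose w hw using hA'
  let pen : V → V := fun v => Sum.elim (fun p => p.penultimate) (fun _ => v) (w v)
  have hpen : ∀ v (p : H.Walk root v), w v = Sum.inl p → pen v = p.penultimate := by
    intro v p h; simp only [pen, h, Sum.elim_inl]
  -- If one of the two chosen paths avoids the end of the other edge vertex, prolonging it by the
  -- edge gives the other path, by uniqueness; the prolongation costs at most one more, whence `2 *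
  -- D + 1`. If each path contained the other's end, then `q` would be the part of `p` before `v`,
  -- which does not contain `u`.
  have key : ∀ u ∈ A, ∀ v ∈ A, H.Adj u v → pen v = u ∨ pen u = v := by
    intro u hu v hv huv
    obtain ⟨p, ep, hp, cp⟩ := hw u hu
    obtain ⟨q, eq, hq, cq⟩ := hw v hv
    rw [hpen u p ep, hpen v q eq]
    by_cases h1 : v ∈ p.support
    · by_cases h2 : u ∈ q.support
      · exfalso
        have e := path_unique β hcyc (p.takeUntil v h1) q (hp.takeUntil h1) hq (by
          have := cost_le_of_subset β (p.takeUntil v h1) p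
            (SimpleGraph.Walk.support_takeUntil_subset_support p h1)
          omega)
        rw [← e] at h2
        exact SimpleGraph.Walk.endpoint_notMem_support_takeUntil hp h1 huv.ne h2
      · right
        have e := path_unique β hcyc (q.concat huv.symm) p (hq.concat h2 _) hp (by
          have := cost_concat_le β q huv.symm
          omega)
        rw [← e]; simp
    · left
      have e := path_unique β hcyc (p.concat huv) q (hp.concat h1 _) hq (by
          have := cost_concat_le β p huv
          omega)
      rw [← e]; simp
  have hr : pen root = root := by
    obtain ⟨p, ep, hp, -⟩ := hw root hroot
    rw [hpen _ p ep, (SimpleGraph.Walk.isPath_iff_nil.1 hp).eq_nil]; rfl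
  -- Every edge joins a vertex other than the root to its predecessor, so there are at most `A.card
  -- - 1` edges, each counted in both orientations.
  have hle := pairs_le_card H A A
    ((A.erase root).image (fun v => (pen v, v)) ∪ (A.erase root).image (fun v => (v, pen v))) (by
    intro u hu v hv huv
    simp only [Finset.mem_union, Finset.mem_image, Finset.mem_erase, Prod.mk.injEq]
    rcases key u hu v hv huv with h | h
    · left
      refine ⟨v, ⟨?_, hv⟩, h, rfl⟩
      rintro rfl
      exact huv.ne (h.symm.trans hr)
    · right
      refine ⟨u, ⟨?_, hu⟩, rfl, h⟩
      rintro rfl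
      exact huv.ne (hr.symm.trans h))
  have h1 : (((A.erase root).image (fun v => (pen v, v))).card) ≤ A.card - 1 :=
    Finset.card_image_le.trans (Finset.card_erase_of_mem hroot).le
  have h2 : (((A.erase root).image (fun v => (v, pen v))).card) ≤ A.card - 1 :=
    Finset.card_image_le.trans (Finset.card_erase_of_mem hroot).le
  have h3 := Finset.card_union_le ((A.erase root).image (fun v => (pen v, v)))
    ((A.erase root).image (fun v => (v, pen v)))
  have h4 : 0 < A.card := Finset.card_pos.2 ⟨_, hroot⟩
  omega

end ShortCycles
end

/-! ### Region growing over clusters. -/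

section

open scoped Classical

namespace ShortCycles

variable {V : Type*}

/-- The vertices of `S` that can be reached from `root` through few clusters. The clusters are the
fibres of `κ`; those whose centre lies in `W` count, the others are single vertices. -/
inductive Reach (H : SimpleGraph V) (κ : V → V) (W S : Finset V) (root : V) : ℕ → V → Prop
  | base (v : V) : κ v = κ root → Reach H κ W S root 0 v
  | mono (r : ℕ) (v : V) : Reach H κ W S root r v → Reach H κ W S root (r + 1) v
  | light (r : ℕ) (u v : V) : Reach H κ W S root r u → H.Adj u v → v ∈ S → κ v ∉ W →
      Reach H κ W S root r v
  | heavy (r : ℕ) (u v w : V) : Reach H κ W S root r u → H.Adj u v → v ∈ S → κ w = κ v →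
      Reach H κ W S root (r + 1) w

theorem Reach.mem {H : SimpleGraph V} {κ : V → V} {W S : Finset V} {root : V}
    (hS : ∀ u v, u ∈ S → κ v = κ u → v ∈ S) (hr : root ∈ S) {r : ℕ} {v : V}
    (h : Reach H κ W S root r v) : v ∈ S := by
  induction h with
  | base v h => exact hS _ _ hr h
  | mono r v _ ih => exact ih
  | light r u v _ _ h _ _ => exact h
  | heavy r u v w _ _ hv h _ => exact hS _ _ hv h

/-- Balls are unions of clusters: heavy steps add whole clusters, and light clusters are single
vertices. -/
theorem Reach.congr {H : SimpleGraph V} {κ : V → V} {W S : Finset V} {root : V}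
    (hlight : ∀ v, κ v ∉ W → κ v = v) {r : ℕ} {v : V}
    (h : Reach H κ W S root r v) : ∀ u, κ u = κ v → Reach H κ W S root r u := by
  induction h with
  | base v h => intro u hu; exact Reach.base _ (hu.trans h)
  | mono r v _ ih => intro u hu; exact Reach.mono _ _ (ih u hu)
  | light r x v h1 h2 h3 h4 _ =>
    intro u hu
    have e1 := hlight v h4
    have e2 := hlight u (hu ▸ h4)
    have : u = v := by rw [← e1, ← e2, hu]
    subst this
    exact Reach.light _ _ _ h1 h2 h3 h4
  | heavy r x v w h1 h2 h3 h4 _ =>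
    intro u hu
    exact Reach.heavy _ _ _ _ h1 h2 h3 (hu.trans h4)

variable [DecidableEq V]

/-- The detour leads through the common centre and adds at most this centre and the new end. -/
theorem exists_walk_cluster {H : SimpleGraph V} (β : Finset V) {κ : V → V}
    (hκ : ∀ v, κ v = v ∨ H.Adj v (κ v)) {v w x : V} (p : H.Walk x v) (h : κ w = κ v) :
    ∃ q : H.Walk x w, cost β q ≤ cost β p + 2 := by
  have h1 : ∃ q : H.Walk x (κ v), cost β q ≤ cost β p + 1 := by
    rcases hκ v with e | e
    · exact ⟨p.copy rfl e.symm, by simp [cost]⟩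
    · exact ⟨p.concat e, cost_concat_le β p e⟩
  obtain ⟨q, hq⟩ := h1
  rcases hκ w with e | e
  · exact ⟨q.copy rfl (h.symm.trans e), by simp only [cost, SimpleGraph.Walk.support_copy] at *; omega⟩
  · have e' : H.Adj (κ v) w := (h ▸ e).symm
    have := cost_concat_le β q e'
    exact ⟨q.concat e', by omega⟩

/-- A light step enters a vertex outside `β` and is free. A heavy step adds at most three vertices:
the point of entry, the centre and the new end. The summand 1 accounts for the cluster of the root.
-/
theorem Reach.exists_walk {H : SimpleGraph V} (β : Finset V) {κ : V → V} {W S : Finset V} {root : V}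
    (hκ : ∀ v, κ v = v ∨ H.Adj v (κ v)) (hlight : ∀ v ∈ S, κ v ∉ W → v ∉ β) {r : ℕ} {v : V}
    (h : Reach H κ W S root r v) : ∃ p : H.Walk root v, cost β p ≤ 3 * (r + 1) := by
  induction h with
  | base v h =>
    have h0 : cost β (SimpleGraph.Walk.nil : H.Walk root root) ≤ 1 := by
      unfold cost
      exact (Finset.card_le_card Finset.inter_subset_left).trans (by simp)
    obtain ⟨q, hq⟩ := exists_walk_cluster β hκ SimpleGraph.Walk.nil h
    exact ⟨q, by omega⟩
  | mono r v _ ih => obtain ⟨p, hp⟩ := ih; exact ⟨p, by omega⟩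
  | light r x v _ h2 h3 h4 ih =>
    obtain ⟨p, hp⟩ := ih
    exact ⟨p.concat h2, (cost_concat_of_notMem β p h2 (hlight v h3 h4)).trans hp⟩
  | heavy r x v w _ h2 _ h4 ih =>
    obtain ⟨p, hp⟩ := ih
    obtain ⟨q, hq⟩ := exists_walk_cluster β hκ (p.concat h2) h4
    have := cost_concat_le β p h2
    exact ⟨q, by omega⟩

/-- A cluster-closed set that spans sufficiently many edges contains a cheap cycle, by region
growing. -/
theorem exists_cycle_of_dense {H : SimpleGraph V} (β W : Finset V) (κ : V → V)
    (hκ : ∀ v, κ v = v ∨ H.Adj v (κ v)) (hκκ : ∀ v, κ (κ v) = κ v)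
    (hsingle : ∀ v, κ v ∉ W → κ v = v) {R : ℕ} (hR : W.card * 4 ^ R < 5 ^ R)
    (S : Finset V) (hlight : ∀ v ∈ S, κ v ∉ W → v ∉ β) (hne : S.Nonempty) (hS : ∀ u v, u ∈ S → κ v = κ u → v ∈ S)
    (hdense : 4 * S.card + (S ∩ W).card ≤ 2 * pairs H S S) :
    ∃ u, ∃ c : H.Walk u u, c.IsCycle ∧ cost β c ≤ 6 * (R + 2) + 1 := by
  -- Let `e` count edges, so that `pairs H S S` is twice `e(S)` and the density hypothesis is `e(S)
  -- ≥ |S| + |S ∩ W| / 4`. The induction removes a ball from `S` and keeps the set dense, nonempty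
  -- and closed under clusters.
  by_contra hno
  push Not at hno
  induction hn : S.card using Nat.strong_induction_on generalizing S with
  | _ n ih =>
  subst hn
  obtain ⟨root, hroot⟩ := hne
  let B : ℕ → Finset V := fun r => S.filter (Reach H κ W S root r)
  let D : ℕ → Finset V := fun r => S.filter fun w => w ∉ B r ∧ ∃ u ∈ B r, ∃ v ∈ S, H.Adj u v ∧ κ w = κ v
  have hBS : ∀ r, B r ⊆ S := fun r => Finset.filter_subset _ _
  have hDS : ∀ r, D r ⊆ S := fun r => Finset.filter_subset _ _
  have hmem : ∀ r v, v ∈ B r ↔ Reach H κ W S root r v := by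
    intro r v
    simp only [B, Finset.mem_filter, and_iff_right_iff_imp]
    exact fun h => h.mem hS hroot
  have hBD : ∀ r, Disjoint (B r) (D r) := by
    intro r
    rw [Finset.disjoint_left]
    intro a ha ha'
    simp only [D, Finset.mem_filter] at ha'
    exact ha'.2.1 ha
  have hsub : ∀ r, B r ∪ D r ⊆ B (r + 1) := by
    intro r v hv
    rw [Finset.mem_union] at hv
    rw [hmem]
    rcases hv with hv | hv
    · exact Reach.mono _ _ ((hmem _ _).1 hv)
    · simp only [D, Finset.mem_filter] at hv
      obtain ⟨_, _, u, hu, x, hx, hux, e⟩ := hv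
      exact Reach.heavy _ _ _ _ ((hmem _ _).1 hu) hux hx e
  -- The layer around a ball has only heavy clusters, because light neighbours are absorbed without
  -- increasing the radius.
  have hDW : ∀ r, ∀ w ∈ D r, κ w ∈ W := by
    intro r w hw
    simp only [D, Finset.mem_filter] at hw
    obtain ⟨hwS, hwB, u, hu, x, hx, hux, e⟩ := hw
    by_contra hnW
    have e1 := hsingle w hnW
    have e2 := hsingle x (e ▸ hnW)
    have : w = x := by rw [← e1, ← e2, e]
    subst this
    exact hwB ((hmem _ _).2 (Reach.light _ _ _ ((hmem _ _).1 hu) hux hx hnW))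
  -- Otherwise the number of elements of `W` in the ball would grow by more than the factor 5/4 at
  -- each of the radii up to `R` and exceed `W.card`, by the choice of `R`.
  have hgrow : ∃ r ≤ R, 4 * (D r ∩ W).card ≤ (B r ∩ W).card := by
    by_contra hg
    push Not at hg
    have hstep : ∀ r ≤ R, 5 * (B r ∩ W).card + 1 ≤ 4 * (B (r + 1) ∩ W).card := by
      intro r hr
      have h1 := hg r hr
      have h2 : ((B r ∪ D r) ∩ W).card = (B r ∩ W).card + (D r ∩ W).card := by
        rw [Finset.union_inter_distrib_right, Finset.card_union_of_disjoint]
        exact Finset.disjoint_of_subset_left Finset.inter_subset_left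
          (Finset.disjoint_of_subset_right Finset.inter_subset_left (hBD r))
      have h3 := Finset.card_le_card (Finset.inter_subset_inter_right (u := W) (hsub r))
      omega
    have hpow : ∀ r ≤ R, 5 ^ r ≤ (B (r + 1) ∩ W).card * 4 ^ r := by
      intro r
      induction r with
      | zero =>
        intro _
        have := hstep 0 (Nat.zero_le _)
        simp only [pow_zero, mul_one]
        omega
      | succ r ihr =>
        intro hr
        have h1 := ihr (by omega)
        have h2 := hstep (r + 1) hr
        calc 5 ^ (r + 1) = 5 * 5 ^ r := by ring
          _ ≤ 5 * ((B (r + 1) ∩ W).card * 4 ^ r) := Nat.mul_le_mul_left _ h1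
          _ = (5 * (B (r + 1) ∩ W).card) * 4 ^ r := by ring
          _ ≤ (4 * (B (r + 1 + 1) ∩ W).card) * 4 ^ r := Nat.mul_le_mul_right _ (by omega)
          _ = _ := by ring
    have h1 := hpow R le_rfl
    have h2 : (B (R + 1) ∩ W).card ≤ W.card := Finset.card_le_card Finset.inter_subset_right
    have h3 := Nat.mul_le_mul_right (4 ^ R) h2
    omega
  obtain ⟨r, hrR, hr⟩ := hgrow
  have hrootB : root ∈ B r := by
    rw [hmem]
    clear hr hrR
    induction r with
    | zero => exact Reach.base _ rfl
    | succ r ih => exact Reach.mono _ _ ih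
  -- The ball together with its layer lies within radius `r + 1 ≤ R + 1`, hence within cost `3 * (R
  -- + 2)`; twice this plus one is the bound on the cost of the cycle.
  have hup : pairs H (B r ∪ D r) (B r ∪ D r) + 2 ≤ 2 * (B r ∪ D r).card := by
    refine pairs_le_of_reachable β (D := 3 * (R + 2)) (fun u c hc => ?_) root _
      (Finset.mem_union_left _ hrootB) (fun v hv => ?_)
    · have := hno u c hc
      omega
    · obtain ⟨p, hp⟩ := ((hmem _ _).1 (hsub r hv)).exists_walk β hκ hlight
      exact ⟨p, by omega⟩
  -- Each vertex of the layer outside `W` is joined to its centre, which lies in the layer as well.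
  -- These edges are distinct because a centre is its own centre.
  have hlow : 2 * ((D r).card - (D r ∩ W).card) ≤ pairs H (D r) (D r) := by
    let P := (D r \ W)
    have hP : ∀ v ∈ P, v ∈ D r ∧ κ v ∈ D r ∧ κ v ≠ v ∧ H.Adj v (κ v) := by
      intro v hv
      simp only [P, Finset.mem_sdiff] at hv
      have hne : κ v ≠ v := fun e => hv.2 (e ▸ hDW r v hv.1)
      refine ⟨hv.1, ?_, hne, (hκ v).resolve_left hne⟩
      have hv1 := hv.1
      simp only [D, Finset.mem_filter] at hv1 ⊢
      obtain ⟨h1, h2, u, hu, x, hx, hux, e⟩ := hv1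
      refine ⟨hS _ _ h1 (hκκ v), fun h => h2 ?_, u, hu, x, hx, hux, (hκκ v).trans e⟩
      rw [hmem] at h ⊢
      exact h.congr hsingle _ (hκκ v).symm
    have h1 := card_le_pairs H (D r) (D r) (P.image (fun v => (v, κ v)) ∪ P.image (fun v => (κ v, v))) (by
      intro e he
      simp only [Finset.mem_union, Finset.mem_image] at he
      rcases he with ⟨v, hv, rfl⟩ | ⟨v, hv, rfl⟩
      · exact ⟨(hP v hv).1, (hP v hv).2.1, (hP v hv).2.2.2⟩
      · exact ⟨(hP v hv).2.1, (hP v hv).1, (hP v hv).2.2.2.symm⟩)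
    rw [Finset.card_union_of_disjoint, Finset.card_image_of_injOn, Finset.card_image_of_injOn] at h1
    · have : P.card = (D r).card - (D r ∩ W).card := by
        rw [Finset.card_sdiff, Finset.inter_comm]
      omega
    · intro a _ b _ h; exact (Prod.mk.inj h).2
    · intro a _ b _ h; exact (Prod.mk.inj h).1
    · rw [Finset.disjoint_left]
      intro e he he'
      simp only [Finset.mem_image] at he he'
      obtain ⟨v, hv, rfl⟩ := he
      obtain ⟨u, hu, e⟩ := he'
      obtain ⟨e1, e2⟩ := Prod.mk.inj e
      apply (hP u hu).2.2.1
      rw [e2, ← hκκ v, ← e2, e1, ← e1, hκκ]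
  have hcross : pairs H (B r) (S \ B r) = pairs H (B r) (D r) := by
    unfold pairs
    refine Finset.sum_congr rfl fun u hu => congrArg _ ?_
    ext v
    simp only [D, Finset.mem_filter, Finset.mem_sdiff]
    constructor
    · rintro ⟨⟨h1, h2⟩, h3⟩
      exact ⟨⟨h1, h2, u, hu, v, h1, h3, rfl⟩, h3⟩
    · rintro ⟨⟨h1, h2, -⟩, h3⟩
      exact ⟨⟨h1, h2⟩, h3⟩
  have hSB : B r ∪ (S \ B r) = S := Finset.union_sdiff_of_subset (hBS r)
  -- Subtracting `hlow` from `hup`, at most `|B| + |D ∩ W| - 1 ≤ |B| + |B ∩ W| / 4 - 1` edges meet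
  -- the ball `B`, so density survives its removal. The same count shows that the ball is not all of
  -- `S`.
  have e1 := pairs_union_self H (Finset.disjoint_sdiff (s := B r) (t := S))
  rw [hSB, hcross] at e1
  have e2 := pairs_union_self H (hBD r)
  have e3 := Finset.card_union_of_disjoint (hBD r)
  have e4 := Finset.card_sdiff_add_card_eq_card (hBS r)
  have e5 : (S ∩ W).card = (B r ∩ W).card + ((S \ B r) ∩ W).card := by
    rw [← Finset.card_union_of_disjoint, ← Finset.union_inter_distrib_right, hSB]
    exact Finset.disjoint_of_subset_left Finset.inter_subset_left
          (Finset.disjoint_of_subset_right Finset.inter_subset_left Finset.disjoint_sdiff)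
  have e6 : (D r ∩ W).card ≤ (D r).card := Finset.card_le_card Finset.inter_subset_left
  have hne' : (S \ B r).Nonempty := by
    rw [Finset.nonempty_iff_ne_empty]
    intro he
    rw [he] at e1 e4 e5
    have : pairs H (∅ : Finset V) ∅ = 0 := rfl
    simp only [Finset.empty_inter, Finset.card_empty] at e4 e5
    omega
  have hBpos : 0 < (B r).card := Finset.card_pos.2 ⟨_, hrootB⟩
  refine ih (S \ B r).card (by omega) (S \ B r)
    (fun v hv => hlight v (Finset.mem_sdiff.1 hv).1) hne' ?_ (by omega) rfl
  intro u v hu huv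
  rw [Finset.mem_sdiff] at hu ⊢
  refine ⟨hS _ _ hu.1 huv, fun h => hu.2 ?_⟩
  rw [hmem] at h ⊢
  exact h.congr hsingle _ huv.symm

end ShortCycles
end

/-! ### Cycles with few branch vertices from an elimination order. -/

section

open scoped Classical

namespace ShortCycles

variable {V : Type*}

/-- The vertices of degree at least three in the subgraph induced by `A`. -/
noncomputable def branch (H : SimpleGraph V) (A : Finset V) : Finset V :=
  A.filter fun v => 3 ≤ (A.filter (H.Adj v)).card

theorem sum_degree_ge {H : SimpleGraph V} (A : Finset V)
    (hdeg : ∀ v ∈ A, 2 ≤ (A.filter (H.Adj v)).card) :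
    2 * A.card + (branch H A).card ≤ pairs H A A := by
  rw [branch, Finset.card_filter, mul_comm, ← smul_eq_mul, ← Finset.sum_const,
    ← Finset.sum_add_distrib]
  refine Finset.sum_le_sum fun v hv => ?_
  have := hdeg v hv
  split_ifs <;> omega

variable [DecidableEq V]

/-- The sum counts an edge at its later end only, whereas `pairs` counts it at both ends. -/
theorem two_mul_le_pairs (H : SimpleGraph V) (F : Finset V) (τ : V → ℕ) :
    2 * ∑ f ∈ F, (F.filter fun u => H.Adj f u ∧ τ u < τ f).card ≤ pairs H F F := by
  have h1 : ∑ f ∈ F, (F.filter fun u => H.Adj f u ∧ τ u < τ f).card =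
      ∑ f ∈ F, (F.filter fun u => H.Adj f u ∧ τ f < τ u).card := by
    simp only [Finset.card_filter]
    rw [Finset.sum_comm]
    simp only [H.adj_comm]
  rw [two_mul]
  nth_rewrite 2 [h1]
  rw [← Finset.sum_add_distrib]
  refine Finset.sum_le_sum fun f _ => ?_
  rw [← Finset.card_union_of_disjoint]
  · refine Finset.card_le_card fun u hu => ?_
    simp only [Finset.mem_union, Finset.mem_filter] at hu ⊢
    tauto
  · rw [Finset.disjoint_left]
    intro u hu hu'
    simp only [Finset.mem_filter] at hu hu'
    omega

/-- The edges from the vertices of `Z \ X` to their centres are distinct and lie in `Z`. -/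
theorem two_mul_le_pairs_stars {H : SimpleGraph V} {X Z : Finset V} (κ : V → V)
    (hκ : ∀ z ∈ Z, κ z ∈ X ∧ (κ z = z ∨ H.Adj z (κ z))) (hXZ : X ⊆ Z) :
    2 * (Z.card - X.card) ≤ pairs H Z Z := by
  let P := Z \ X
  have hP : ∀ v ∈ P, v ∈ Z ∧ κ v ∈ X ∧ H.Adj v (κ v) := by
    intro v hv
    simp only [P, Finset.mem_sdiff] at hv
    exact ⟨hv.1, (hκ v hv.1).1, (hκ v hv.1).2.resolve_left fun e => hv.2 (e ▸ (hκ v hv.1).1)⟩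
  have h1 := card_le_pairs H Z Z (P.image (fun v => (v, κ v)) ∪ P.image (fun v => (κ v, v))) (by
    intro e he
    simp only [Finset.mem_union, Finset.mem_image] at he
    rcases he with ⟨v, hv, rfl⟩ | ⟨v, hv, rfl⟩
    · exact ⟨(hP v hv).1, hXZ (hP v hv).2.1, (hP v hv).2.2⟩
    · exact ⟨hXZ (hP v hv).2.1, (hP v hv).1, (hP v hv).2.2.symm⟩)
  rw [Finset.card_union_of_disjoint, Finset.card_image_of_injOn, Finset.card_image_of_injOn,
    Finset.card_sdiff_of_subset hXZ] at h1
  · omega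
  · intro a _ b _ h; exact (Prod.mk.inj h).2
  · intro a _ b _ h; exact (Prod.mk.inj h).1
  · rw [Finset.disjoint_left]
    intro e he he'
    simp only [Finset.mem_image] at he he'
    obtain ⟨v, hv, rfl⟩ := he
    obtain ⟨u, hu, e⟩ := he'
    obtain ⟨e1, -⟩ := Prod.mk.inj e
    simp only [P, Finset.mem_sdiff] at hv
    exact hv.2 (e1 ▸ (hP u hu).2.1)

/-- If a graph of minimum degree two can be dismantled by deleting stars with few centres and
vertices of degree at most one, then it has a cycle with few vertices of degree at least three. -/
theorem exists_cycle_of_elimination {H : SimpleGraph V} (A X Z : Finset V) (τ : V → ℕ)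
    (hX : X.Nonempty)
    (hdeg : ∀ v ∈ A, 2 ≤ (A.filter (H.Adj v)).card)
    (hXZ : X ⊆ Z) (hZA : Z ⊆ A) (hstar : ∀ z ∈ Z, ∃ x ∈ X, z = x ∨ H.Adj z x)
    (hdegen : ∀ v ∈ A \ Z, (A.filter fun u => H.Adj v u ∧ τ v ≤ τ u).card ≤ 1)
    (hinj : ∀ u ∈ A \ Z, ∀ v ∈ A \ Z, τ u = τ v → u = v)
    {R : ℕ} (hR : 4 * X.card * 4 ^ R < 5 ^ R) :
    ∃ u, ∃ c : H.Walk u u, c.IsCycle ∧ cost (branch H A) c ≤ 6 * (R + 2) + 1 := by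
  have hne : A.Nonempty := hX.mono (hXZ.trans hZA)
  have hsum := sum_degree_ge A hdeg
  have hβA : branch H A ⊆ A := Finset.filter_subset _ _
  set β := branch H A with hβ
  -- Each of three cases provides a dense set with at most `4 * X.card` elements in `W`. With few
  -- branch vertices, this is `A` with single vertices as clusters, where every branch vertex
  -- contributes to the excess of the degree sum.
  by_cases h3 : β.card < X.card
  · refine exists_cycle_of_dense β β id (fun _ => Or.inl rfl) (fun _ => rfl)
      (fun _ _ => rfl) (R := R) ?_ A (fun _ _ h => h) hne ?_ ?_
    · refine lt_of_le_of_lt (Nat.mul_le_mul_right _ ?_) hR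
      omega
    · intro u v hu h; exact (show v = u from h) ▸ hu
    · have := Finset.card_le_card (Finset.inter_subset_right (s₁ := A) (s₂ := β))
      omega
  have hex : ∀ z, ∃ x, z ∈ Z → x ∈ X ∧ (x = z ∨ H.Adj z x) := by
    intro z
    by_cases hz : z ∈ Z
    · obtain ⟨x, hx, h⟩ := hstar z hz
      exact ⟨x, fun _ => ⟨hx, h.imp Eq.symm id⟩⟩
    · exact ⟨z, fun h => absurd h hz⟩
  choose g hg using hex
  -- The clusters are the stars into which `Z` is partitioned, and the single vertices outside `Z`.
  let κ : V → V := fun v => if v ∈ Z ∧ v ∉ X then g v else v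
  have κX : ∀ x ∈ X, κ x = x := fun x hx => if_neg fun h => h.2 hx
  have κn : ∀ x, x ∉ Z → κ x = x := fun x hx => if_neg fun h => hx h.1
  have κZ : ∀ z ∈ Z, κ z ∈ X ∧ (κ z = z ∨ H.Adj z (κ z)) := by
    intro z hz
    by_cases hx : z ∈ X
    · rw [κX z hx]; exact ⟨hx, Or.inl rfl⟩
    · have : κ z = g z := if_pos ⟨hz, hx⟩
      rw [this]; exact hg z hz
  have κadj : ∀ v, κ v = v ∨ H.Adj v (κ v) := by
    intro v
    by_cases hz : v ∈ Z
    · exact (κZ v hz).2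
    · exact Or.inl (κn v hz)
  have κκ : ∀ v, κ (κ v) = κ v := by
    intro v
    by_cases hz : v ∈ Z
    · exact κX _ (κZ v hz).1
    · rw [κn v hz, κn v hz]
  have κcl : ∀ u v, κ v = κ u → (u ∈ Z ∧ v ∈ Z) ∨ u = v := by
    intro u v h
    by_cases hu : u ∈ Z
    · by_cases hv : v ∈ Z
      · exact Or.inl ⟨hu, hv⟩
      · rw [κn v hv] at h
        exact absurd (hXZ (h ▸ (κZ u hu).1)) hv
    · by_cases hv : v ∈ Z
      · rw [κn u hu] at h
        exact absurd (hXZ (h ▸ (κZ v hv).1)) hu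
      · rw [κn u hu, κn v hv] at h
        exact Or.inr h.symm
  -- With few branch vertices outside `Z`, the whole of `A` is still dense: both `X` and `(A \ Z) ∩
  -- β` have at most `β.card` elements.
  by_cases h1 : ((A \ Z) ∩ β).card < 3 * X.card
  · refine exists_cycle_of_dense β (X ∪ ((A \ Z) ∩ β)) κ κadj κκ ?_ (R := R) ?_ A ?_ hne ?_ ?_
    · intro v hv
      exact κn v fun h => hv (Finset.mem_union_left _ (κZ v h).1)
    · refine lt_of_le_of_lt (Nat.mul_le_mul_right _ ?_) hR
      have := Finset.card_union_le X ((A \ Z) ∩ β)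
      omega
    · intro v _ hv h
      have hvZ : v ∉ Z := fun h => hv (Finset.mem_union_left _ (κZ v h).1)
      rw [κn v hvZ] at hv
      exact hv (Finset.mem_union_right _
        (Finset.mem_inter.2 ⟨Finset.mem_sdiff.2 ⟨hβA h, hvZ⟩, h⟩))
    · intro u v hu h
      rcases κcl u v h with ⟨_, h⟩ | rfl
      · exact hZA h
      · exact hu
    · have e1 := Finset.card_le_card (Finset.inter_subset_right (s₁ := A) (s₂ := X ∪ ((A \ Z) ∩ β)))
      have e2 := Finset.card_union_le X ((A \ Z) ∩ β)
      have e3 := Finset.card_le_card (Finset.inter_subset_right (s₁ := A \ Z) (s₂ := β))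
      omega
  -- Otherwise only an initial part of the elimination order is used, to keep `W` small. It can be
  -- cut off at exactly `3 * X.card` branch vertices since the times outside `Z` are distinct, so
  -- that `F` grows by at most one vertex at a time.
  · let F : ℕ → Finset V := fun T => (A \ Z).filter fun f => τ f < T
    have hex : ∃ T, 3 * X.card ≤ (F T ∩ β).card := by
      refine ⟨(A.sup τ) + 1, ?_⟩
      have : F (A.sup τ + 1) = A \ Z := by
        refine Finset.filter_true_of_mem fun f hf => ?_
        exact Nat.lt_succ_of_le (Finset.le_sup (f := τ) (Finset.mem_sdiff.1 hf).1)
      rw [this]; omega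
    obtain ⟨T, hT⟩ : ∃ T, (F T ∩ β).card = 3 * X.card := by
      refine ⟨Nat.find hex, le_antisymm ?_ (Nat.find_spec hex)⟩
      rcases Nat.eq_zero_or_pos (Nat.find hex) with h0 | h0
      · rw [h0]
        have : F 0 = ∅ := Finset.filter_false_of_mem fun f _ => by omega
        simp [this]
      · have hmin := Nat.find_min hex (m := Nat.find hex - 1) (by omega)
        set T := Nat.find hex
        have hsub : F T \ F (T - 1) ⊆ (A \ Z).filter fun f => τ f = T - 1 := by
          intro f hf
          simp only [F, Finset.mem_sdiff, Finset.mem_filter] at hf ⊢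
          refine ⟨hf.1.1, ?_⟩
          have := hf.2
          have h2 : ¬ τ f < T - 1 := fun h => this ⟨hf.1.1, h⟩
          have := hf.1.2
          omega
        have hone : ((A \ Z).filter fun f => τ f = T - 1).card ≤ 1 := by
          rw [Finset.card_le_one]
          intro a ha b hb
          rw [Finset.mem_filter] at ha hb
          exact hinj a ha.1 b hb.1 (ha.2.trans hb.2.symm)
        have h4 : F T ∩ β ⊆ (F (T - 1) ∩ β) ∪ (F T \ F (T - 1)) := by
          intro f hf
          simp only [Finset.mem_union, Finset.mem_inter, Finset.mem_sdiff] at hf ⊢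
          tauto
        have h5 := (Finset.card_le_card h4).trans (Finset.card_union_le _ _)
        have h6 := Finset.card_le_card hsub
        omega
    have hFA : F T ⊆ A \ Z := Finset.filter_subset _ _
    have hFZ : Disjoint (F T) Z :=
      Finset.disjoint_of_subset_left hFA Finset.sdiff_disjoint
    have hlow := two_mul_le_pairs H (F T) τ
    have hlowZ := two_mul_le_pairs_stars κ κZ hXZ
    -- All but at most one of the neighbours of `f` in `A` lie in `Z` or earlier in `F`. Summing up,
    -- `e(F) + e(F, Z) ≥ |F| + 3 |X|`; together with `e(Z) ≥ |Z| - |X|` from the stars this gives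
    -- `e(F ∪ Z) ≥ |F ∪ Z| + 2 |X|`, while density needs only an excess of `|X|`.
    have hdeg' : ∑ f ∈ F T, (1 + if f ∈ β then 1 else 0) ≤
        ∑ f ∈ F T, (((F T).filter fun u => H.Adj f u ∧ τ u < τ f).card +
          (Z.filter (H.Adj f)).card) := by
      refine Finset.sum_le_sum fun f hf => ?_
      have h4 := hdegen f (hFA hf)
      have hfA := (Finset.mem_sdiff.1 (hFA hf)).1
      have h5 := hdeg f hfA
      have h6 : f ∈ β → 3 ≤ (A.filter (H.Adj f)).card := fun h => (Finset.mem_filter.1 h).2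
      have h7 : A.filter (H.Adj f) ⊆ (A.filter fun u => H.Adj f u ∧ τ f ≤ τ u) ∪
          (((F T).filter fun u => H.Adj f u ∧ τ u < τ f) ∪ Z.filter (H.Adj f)) := by
        intro u hu
        have hfT := (Finset.mem_filter.1 hf).2
        simp only [F, Finset.mem_union, Finset.mem_filter, Finset.mem_sdiff] at hu ⊢
        by_cases huZ : u ∈ Z
        · exact Or.inr (Or.inr ⟨huZ, hu.2⟩)
        · rcases lt_or_ge (τ u) (τ f) with h | h
          · exact Or.inr (Or.inl ⟨⟨⟨hu.1, huZ⟩, h.trans hfT⟩, hu.2, h⟩)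
          · exact Or.inl ⟨hu.1, hu.2, h⟩
      have h8 := (Finset.card_le_card h7).trans (Finset.card_union_le _ _)
      have h9 := Finset.card_union_le ((F T).filter fun u => H.Adj f u ∧ τ u < τ f)
        (Z.filter (H.Adj f))
      split_ifs with hfβ
      · have := h6 hfβ; omega
      · omega
    rw [Finset.sum_add_distrib, Finset.sum_add_distrib, ← Finset.card_filter,
      Finset.filter_mem_eq_inter] at hdeg'
    simp only [Finset.sum_const, smul_eq_mul, mul_one] at hdeg'
    have hcross : pairs H (F T) Z = ∑ f ∈ F T, (Z.filter (H.Adj f)).card := rfl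
    refine exists_cycle_of_dense β (X ∪ (F T ∩ β)) κ κadj κκ ?_ (R := R) ?_ (F T ∪ Z) ?_
      ((hX.mono hXZ).mono Finset.subset_union_right) ?_ ?_
    · intro v hv
      exact κn v fun h => hv (Finset.mem_union_left _ (κZ v h).1)
    · refine lt_of_le_of_lt (Nat.mul_le_mul_right _ ?_) hR
      have := Finset.card_union_le X (F T ∩ β)
      omega
    · intro v hvS hv h
      have hvZ : v ∉ Z := fun h => hv (Finset.mem_union_left _ (κZ v h).1)
      rw [κn v hvZ] at hv
      exact hv (Finset.mem_union_right _
        (Finset.mem_inter.2 ⟨(Finset.mem_union.1 hvS).resolve_right hvZ, h⟩))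
    · intro u v hu h
      rcases κcl u v h with ⟨_, h⟩ | rfl
      · exact Finset.mem_union_right _ h
      · exact hu
    · have e1 := Finset.card_le_card
        (Finset.inter_subset_right (s₁ := F T ∪ Z) (s₂ := X ∪ (F T ∩ β)))
      have e2 := Finset.card_union_le X (F T ∩ β)
      have e3 := pairs_union_self H hFZ
      have e4 := Finset.card_union_of_disjoint hFZ
      have e5 := Finset.card_le_card hXZ
      omega

end ShortCycles
end

/-! ### The number of centres of a dismantling. -/

section

open scoped Classical

namespace ShortCycles

variable {V : Type*}

/-- The subgraph of `G` on the vertices deleted at time `i` or later. -/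
def aliveGraph (G : SimpleGraph V) (τ : V → ℕ) (i : ℕ) : SimpleGraph V where
  Adj u v := G.Adj u v ∧ i ≤ τ u ∧ i ≤ τ v
  symm := ⟨fun _ _ h => ⟨h.1.symm, h.2.2, h.2.1⟩⟩
  loopless := ⟨fun _ h => h.1.ne rfl⟩

theorem aliveGraph_adj {G : SimpleGraph V} {τ : V → ℕ} {i : ℕ} {u v : V} :
    (aliveGraph G τ i).Adj u v ↔ G.Adj u v ∧ i ≤ τ u ∧ i ≤ τ v := Iff.rfl

variable [Fintype V]

/-- The vertices deleted at time `i` or later. -/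
def alive (τ : V → ℕ) (i : ℕ) : Finset V := Finset.univ.filter fun v => i ≤ τ v

theorem mem_alive {τ : V → ℕ} {i : ℕ} {v : V} : v ∈ alive τ i ↔ i ≤ τ v := by simp [alive]

/-- The neighbours of `v` deleted at time `i` or later. -/
noncomputable def aliveNbrs (G : SimpleGraph V) (τ : V → ℕ) (i : ℕ) (v : V) : Finset V :=
  Finset.univ.filter fun u => G.Adj v u ∧ i ≤ τ u

theorem mem_aliveNbrs {G : SimpleGraph V} {τ : V → ℕ} {i : ℕ} {v u : V} :
    u ∈ aliveNbrs G τ i v ↔ G.Adj v u ∧ i ≤ τ u := by simp [aliveNbrs]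

theorem filter_aliveGraph (G : SimpleGraph V) (τ : V → ℕ) (i : ℕ) {v : V} (hv : i ≤ τ v) :
    (alive τ i).filter ((aliveGraph G τ i).Adj v) = aliveNbrs G τ i v := by
  ext u
  simp only [Finset.mem_filter, mem_alive, aliveGraph_adj, mem_aliveNbrs]
  tauto

/-- The vertices of degree at least three among those deleted at time `i` or later. -/
noncomputable def aliveBranch (G : SimpleGraph V) (τ : V → ℕ) (i : ℕ) : Finset V :=
  Finset.univ.filter fun v => i ≤ τ v ∧ 3 ≤ (aliveNbrs G τ i v).card

theorem branch_aliveGraph (G : SimpleGraph V) (τ : V → ℕ) (i : ℕ) :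
    branch (aliveGraph G τ i) (alive τ i) = aliveBranch G τ i := by
  ext v
  simp only [branch, Finset.mem_filter, mem_alive, aliveBranch, Finset.mem_univ, true_and]
  refine and_congr_right fun h => ?_
  rw [filter_aliveGraph G τ i h]

variable [DecidableEq V]

/-- Minimum degree two yields at least as many edges as vertices; this is the region-growing lemma
without heavy clusters and with all costs zero. -/
theorem exists_isCycle_of_degree {G : SimpleGraph V} {τ : V → ℕ} {i : ℕ} {v : V} (hv : i ≤ τ v)
    (hdeg : ∀ v, i ≤ τ v → 2 ≤ (aliveNbrs G τ i v).card) :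
    ∃ u, ∃ c : (aliveGraph G τ i).Walk u u, c.IsCycle := by
  have hsum := sum_degree_ge (H := aliveGraph G τ i) (alive τ i) (fun v hv => by
    rw [mem_alive] at hv
    rw [filter_aliveGraph G τ i hv]
    exact hdeg v hv)
  obtain ⟨u, c, hc, -⟩ := exists_cycle_of_dense (H := aliveGraph G τ i) ∅ ∅ id (fun _ => Or.inl rfl)
    (fun _ => rfl) (fun _ _ => rfl) (R := 0) (by simp) (alive τ i) (by simp)
    ⟨v, mem_alive.2 hv⟩ (fun u v hu h => (show v = u from h) ▸ hu) (by
      simp only [Finset.inter_empty, Finset.card_empty]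
      omega)
  exact ⟨u, c, hc⟩

/-- The deletion times `τ` come from deleting, one after the other, vertices of degree at most one
(those outside `Z`) and closed neighbourhoods of sets of centres (collected in `X`); the latter
happens only when the minimum degree is two, and uses no more centres than there are vertices of
degree at least three, plus one, on any remaining cycle. -/
structure IsDismantling (G : SimpleGraph V) (τ : V → ℕ) (X Z : Finset V) : Prop where
  subset : X ⊆ Z
  star : ∀ z ∈ Z, ∃ x ∈ X, τ x = τ z ∧ (z = x ∨ G.Adj z x)
  degen : ∀ v ∉ Z, (aliveNbrs G τ (τ v) v).card ≤ 1
  inj : ∀ u ∉ Z, ∀ v ∉ Z, τ u = τ v → u = v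
  degree : ∀ x ∈ X, ∀ v, τ x ≤ τ v → 2 ≤ (aliveNbrs G τ (τ x) v).card
  short : ∀ x ∈ X, ∀ u, ∀ c : (aliveGraph G τ (τ x)).Walk u u, c.IsCycle →
    (X.filter fun y => τ y = τ x).card ≤ cost (aliveBranch G τ (τ x)) c + 1

/-- Whatever is deleted from time `τ x` on dismantles the graph remaining at that time, so
`exists_cycle_of_elimination` finds a cycle there with few branch vertices. By `short` it bounds the
number of centres with this time; summing over the times gives the claim. -/
theorem IsDismantling.card_le {G : SimpleGraph V} {τ : V → ℕ} {X Z : Finset V}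
    (h : IsDismantling G τ X Z) {R : ℕ} (hR : 4 * X.card * 4 ^ R < 5 ^ R) :
    X.card ≤ (6 * (R + 2) + 2) * (X.image τ).card := by
  refine Finset.card_le_mul_card_image X _ fun i hi => ?_
  obtain ⟨x, hx, rfl⟩ := Finset.mem_image.1 hi
  obtain ⟨i, hxi⟩ : ∃ i, i = τ x := ⟨_, rfl⟩
  rw [← hxi]
  have hfil : ∀ v, v ∈ alive τ i → v ∉ Z.filter (fun z => i ≤ τ z) → v ∉ Z := by
    intro v hv hvZ hz
    exact hvZ (Finset.mem_filter.2 ⟨hz, mem_alive.1 hv⟩)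
  obtain ⟨u, c, hc, hcost⟩ := exists_cycle_of_elimination (H := aliveGraph G τ i) (alive τ i)
    (X.filter fun y => i ≤ τ y) (Z.filter fun y => i ≤ τ y) τ
    ⟨x, Finset.mem_filter.2 ⟨hx, hxi.le⟩⟩ (fun v hv => by
      rw [mem_alive] at hv
      rw [filter_aliveGraph G τ i hv]
      rw [hxi] at hv ⊢
      exact h.degree x hx v hv) (Finset.filter_subset_filter _ h.subset)
    (fun v hv => mem_alive.2 (Finset.mem_filter.1 hv).2) (fun z hz => by
      rw [Finset.mem_filter] at hz
      obtain ⟨y, hy, e, hyz⟩ := h.star z hz.1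
      refine ⟨y, Finset.mem_filter.2 ⟨hy, e ▸ hz.2⟩, hyz.imp id fun a => ⟨a, hz.2, e ▸ hz.2⟩⟩)
    (fun v hv => by
      rw [Finset.mem_sdiff] at hv
      refine (Finset.card_le_card ?_).trans (h.degen v (hfil v hv.1 hv.2))
      intro y hy
      simp only [Finset.mem_filter, aliveGraph_adj] at hy
      exact mem_aliveNbrs.2 ⟨hy.2.1.1, hy.2.2⟩)
    (fun v hv w hw => by
      rw [Finset.mem_sdiff] at hv hw
      exact h.inj v (hfil v hv.1 hv.2) w (hfil w hw.1 hw.2)) (R := R)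
    (lt_of_le_of_lt (Nat.mul_le_mul_right _ (Nat.mul_le_mul_left _
      (Finset.card_le_card (Finset.filter_subset _ _)))) hR)
  have h1 := h.short x hx
  rw [← hxi] at h1
  have h1 := h1 u c hc
  rw [branch_aliveGraph] at hcost
  omega

/-- The exponent is four times a number `a` with `4 * M < 2 ^ a`, and the fourth power of 5/4
exceeds 2, as 512 ≤ 625 shows. -/
theorem exists_pow_lt (M : ℕ) : 4 * M * 4 ^ (4 * (Nat.log 2 (4 * M) + 1)) <
    5 ^ (4 * (Nat.log 2 (4 * M) + 1)) := by
  set a := Nat.log 2 (4 * M) + 1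
  have h1 : 4 * M < 2 ^ a := Nat.lt_pow_succ_log_self (by norm_num) _
  calc 4 * M * 4 ^ (4 * a) < 2 ^ a * 4 ^ (4 * a) := Nat.mul_lt_mul_of_pos_right h1 (by positivity)
    _ = 512 ^ a := by rw [pow_mul, ← mul_pow]; norm_num
    _ ≤ 625 ^ a := Nat.pow_le_pow_left (by norm_num) _
    _ = 5 ^ (4 * a) := by rw [pow_mul]; norm_num

/-- With this exponent, `card_le` becomes `M ≤ (24 log₂ (4 M) + 38) k`, which remains to be solved
for `M`. -/
theorem IsDismantling.card_le_log {G : SimpleGraph V} {τ : V → ℕ} {X Z : Finset V}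
    (h : IsDismantling G τ X Z) {k : ℕ} (hk : 0 < k) (hXk : (X.image τ).card ≤ k) :
    (X.card : ℝ) ≤ 11000 * k * Real.log (k + 1) := by
  rcases Nat.eq_zero_or_pos X.card with h0 | hM
  · rw [h0]
    have := Real.log_nonneg (show (1 : ℝ) ≤ k + 1 by linarith [(Nat.cast_nonneg k : (0 : ℝ) ≤ k)])
    push_cast
    positivity
  have h1 := (h.card_le (exists_pow_lt X.card)).trans (Nat.mul_le_mul_left _ hXk)
  set M := X.card
  have hMR : (0 : ℝ) < M := by exact_mod_cast hM
  have hkR : (1 : ℝ) ≤ k := by exact_mod_cast hk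
  have h2 : (M : ℝ) ≤ (24 * (Nat.log 2 (4 * M) : ℝ) + 38) * k := by
    have : (M : ℝ) ≤ ((6 * (4 * (Nat.log 2 (4 * M) + 1) + 2) + 2) * k : ℕ) := by exact_mod_cast h1
    push_cast at this
    linarith
  have hlog2 := Real.log_two_gt_d9
  have h3 : (Nat.log 2 (4 * M) : ℝ) * Real.log 2 ≤ Real.log (4 * M) := by
    rw [← Real.log_pow]
    refine Real.log_le_log (by positivity) ?_
    exact_mod_cast Nat.pow_log_le_self 2 (by omega)
  -- As 24 / log 2 < 35, the factor 70 is chosen so that the term `35 * (y / 70) = y / 2` coming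
  -- from `log (y / 70) ≤ y / 70 - 1` can be absorbed. The remaining constants are at most a
  -- multiple of `log (k + 1) ≥ log 2`.
  obtain ⟨y, hy, hMy⟩ : ∃ y : ℝ, 0 < y ∧ (M : ℝ) = y * k :=
    ⟨M / k, div_pos hMR (by linarith), by field_simp⟩
  have h4 : Real.log (4 * M) ≤ 3 + Real.log k + (y / 70 + 69) := by
    have e : (4 * M : ℝ) = 4 * (k * ((y / 70) * 70)) := by rw [hMy]; ring
    rw [e, Real.log_mul (by norm_num) (by positivity), Real.log_mul (by positivity) (by positivity),
      Real.log_mul (by positivity) (by norm_num)]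
    have a1 := Real.log_le_sub_one_of_pos (show (0 : ℝ) < 4 by norm_num)
    have a2 := Real.log_le_sub_one_of_pos (show (0 : ℝ) < 70 by norm_num)
    have a3 := Real.log_le_sub_one_of_pos (show (0 : ℝ) < y / 70 by positivity)
    linarith
  have h5 : Real.log k ≤ Real.log (k + 1) := Real.log_le_log (by linarith) (by linarith)
  have h6 : Real.log 2 ≤ Real.log (k + 1) := Real.log_le_log (by norm_num) (by linarith)
  have h7 : y ≤ 24 * (Nat.log 2 (4 * M) : ℝ) + 38 := by
    rw [hMy] at h2
    exact le_of_mul_le_mul_right h2 (by linarith)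
  have h8 : 24 * (Nat.log 2 (4 * M) : ℝ) ≤ 35 * Real.log (4 * M) := by
    have : (0 : ℝ) ≤ Nat.log 2 (4 * M) := Nat.cast_nonneg _
    nlinarith
  have h9 : y ≤ 11000 * Real.log (k + 1) := by linarith
  rw [hMy]
  have := mul_le_mul_of_nonneg_right h9 (show (0 : ℝ) ≤ k by linarith)
  linarith

end ShortCycles
end

/-! ### The tree-decomposition and its independence number. -/

section

open scoped Classical

namespace ShortCycles

/-- The graph joining every element to its parent. -/
def parentGraph {ι : Type*} (par : ι → ι) : SimpleGraph ι where
  Adj a b := a ≠ b ∧ (par a = b ∨ par b = a)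
  symm := ⟨fun _ _ h => ⟨h.1.symm, h.2.symm⟩⟩
  loopless := ⟨fun _ h => h.1 rfl⟩

theorem parentGraph_adj {ι : Type*} {par : ι → ι} {a b : ι} :
    (parentGraph par).Adj a b ↔ a ≠ b ∧ (par a = b ∨ par b = a) := Iff.rfl

/-- Ranks increase along parents, so every node reaches the root. Each edge joins a node other than
the root to its parent, so there are fewer edges than nodes, and a connected graph with so few edges
is a tree. -/
theorem parentGraph_isTree {ι : Type*} [Finite ι] (par : ι → ι) (root : ι) (ρ : ι → ℕ)
    (hroot : par root = root) (h : ∀ a, a ≠ root → ρ a < ρ (par a)) :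
    (parentGraph par).IsTree := by
  have hconn : (parentGraph par).Connected := by
    have hmax : ∃ N, ∀ a, ρ a ≤ N := by
      obtain ⟨N, hN⟩ := (Set.finite_range ρ).bddAbove
      exact ⟨N, fun a => hN ⟨a, rfl⟩⟩
    obtain ⟨N, hN⟩ := hmax
    have hreach : ∀ d a, N - ρ a = d → (parentGraph par).Reachable a root := by
      intro d
      induction d using Nat.strong_induction_on with
      | _ d ih =>
      intro a ha
      by_cases e : a = root
      · subst e; rfl
      · have h1 := h a e
        have h2 := hN (par a)
        have hadj : (parentGraph par).Adj a (par a) := ⟨fun e' => by rw [← e'] at h1; omega, Or.inl rfl⟩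
        exact hadj.reachable.trans (ih (N - ρ (par a)) (by omega) _ rfl)
    have : Nonempty ι := ⟨root⟩
    exact ⟨fun a b => (hreach _ a rfl).trans (hreach _ b rfl).symm⟩
  rw [SimpleGraph.isTree_iff_connected_and_card]
  refine ⟨hconn, le_antisymm ?_ hconn.card_vert_le_card_edgeSet_add_one⟩
  have hsurj : Function.Surjective (fun a : {a // a ≠ root} =>
      (⟨s(a.1, par a.1), by
        have := h a.1 a.2
        exact ⟨fun e => this.ne (congrArg ρ e), Or.inl rfl⟩⟩ : (parentGraph par).edgeSet)) := by
    rintro ⟨e, he⟩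
    induction e using Sym2.ind with
    | _ x y =>
    rw [SimpleGraph.mem_edgeSet] at he
    rcases he with ⟨hne, h1 | h1⟩
    · refine ⟨⟨x, ?_⟩, ?_⟩
      · rintro rfl; exact hne (hroot.symm.trans h1)
      · simp only [h1]
    · refine ⟨⟨y, ?_⟩, ?_⟩
      · rintro rfl; exact hne (h1.symm.trans hroot)
      · simp only [h1, Sym2.eq_swap]
  have h1 : Nat.card (parentGraph par).edgeSet ≤ _ := Nat.card_le_card_of_surjective _ hsurj
  have h2 : Nat.card {a // a ≠ root} + 1 = Nat.card ι := by
    have := Fintype.ofFinite ι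
    rw [Nat.card_eq_fintype_card, Nat.card_eq_fintype_card, Fintype.card_subtype_compl,
      Fintype.card_subtype_eq]
    have := Fintype.card_pos_iff.2 ⟨root⟩
    omega
  have h3 : Nat.card (parentGraph par).edgeSet + 1 ≤ Nat.card ι := by omega
  exact h3

/-- `E` gives every vertex outside `Z` its neighbour deleted later, if there is one. -/
structure IsParent {n : ℕ} (G : SimpleGraph (Fin n)) (τ : Fin n → ℕ) (Z : Finset (Fin n))
    (E : Fin n → Fin (n + 1)) : Prop where
  lt : ∀ v u, E v = Fin.castSucc u → τ v < τ u
  cover : ∀ v ∉ Z, ∀ u ∉ Z, G.Adj v u → τ v ≤ τ u → E v = Fin.castSucc u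

/-- The parent function on the nodes of the tree-decomposition. -/
def nodeParent {n : ℕ} (E : Fin n → Fin (n + 1)) : Fin (n + 1) → Fin (n + 1) :=
  Fin.lastCases (Fin.last n) E

theorem nodeParent_last {n : ℕ} (E : Fin n → Fin (n + 1)) :
    nodeParent E (Fin.last n) = Fin.last n := by simp [nodeParent]

theorem nodeParent_castSucc {n : ℕ} (E : Fin n → Fin (n + 1)) (v : Fin n) :
    nodeParent E v.castSucc = E v := by simp [nodeParent]

/-- The bag of a node: the vertices of `Z`, the node itself and its parent. -/
def nodeBag {n : ℕ} (Z : Finset (Fin n)) (E : Fin n → Fin (n + 1)) (a : Fin (n + 1)) :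
    Set (Fin n) :=
  {v | v ∈ Z ∨ v.castSucc = a ∨ v.castSucc = nodeParent E a}

theorem connected_induce_of_star {ι : Type*} (T : SimpleGraph ι) (s : Set ι) (c : ι) (hc : c ∈ s)
    (h : ∀ a ∈ s, a = c ∨ T.Adj a c) : (T.induce s).Connected := by
  have hr : ∀ a : s, (T.induce s).Reachable a ⟨c, hc⟩ := by
    rintro ⟨a, ha⟩
    rcases h a ha with rfl | h
    · rfl
    · exact SimpleGraph.Adj.reachable (show (T.induce s).Adj ⟨a, ha⟩ ⟨c, hc⟩ from h)
  have : Nonempty s := ⟨⟨c, hc⟩⟩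
  exact ⟨fun a b => (hr a).trans (hr b).symm⟩

/-- The tree-decomposition given by a dismantling. -/
def IsParent.treeDecomposition {n : ℕ} {G : SimpleGraph (Fin n)} {τ : Fin n → ℕ}
    {Z : Finset (Fin n)} {E : Fin n → Fin (n + 1)} (h : IsParent G τ Z E) :
    TreeDecomposition G (Fin (n + 1)) where
  tree := parentGraph (nodeParent E)
  bag := nodeBag Z E
  isTree := by
    let N := Finset.univ.sup τ + 1
    have hN : ∀ v, τ v < N := fun v => Nat.lt_succ_of_le (Finset.le_sup (f := τ) (Finset.mem_univ v))
    -- The additional node `n` serves as the root; its rank exceeds all deletion times.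
    refine parentGraph_isTree _ (Fin.last n) (Fin.lastCases N τ) (nodeParent_last E) fun a ha => ?_
    induction a using Fin.lastCases with
    | last => exact absurd rfl ha
    | cast v =>
      rw [nodeParent_castSucc]
      rcases Fin.eq_castSucc_or_eq_last (E v) with ⟨u, hu⟩ | hu
      · rw [hu]; simpa using h.lt v u hu
      · rw [hu]; simpa using hN v
  cover := by
    refine Set.eq_univ_of_forall fun v => Set.mem_iUnion.2 ⟨v.castSucc, Or.inr (Or.inl rfl)⟩
  edge := by
    have key : ∀ u v, G.Adj u v → τ u ≤ τ v → ∃ a, {u, v} ⊆ nodeBag Z E a := by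
      intro u v huv hle
      by_cases hu : u ∈ Z
      · refine ⟨v.castSucc, ?_⟩
        rintro x (rfl | rfl)
        · exact Or.inl hu
        · exact Or.inr (Or.inl rfl)
      · refine ⟨u.castSucc, ?_⟩
        rintro x (rfl | rfl)
        · exact Or.inr (Or.inl rfl)
        · by_cases hv : x ∈ Z
          · exact Or.inl hv
          · exact Or.inr (Or.inr (by rw [nodeParent_castSucc, h.cover u hu x hv huv hle]))
    intro u v huv
    rcases le_total (τ u) (τ v) with hle | hle
    · exact key u v huv hle
    · obtain ⟨a, ha⟩ := key v u huv.symm hle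
      exact ⟨a, Set.pair_comm u v ▸ ha⟩
  subtree := by
    intro v
    by_cases hv : v ∈ Z
    · have hset : {a | v ∈ nodeBag Z E a} = Set.univ := Set.eq_univ_of_forall fun a => Or.inl hv
      rw [hset]
      refine (SimpleGraph.Iso.connected_iff (SimpleGraph.induceUnivIso _)).2 ?_
      let N := Finset.univ.sup τ + 1
      have hN : ∀ v, τ v < N :=
        fun v => Nat.lt_succ_of_le (Finset.le_sup (f := τ) (Finset.mem_univ v))
      refine (parentGraph_isTree _ (Fin.last n) (Fin.lastCases N τ) (nodeParent_last E)
        fun a ha => ?_).1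
      induction a using Fin.lastCases with
      | last => exact absurd rfl ha
      | cast v =>
        rw [nodeParent_castSucc]
        rcases Fin.eq_castSucc_or_eq_last (E v) with ⟨u, hu⟩ | hu
        · rw [hu]; simpa using h.lt v u hu
        · rw [hu]; simpa using hN v
    -- A vertex outside `Z` occurs in the bag of its own node and in those of the children of this
    -- node, which form a star.
    · refine connected_induce_of_star _ _ v.castSucc (Or.inr (Or.inl rfl)) fun a ha => ?_
      rcases ha with ha | ha | ha
      · exact absurd ha hv
      · exact Or.inl ha.symm
      · by_cases e : a = v.castSucc
        · exact Or.inl e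
        · exact Or.inr ⟨e, Or.inl ha.symm⟩

section Independence

variable {V : Type*} [DecidableEq V]

/-- If the independent set contains `x`, it is `{x}`, and `t` is positive. Otherwise any `t` of its
elements together with `x` induce the forbidden star. -/
theorem card_le_of_subset_closedNbhd {G : SimpleGraph V} {t : ℕ} (ht : 0 < t)
    (hG : ¬ (completeBipartiteGraph (Fin 1) (Fin t)).IsIndContained G) (x : V) (s : Finset V)
    (hs : G.IsIndepSet s) (hx : ∀ v ∈ s, v = x ∨ G.Adj v x) : s.card ≤ t := by
  by_contra hlt
  push Not at hlt
  have hxs : x ∉ s := by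
    intro hxs
    have : s ⊆ {x} := by
      intro v hv
      rw [Finset.mem_singleton]
      by_contra hne
      exact hs (by exact_mod_cast hv) (by exact_mod_cast hxs) hne ((hx v hv).resolve_left hne)
    have := Finset.card_le_card this
    rw [Finset.card_singleton] at this
    omega
  have hadj : ∀ v ∈ s, G.Adj v x := fun v hv =>
    (hx v hv).resolve_left fun e => hxs (e ▸ hv)
  obtain ⟨s', hs', hc⟩ := Finset.exists_subset_card_eq hlt.le
  let e := s'.equivFinOfCardEq hc
  have he : ∀ i, (e.symm i : V) ∈ s := fun i => hs' (e.symm i).2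
  have hinj : Function.Injective (Sum.elim (fun _ => x) (fun i => (e.symm i : V)) :
      Fin 1 ⊕ Fin t → V) := by
    rintro (i | i) (j | j) h
    · rw [Subsingleton.elim i j]
    · simp only [Sum.elim_inl, Sum.elim_inr] at h
      exact absurd (h ▸ he j) hxs
    · simp only [Sum.elim_inl, Sum.elim_inr] at h
      exact absurd (h ▸ he i) hxs
    · simp only [Sum.elim_inr] at h
      rw [e.symm.injective (Subtype.ext h)]
  refine hG ⟨⟨⟨_, hinj⟩, ?_⟩⟩
  rintro (i | i) (j | j)
  · simp
  · simpa using (hadj _ (he j)).symm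
  · simpa using hadj _ (he i)
  · simp only [Function.Embedding.coeFn_mk, Sum.elim_inr, completeBipartiteGraph_adj,
        Sum.isLeft_inr, Bool.false_eq_true, false_and, and_false, or_false, iff_false]
    intro h
    exact hs (by exact_mod_cast he i) (by exact_mod_cast he j) h.ne h

theorem indepNum_induce_le {G : SimpleGraph V} [Fintype V] {t : ℕ} (ht : 0 < t)
    (hG : ¬ (completeBipartiteGraph (Fin 1) (Fin t)).IsIndContained G) (X Y : Finset V) (B : Set V)
    (hB : ∀ v ∈ B, v ∈ Y ∨ ∃ x ∈ X, v = x ∨ G.Adj v x) :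
    (G.induce B).indepNum ≤ X.card * t + Y.card := by
  obtain ⟨s, hs⟩ := (G.induce B).exists_isNIndepSet_indepNum
  rw [← hs.card_eq]
  let s' : Finset V := s.map (Function.Embedding.subtype _)
  have hs' : G.IsIndepSet s' := by
    intro a ha b hb hab
    simp only [s', Finset.coe_map, Set.mem_image, Finset.mem_coe] at ha hb
    obtain ⟨a, ha, rfl⟩ := ha
    obtain ⟨b, hb, rfl⟩ := hb
    exact hs.isIndepSet (by exact_mod_cast ha) (by exact_mod_cast hb) (fun e => hab (e ▸ rfl))
  have hcov : s' ⊆ (X.biUnion fun x => s'.filter fun v => v = x ∨ G.Adj v x) ∪ Y := by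
    intro v hv
    have hvB : v ∈ B := by
      simp only [s', Finset.mem_map] at hv
      obtain ⟨a, _, rfl⟩ := hv
      exact a.2
    simp only [Finset.mem_union, Finset.mem_biUnion, Finset.mem_filter]
    rcases hB v hvB with h | ⟨x, hx, h⟩
    · exact Or.inr h
    · exact Or.inl ⟨x, hx, hv, h⟩
  calc s.card = s'.card := (Finset.card_map _).symm
    _ ≤ _ := Finset.card_le_card hcov
    _ ≤ _ := Finset.card_union_le _ _
    _ ≤ X.card * t + Y.card := by
      refine Nat.add_le_add_right ?_ _
      refine Finset.card_biUnion_le_card_mul _ _ _ fun x _ => ?_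
      refine card_le_of_subset_closedNbhd ht hG x _ (fun a ha b hb => ?_) fun v hv =>
        (Finset.mem_filter.1 hv).2
      rw [Finset.mem_coe, Finset.mem_filter] at ha hb
      exact hs' (by exact_mod_cast ha.1) (by exact_mod_cast hb.1)

end Independence

/-- A bag consists of `Z`, which the closed neighbourhoods of `X` cover, and of at most two vertices
given by the node and its parent. -/
theorem IsParent.independenceNumber_le {n : ℕ} {G : SimpleGraph (Fin n)} {τ : Fin n → ℕ}
    {X Z : Finset (Fin n)} {E : Fin n → Fin (n + 1)} (h : IsParent G τ Z E)
    (hd : IsDismantling G τ X Z) {t : ℕ} (ht : 0 < t)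
    (hG : ¬ (completeBipartiteGraph (Fin 1) (Fin t)).IsIndContained G) :
    h.treeDecomposition.independenceNumber ≤ X.card * t + 2 := by
  refine Finset.sup_le fun a _ => ?_
  have hY : (Finset.univ.filter fun v : Fin n => v.castSucc = a ∨ v.castSucc = nodeParent E a).card
      ≤ 2 := by
    rw [← Finset.card_map Fin.castSuccEmb]
    refine (Finset.card_le_card (t := {a, nodeParent E a}) ?_).trans Finset.card_le_two
    intro b hb
    simp only [Finset.mem_map, Finset.mem_filter, Finset.mem_univ, true_and] at hb
    obtain ⟨v, hv, rfl⟩ := hb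
    simpa using hv
  refine (indepNum_induce_le ht hG X _ (h.treeDecomposition.bag a) fun v hv => ?_).trans
    (Nat.add_le_add_left hY _)
  rcases hv with hv | hv
  · obtain ⟨x, hx, -, hvx⟩ := hd.star v hv
    exact Or.inr ⟨x, hx, hvx⟩
  · exact Or.inl (by simpa using hv)

end ShortCycles
end

/-! ### The chosen cycles form an induced packing. -/

section

open scoped Classical

namespace ShortCycles

variable {V : Type*} [Fintype V]

/-- The cycle `c` was chosen at time `T`: its vertices are present at that time, the closed
neighbourhood of its root and of its vertices of degree at least three is deleted at that time. -/
structure ChosenAt (G : SimpleGraph V) (τ : V → ℕ) (T : ℕ) {r : V} (c : G.Walk r r) : Prop where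
  isCycle : c.IsCycle
  le : ∀ v ∈ c.support, T ≤ τ v
  deleted : ∀ v ∈ c.support, v = r ∨ 3 ≤ (aliveNbrs G τ T v).card →
    τ v = T ∧ ∀ w, G.Adj v w → T ≤ τ w → τ w = T

variable {G : SimpleGraph V} {τ : V → ℕ} {T T' : ℕ} {r : V} {c : G.Walk r r}

/-- A vertex of the cycle that survives until `T'` had degree at most two at time `T` and has degree
at least two at time `T'`. It has thus lost no neighbour, and its successor on the cycle survives
too. Following the cycle to its end, the root would survive, but it was deleted at time `T`. -/
theorem ChosenAt.lt_of_mem_support (h : ChosenAt G τ T c) (hT : T < T')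
    (hdeg : ∀ v, T' ≤ τ v → 2 ≤ (aliveNbrs G τ T' v).card) {v : V} (hv : v ∈ c.support) :
    τ v < T' := by
  by_contra hlt
  push Not at hlt
  have hstep : ∀ i < c.length, T' ≤ τ (c.getVert i) → T' ≤ τ (c.getVert (i + 1)) := by
    intro i hi hle
    have hmem := c.getVert_mem_support i
    have h1 : (aliveNbrs G τ T (c.getVert i)).card ≤ 2 := by
      by_contra h3
      have := (h.deleted _ hmem (Or.inr (by omega))).1
      omega
    have hsub : aliveNbrs G τ T' (c.getVert i) ⊆ aliveNbrs G τ T (c.getVert i) := by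
      intro u hu
      rw [mem_aliveNbrs] at hu ⊢
      exact ⟨hu.1, by omega⟩
    have heq := Finset.eq_of_subset_of_card_le hsub (h1.trans (hdeg _ hle))
    have : c.getVert (i + 1) ∈ aliveNbrs G τ T (c.getVert i) :=
      mem_aliveNbrs.2 ⟨c.adj_getVert_succ hi, h.le _ (c.getVert_mem_support _)⟩
    rw [← heq] at this
    exact (mem_aliveNbrs.1 this).2
  obtain ⟨i, rfl, hi⟩ := SimpleGraph.Walk.mem_support_iff_exists_getVert.1 hv
  have hall : ∀ d, i + d ≤ c.length → T' ≤ τ (c.getVert (i + d)) := by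
    intro d
    induction d with
    | zero => intro _; exact hlt
    | succ d ih =>
      intro hd
      rw [← Nat.add_assoc] at hd ⊢
      exact hstep _ (by omega) (ih (by omega))
  have h2 := hall (c.length - i) (by omega)
  rw [Nat.add_sub_cancel' hi, c.getVert_length] at h2
  have := (h.deleted r c.start_mem_support (Or.inl rfl)).1
  omega

/-- If `v` was a branch vertex, then `w` was deleted together with it. Otherwise the only neighbours
of `v` at time `T` are its two neighbours on the cycle, and none of these survives until `T'`. -/
theorem ChosenAt.not_adj (h : ChosenAt G τ T c) (hT : T < T')
    (hdeg : ∀ v, T' ≤ τ v → 2 ≤ (aliveNbrs G τ T' v).card) {v w : V} (hv : v ∈ c.support)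
    (hw : T' ≤ τ w) : ¬ G.Adj v w := by
  intro hvw
  have h1 : (aliveNbrs G τ T v).card ≤ 2 := by
    by_contra h3
    have := (h.deleted v hv (Or.inr (by omega))).2 w hvw (by omega)
    omega
  have h2 := h.isCycle.ncard_neighborSet_toSubgraph_eq_two hv
  have hsub : c.toSubgraph.neighborSet v ⊆ aliveNbrs G τ T v := by
    intro u hu
    rw [SimpleGraph.Subgraph.mem_neighborSet] at hu
    rw [Finset.mem_coe, mem_aliveNbrs]
    exact ⟨hu.adj_sub, h.le _ (c.mem_verts_toSubgraph.1 hu.snd_mem)⟩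
  have h3 : c.toSubgraph.neighborSet v = aliveNbrs G τ T v := by
    refine Set.eq_of_subset_of_ncard_le hsub ?_ (Finset.finite_toSet _)
    rw [Set.ncard_coe_finset, h2]
    exact h1
  have h4 : w ∈ (aliveNbrs G τ T v : Set V) := by
    rw [Finset.mem_coe, mem_aliveNbrs]
    exact ⟨hvw, by omega⟩
  rw [← h3, SimpleGraph.Subgraph.mem_neighborSet] at h4
  have := h.lt_of_mem_support hT hdeg (c.mem_verts_toSubgraph.1 h4.snd_mem)
  omega

theorem isInducedCyclePacking_of_chosenAt {k : ℕ} {root : Fin k → V}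
    {cyc : ∀ i, G.Walk (root i) (root i)} {T : Fin k → ℕ} (hT : ∀ i j, i < j → T i < T j)
    (h : ∀ i, ChosenAt G τ (T i) (cyc i))
    (hdeg : ∀ i v, T i ≤ τ v → 2 ≤ (aliveNbrs G τ (T i) v).card) :
    IsInducedCyclePacking G root cyc where
  isCycle i := (h i).isCycle
  disjoint := by
    intro i j hij u hu hu'
    rcases lt_or_gt_of_ne hij with hlt | hlt
    · have := (h i).lt_of_mem_support (hT _ _ hlt) (hdeg j) hu
      have := (h j).le u hu'
      omega
    · have := (h j).lt_of_mem_support (hT _ _ hlt) (hdeg i) hu'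
      have := (h i).le u hu
      omega
  no_edge := by
    intro i j hij u hu v hv huv
    rcases lt_or_gt_of_ne hij with hlt | hlt
    · exact (h i).not_adj (hT _ _ hlt) (hdeg j) hu ((h j).le v hv) huv
    · exact (h j).not_adj (hT _ _ hlt) (hdeg i) hv ((h i).le u hu) huv.symm

end ShortCycles
end

/-! ### A language of bounded loops with polynomial running time. -/

/-- Structured programs whose loops run a counter through `0, ..., n - 1`, where `n` is the content
of register 0. -/
inductive LProg where
  | skip
  | assign (x : ℕ) (e : Expr)
  | store (a : ℕ) (i e : Expr)
  | seq (p q : LProg)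
  | ite (e : Expr) (p q : LProg)
  | forN (x : ℕ) (p : LProg)

namespace LProg

/-- The program for the random access machine. -/
def toProg : LProg → Prog
  | skip => .skip
  | assign x e => .assign x e
  | store a i e => .store a i e
  | seq p q => .seq p.toProg q.toProg
  | ite e p q => .ite e p.toProg q.toProg
  | forN x p => .seq (.assign x (.const 0)) (.loop (.sub (.var 0) (.var x))
      (.seq p.toProg (.assign x (.add (.var x) (.const 1)))))

/-- The registers that a program may change. -/
def vars : LProg → List ℕ
  | skip => []
  | assign x _ => [x]
  | store _ _ _ => []
  | seq p q => p.vars ++ q.vars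
  | ite _ p q => p.vars ++ q.vars
  | forN x p => x :: p.vars

/-- The arrays that a program may change. -/
def arrs : LProg → List ℕ
  | skip => []
  | assign _ _ => []
  | store a _ _ => [a]
  | seq p q => p.arrs ++ q.arrs
  | ite _ p q => p.arrs ++ q.arrs
  | forN _ p => p.arrs

/-- No program changes register 0 and no loop body changes the counter. -/
def wf : LProg → Bool
  | skip => true
  | assign x _ => x != 0
  | store _ _ _ => true
  | seq p q => p.wf && q.wf
  | ite _ p q => p.wf && q.wf
  | forN x p => x != 0 && !(p.vars.contains x) && p.wf

/-- The effect of a program. -/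
def den : LProg → Store → Store
  | skip, s => s
  | assign x e, s => s.setVar x (e.eval s)
  | store a i e, s => s.setArr a (i.eval s) (e.eval s)
  | seq p q, s => q.den (p.den s)
  | ite e p q, s => if e.eval s = 0 then q.den s else p.den s
  | forN x p, s => Nat.rec (s.setVar x 0) (fun i st => (p.den st).setVar x (i + 1)) (s.var 0)

/-- A bound on the number of steps, in terms of the content of register 0. -/
def bound : LProg → ℕ → ℕ
  | skip, _ => 1
  | assign _ e, _ => e.cost + 1
  | store _ i e, _ => i.cost + e.cost + 1
  | seq p q, n => p.bound n + q.bound n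
  | ite e p q, n => e.cost + 1 + (p.bound n + q.bound n)
  | forN _ p, n => 6 + n * (p.bound n + 8)

end LProg

@[simp] theorem Store.var_setVar (s : Store) (x v y : ℕ) :
    (s.setVar x v).var y = if y = x then v else s.var y := by
  simp [Store.setVar, Function.update_apply]

@[simp] theorem Store.arr_setVar (s : Store) (x v a : ℕ) : (s.setVar x v).arr a = s.arr a := rfl

@[simp] theorem Store.var_setArr (s : Store) (a i v x : ℕ) : (s.setArr a i v).var x = s.var x := rfl

@[simp] theorem Store.arr_setArr (s : Store) (a i v b : ℕ) :
    (s.setArr a i v).arr b = if b = a then Function.update (s.arr a) i v else s.arr b := by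
  simp [Store.setArr, Function.update_apply]

namespace LProg

theorem den_ite_eq {e : Expr} {p q : LProg} {s : Store} (h : e.eval s = 0) :
    (ite e p q).den s = q.den s := if_pos h

theorem den_ite_ne {e : Expr} {p q : LProg} {s : Store} (h : e.eval s ≠ 0) :
    (ite e p q).den s = p.den s := if_neg h

theorem den_seq (p q : LProg) (s : Store) : (seq p q).den s = q.den (p.den s) := rfl

theorem den_assign (x : ℕ) (e : Expr) (s : Store) :
    (assign x e).den s = s.setVar x (e.eval s) := rfl

theorem den_store (a : ℕ) (i e : Expr) (s : Store) :
    (store a i e).den s = s.setArr a (i.eval s) (e.eval s) := rfl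

theorem den_skip (s : Store) : skip.den s = s := rfl

theorem vars_ne_zero {p : LProg} (h : p.wf = true) : 0 ∉ p.vars := by
  induction p with
  | skip => simp [vars]
  | assign x e => simp [wf] at h; simp [vars]; omega
  | store => simp [vars]
  | seq p q ihp ihq => simp [wf] at h; simp [vars, ihp h.1, ihq h.2]
  | ite e p q ihp ihq => simp [wf] at h; simp [vars, ihp h.1, ihq h.2]
  | forN x p ih => simp [wf] at h; simp [vars, ih h.2]; omega

theorem den_var {p : LProg} {x : ℕ} (h : x ∉ p.vars) (s : Store) : (p.den s).var x = s.var x := by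
  induction p generalizing s with
  | skip => rfl
  | assign y e => simp [vars] at h; simp [den, h]
  | store => rfl
  | seq p q ihp ihq =>
    simp [vars] at h
    rw [den, ihq h.2, ihp h.1]
  | ite e p q ihp ihq =>
    simp [vars] at h
    rw [den]
    split_ifs
    · exact ihq h.2 s
    · exact ihp h.1 s
  | forN y p ih =>
    simp [vars] at h
    rw [den]
    induction s.var 0 with
    | zero => simp [h]
    | succ i ihi => simp only [Store.var_setVar, h, if_false]; rw [ih h.2, ihi]

theorem den_arr {p : LProg} {a : ℕ} (h : a ∉ p.arrs) (s : Store) : (p.den s).arr a = s.arr a := by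
  induction p generalizing s with
  | skip => rfl
  | assign y e => rfl
  | store => simp [arrs] at h; simp [den, h]
  | seq p q ihp ihq =>
    simp [arrs] at h
    rw [den, ihq h.2, ihp h.1]
  | ite e p q ihp ihq =>
    simp [arrs] at h
    rw [den]
    split_ifs
    · exact ihq h.2 s
    · exact ihp h.1 s
  | forN y p ih =>
    simp [arrs] at h
    rw [den]
    induction s.var 0 with
    | zero => rfl
    | succ i ihi => rw [Store.arr_setVar, ih h, ihi]

/-- The rule for loops: an invariant may use that nothing changes except what the body changes. -/
theorem den_forN {x : ℕ} {p : LProg} (s : Store)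
    (I : ℕ → Store → Prop) (h0 : I 0 (s.setVar x 0))
    (hs : ∀ i st, i < s.var 0 → st.var x = i → (∀ y, y ≠ x → y ∉ p.vars → st.var y = s.var y) →
      (∀ a, a ∉ p.arrs → st.arr a = s.arr a) → I i st → I (i + 1) ((p.den st).setVar x (i + 1))) :
    I (s.var 0) ((forN x p).den s) := by
  rw [den]
  suffices H : ∀ m ≤ s.var 0, ∀ F : Store, F = Nat.rec (s.setVar x 0)
      (fun i st => (p.den st).setVar x (i + 1)) m → F.var x = m ∧
      (∀ y, y ≠ x → y ∉ p.vars → F.var y = s.var y) ∧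
      (∀ a, a ∉ p.arrs → F.arr a = s.arr a) ∧ I m F from (H _ le_rfl _ rfl).2.2.2
  intro m
  induction m with
  | zero =>
    rintro _ F rfl
    refine ⟨by simp, fun y hy _ => by simp [hy], fun a _ => rfl, h0⟩
  | succ m ih =>
    rintro hm F rfl
    obtain ⟨h1, h2, h3, h4⟩ := ih (by omega) _ rfl
    refine ⟨by simp, fun y hy hyp => ?_, fun a ha => ?_, hs m _ (by omega) h1 h2 h3 h4⟩
    · simp only [Store.var_setVar, hy, if_false]
      rw [den_var hyp, h2 y hy hyp]
    · rw [Store.arr_setVar, den_arr ha, h3 a ha]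

/-- A loop makes exactly `n` iterations because its body changes neither register 0 nor the counter.
Of the constants in `bound`, 6 stands for the initialization and the last test, 8 for the test and
the increment in each iteration. -/
theorem exec {p : LProg} (h : p.wf = true) (s : Store) :
    ∃ c, Prog.Exec p.toProg s c (p.den s) ∧ c ≤ p.bound (s.var 0) := by
  induction p generalizing s with
  | skip => exact ⟨_, .skip s, le_rfl⟩
  | assign x e => exact ⟨_, .assign s x e, le_rfl⟩
  | store a i e => exact ⟨_, .store s a i e, le_rfl⟩
  | seq p q ihp ihq =>
    have hw := h
    simp [wf] at h
    obtain ⟨c1, e1, b1⟩ := ihp h.1 s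
    obtain ⟨c2, e2, b2⟩ := ihq h.2 (p.den s)
    rw [den_var (vars_ne_zero h.1)] at b2
    exact ⟨_, .seq e1 e2, Nat.add_le_add b1 b2⟩
  | ite e p q ihp ihq =>
    simp [wf] at h
    rw [toProg, den, bound]
    split_ifs with he
    · obtain ⟨c2, e2, b2⟩ := ihq h.2 s
      exact ⟨_, .ite_false he e2, by omega⟩
    · obtain ⟨c1, e1, b1⟩ := ihp h.1 s
      exact ⟨_, .ite_true he e1, by omega⟩
  | forN x p ih =>
    simp [wf] at h
    obtain ⟨⟨hx0, hxp⟩, hp⟩ := h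
    let F : ℕ → Store := fun m => Nat.rec (s.setVar x 0) (fun i st => (p.den st).setVar x (i + 1)) m
    have hF : ∀ m, (F m).var x = m ∧ (F m).var 0 = s.var 0 := by
      intro m
      induction m with
      | zero => exact ⟨by simp [F], by simp [F, Ne.symm hx0]⟩
      | succ m ihm =>
        refine ⟨by simp [F], ?_⟩
        change ((p.den (F m)).setVar x (m + 1)).var 0 = _
        rw [Store.var_setVar, if_neg (Ne.symm hx0), den_var (vars_ne_zero hp), ihm.2]
    have hloop : ∀ d m, m + d = s.var 0 → ∃ c, Prog.Exec (.loop (.sub (.var 0) (.var x))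
        (.seq p.toProg (.assign x (.add (.var x) (.const 1))))) (F m) c (F (s.var 0)) ∧
        c ≤ 4 + d * (p.bound (s.var 0) + 8) := by
      intro d
      induction d with
      | zero =>
        intro m hm
        obtain rfl : m = s.var 0 := by omega
        refine ⟨_, .loop_done (by simp [Expr.eval, hF]), by simp [Expr.cost]⟩
      | succ d ihd =>
        intro m hm
        obtain ⟨c2, e2, b2⟩ := ihd (m + 1) (by omega)
        obtain ⟨c1, e1, b1⟩ := ih hp (F m)
        rw [(hF m).2] at b1
        have e3 : F (m + 1) = (p.den (F m)).setVar x
            ((Expr.add (.var x) (.const 1)).eval (p.den (F m))) := by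
          simp only [Expr.eval]
          rw [den_var hxp, (hF m).1]
        rw [e3] at e2
        refine ⟨_, .loop_step (by simp only [Expr.eval, hF]; omega) (.seq e1 (.assign _ _ _)) e2, ?_⟩
        simp only [Expr.cost]
        rw [Nat.succ_mul]
        omega
    obtain ⟨c, e, b⟩ := hloop (s.var 0) 0 (by omega)
    refine ⟨_, .seq (.assign s x (.const 0)) e, ?_⟩
    simp only [Expr.cost, bound]
    omega

theorem eval_mono (P : Polynomial ℕ) {m n : ℕ} (h : m ≤ n) : P.eval m ≤ P.eval n := by
  rw [Polynomial.eval_eq_sum, Polynomial.eval_eq_sum]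
  exact Finset.sum_le_sum fun i _ => Nat.mul_le_mul_left _ (Nat.pow_le_pow_left h i)

/-- Each loop multiplies the bound by `n` up to constants, and the nesting depth is fixed by the
program. -/
theorem bound_le_polynomial (p : LProg) : ∃ P : Polynomial ℕ, ∀ n, p.bound n ≤ P.eval n := by
  induction p with
  | skip => exact ⟨Polynomial.C 1, fun n => by simp [bound]⟩
  | assign x e => exact ⟨Polynomial.C (e.cost + 1), fun n => by simp [bound]⟩
  | store a i e => exact ⟨Polynomial.C (i.cost + e.cost + 1), fun n => by simp [bound]⟩
  | seq p q ihp ihq =>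
    obtain ⟨P, hP⟩ := ihp
    obtain ⟨Q, hQ⟩ := ihq
    exact ⟨P + Q, fun n => by simpa [bound] using Nat.add_le_add (hP n) (hQ n)⟩
  | ite e p q ihp ihq =>
    obtain ⟨P, hP⟩ := ihp
    obtain ⟨Q, hQ⟩ := ihq
    refine ⟨Polynomial.C (e.cost + 1) + (P + Q), fun n => ?_⟩
    have := hP n
    have := hQ n
    simp only [bound, Polynomial.eval_add, Polynomial.eval_C]
    omega
  | forN x p ih =>
    obtain ⟨P, hP⟩ := ih
    refine ⟨Polynomial.C 6 + Polynomial.X * (P + Polynomial.C 8), fun n => ?_⟩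
    simp only [bound, Polynomial.eval_add, Polynomial.eval_mul, Polynomial.eval_C, Polynomial.eval_X]
    exact Nat.add_le_add_left (Nat.mul_le_mul_left _ (Nat.add_le_add_right (hP n) _)) _

end LProg

/-! ### Degrees in the remaining graph. -/

section

open scoped Classical

namespace CycleFinder

open LProg

/-- The entry of the adjacency matrix at the row and column given by two registers. -/
def adjE (a b : ℕ) : Expr := .get 0 (.add (.get 5 (.var a)) (.var b))

/-- An expression that is nonzero if and only if two expressions differ. -/
def neE (e f : Expr) : Expr := .add (.sub e f) (.sub f e)

/-- The memory contains the input graph and, in array 5, the multiples of `n`. -/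
structure Ctx (n : ℕ) (g : ℕ → ℕ → Prop) (s : Store) : Prop where
  n_eq : s.var 0 = n
  adj : ∀ u < n, ∀ v < n, s.arr 0 (u * n + v) = 0 ↔ ¬ g u v
  row : ∀ i ≤ n, s.arr 5 i = i * n

theorem Ctx.congr {n : ℕ} {g : ℕ → ℕ → Prop} {s s' : Store} (h : Ctx n g s)
    (h0 : s'.var 0 = s.var 0) (ha : s'.arr 0 = s.arr 0) (hr : s'.arr 5 = s.arr 5) : Ctx n g s' :=
  ⟨h0.trans h.n_eq, by rw [ha]; exact h.adj, by rw [hr]; exact h.row⟩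

theorem Ctx.den {n : ℕ} {g : ℕ → ℕ → Prop} {s : Store} (h : Ctx n g s) {p : LProg}
    (h0 : 0 ∉ p.vars) (ha : 0 ∉ p.arrs) (hr : 5 ∉ p.arrs) : Ctx n g (p.den s) :=
  h.congr (den_var h0 s) (den_arr ha s) (den_arr hr s)

theorem Ctx.eval_adjE {n : ℕ} {g : ℕ → ℕ → Prop} {s : Store} (h : Ctx n g s) {a b : ℕ}
    (ha : s.var a < n) (hb : s.var b < n) : (adjE a b).eval s = 0 ↔ ¬ g (s.var a) (s.var b) := by
  simp only [adjE, Expr.eval]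
  rw [h.row _ ha.le]
  exact h.adj _ ha _ hb

@[simp] theorem eval_neE (s : Store) (e f : Expr) : (neE e f).eval s = 0 ↔ e.eval s = f.eval s := by
  simp only [neE, Expr.eval]
  omega

/-- The number of remaining neighbours. -/
noncomputable def deg (n : ℕ) (g : ℕ → ℕ → Prop) (dead : ℕ → ℕ) (v : ℕ) : ℕ :=
  ((Finset.range n).filter fun w => dead w = 0 ∧ g v w).card

/-- Count the remaining neighbours of the vertex in register 7 (result in register 9) and find one
of them (result in register 12). -/
def degP : LProg :=
  .seq (.assign 9 (.const 0)) <| .seq (.assign 12 (.var 0)) <|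
    .forN 8 <| .ite (.get 6 (.var 8)) .skip <| .ite (adjE 7 8)
      (.seq (.assign 9 (.add (.var 9) (.const 1))) (.assign 12 (.var 8))) .skip

/-- The invariant counts only neighbours below the loop counter. The value `n` in register 12 means
that no neighbour was found; it is at the same time the number of the root node, so that register 12
can be stored as a parent. -/
theorem degP_spec {n : ℕ} {g : ℕ → ℕ → Prop} {s : Store} (h : Ctx n g s) (hv : s.var 7 < n) :
    (degP.den s).var 9 = deg n g (s.arr 6) (s.var 7) ∧
    ((degP.den s).var 12 = n ∧ deg n g (s.arr 6) (s.var 7) = 0 ∨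
      (degP.den s).var 12 < n ∧ s.arr 6 ((degP.den s).var 12) = 0 ∧
        g (s.var 7) ((degP.den s).var 12)) := by
  obtain ⟨s1, hs1⟩ : ∃ s1, s1 = (s.setVar 9 0).setVar 12 n := ⟨_, rfl⟩
  have e : degP.den s = (LProg.forN 8 (.ite (.get 6 (.var 8)) .skip <| .ite (adjE 7 8)
      (.seq (.assign 9 (.add (.var 9) (.const 1))) (.assign 12 (.var 8))) .skip)).den s1 := by
    rw [hs1]
    simp only [degP, LProg.den, Expr.eval, Store.var_setVar]
    simp [h.n_eq]
  rw [e]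
  have hn : s1.var 0 = n := by simp [hs1, h.n_eq]
  have key := den_forN (x := 8) (p := .ite (.get 6 (.var 8)) .skip <| .ite (adjE 7 8)
      (.seq (.assign 9 (.add (.var 9) (.const 1))) (.assign 12 (.var 8))) .skip) s1
    (fun i st => st.var 9 = deg i g (s.arr 6) (s.var 7) ∧
      (st.var 12 = n ∧ deg i g (s.arr 6) (s.var 7) = 0 ∨
        st.var 12 < n ∧ s.arr 6 (st.var 12) = 0 ∧ g (s.var 7) (st.var 12))) ?_ ?_
  · rw [hn] at key
    exact key
  · simp [hs1, deg]
  · intro i st hi h8 hvar harr hI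
    rw [hn] at hi
    have hc : Ctx n g st := h.congr (by rw [hvar 0 (by decide) (by decide)]; simp [hs1])
      (by rw [harr 0 (by decide)]; simp [hs1]) (by rw [harr 5 (by decide)]; simp [hs1])
    have h7 : st.var 7 = s.var 7 := by rw [hvar 7 (by decide) (by decide)]; simp [hs1]
    have h6 : st.arr 6 = s.arr 6 := by rw [harr 6 (by decide)]; simp [hs1]
    have hadj := hc.eval_adjE (a := 7) (b := 8) (by omega) (by omega)
    have hdeg : deg (i + 1) g (s.arr 6) (s.var 7) =
        deg i g (s.arr 6) (s.var 7) + if s.arr 6 i = 0 ∧ g (s.var 7) i then 1 else 0 := by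
      unfold deg
      rw [Finset.range_add_one, Finset.filter_insert]
      split_ifs
      · rw [Finset.card_insert_of_notMem (by simp)]
      · rfl
    rw [h7, h8] at hadj
    simp only [LProg.den, Expr.eval, h8, h6]
    by_cases h1 : s.arr 6 i = 0
    · by_cases h2 : g (s.var 7) i
      · simp [h1, h2, hadj, hdeg, hI.1, hi, h8]
      · simp [h1, h2, hadj, hdeg, hI.1, hI.2]
    · simp [h1, hdeg, hI.1, hI.2]

end CycleFinder
end

/-! ### Weights, vertices of low degree, and the relaxation of one arc. -/

section

open scoped Classical

namespace CycleFinder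

open LProg

/-- The weight of a vertex. -/
noncomputable def weight (n : ℕ) (g : ℕ → ℕ → Prop) (dead : ℕ → ℕ) (v : ℕ) : ℕ :=
  if 3 ≤ deg n g dead v then n + 2 else 1

theorem one_le_weight (n : ℕ) (g : ℕ → ℕ → Prop) (dead : ℕ → ℕ) (v : ℕ) :
    1 ≤ weight n g dead v := by
  unfold weight
  split_ifs <;> omega

theorem weight_le (n : ℕ) (g : ℕ → ℕ → Prop) (dead : ℕ → ℕ) (v : ℕ) :
    weight n g dead v ≤ n + 2 := by
  unfold weight
  split_ifs <;> omega

/-- Process the vertex in register 7 for `scanP`. -/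
def scanBody : LProg :=
  .ite (.get 6 (.var 7)) .skip <| .seq degP <|
    .seq (.ite (.sub (.var 9) (.const 2)) (.store 7 (.var 7) (.add (.var 0) (.const 2)))
      (.store 7 (.var 7) (.const 1)))
    (.ite (.sub (.const 2) (.var 9))
      (.seq (.assign 11 (.add (.var 7) (.const 1))) (.assign 13 (.var 12))) .skip)

/-- Compute the weights of the remaining vertices in array 7, and find a remaining vertex with at
most one remaining neighbour, if there is one (register 11), and this neighbour (register 13). -/
def scanP : LProg := .seq (.assign 11 (.const 0)) (.forN 7 scanBody)

/-- Register 11 is zero, or it is the successor of a remaining vertex with at most one remaining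
neighbour, which is in register 13. -/
def LowFound (n : ℕ) (g : ℕ → ℕ → Prop) (dead : ℕ → ℕ) (st : Store) : Prop :=
  ∃ d < n, st.var 11 = d + 1 ∧ dead d = 0 ∧ deg n g dead d < 2 ∧
    (st.var 13 = n ∧ deg n g dead d = 0 ∨
      st.var 13 < n ∧ dead (st.var 13) = 0 ∧ g d (st.var 13))

/-- The scan leaves array 6 unchanged, so all weights and degrees refer to the graph remaining at
the start of the round. Among several vertices of low degree, the last one is kept. -/
theorem scanP_spec {n : ℕ} {g : ℕ → ℕ → Prop} {s : Store} (h : Ctx n g s) :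
    (∀ v < n, s.arr 6 v = 0 → (scanP.den s).arr 7 v = weight n g (s.arr 6) v) ∧
    ((scanP.den s).var 11 = 0 ∧ (∀ v < n, s.arr 6 v = 0 → 2 ≤ deg n g (s.arr 6) v) ∨
      LowFound n g (s.arr 6) (scanP.den s)) := by
  have hn : (s.setVar 11 0).var 0 = n := by simp [h.n_eq]
  have key := den_forN (x := 7) (p := scanBody) (s.setVar 11 0) (fun i st =>
    (∀ v < i, s.arr 6 v = 0 → st.arr 7 v = weight n g (s.arr 6) v) ∧
    (st.var 11 = 0 ∧ (∀ v < i, s.arr 6 v = 0 → 2 ≤ deg n g (s.arr 6) v) ∨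
      LowFound n g (s.arr 6) st)) ?_ ?_
  · rw [hn] at key
    exact key
  · simp
  · intro i st hi h7 hvar harr hI
    rw [hn] at hi
    have hc : Ctx n g st := h.congr (by rw [hvar 0 (by decide) (by decide)]; simp)
      (by rw [harr 0 (by decide)]; simp) (by rw [harr 5 (by decide)]; simp)
    have h6 : st.arr 6 = s.arr 6 := by rw [harr 6 (by decide)]; simp
    by_cases hd : s.arr 6 i = 0
    · obtain ⟨e9, e12⟩ := degP_spec hc (by omega)
      rw [h6, h7] at e9 e12
      have f0 : (degP.den st).var 0 = n := (den_var (by decide) st).trans hc.n_eq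
      have f7 : (degP.den st).var 7 = i := (den_var (by decide) st).trans h7
      have f11 : (degP.den st).var 11 = st.var 11 := den_var (by decide) st
      have f13 : (degP.den st).var 13 = st.var 13 := den_var (by decide) st
      have a7 : (degP.den st).arr 7 = st.arr 7 := den_arr (by decide) st
      obtain ⟨s2, hs2⟩ : ∃ s2, s2 = degP.den st := ⟨_, rfl⟩
      obtain ⟨s3, hs3⟩ : ∃ s3, s3 = s2.setArr 7 i (weight n g (s.arr 6) i) := ⟨_, rfl⟩
      have e3 : scanBody.den st = (LProg.ite (.sub (.const 2) (.var 9))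
          (.seq (.assign 11 (.add (.var 7) (.const 1))) (.assign 13 (.var 12))) .skip).den s3 := by
        rw [hs3, weight, ← e9, ← hs2]
        simp only [scanBody, LProg.den, Expr.eval, h7, h6, hd, if_true, ← hs2]
        rw [← hs2] at f7 f0
        by_cases h3 : 3 ≤ s2.var 9
        · have : s2.var 9 - 2 ≠ 0 := by omega
          simp [h3, this, f7, f0]
        · have : s2.var 9 - 2 = 0 := by omega
          simp [h3, this, f7]
      rw [← hs2] at e9 e12 f7 f11 f13 a7
      have hw : ∀ v < i + 1, s.arr 6 v = 0 → s3.arr 7 v = weight n g (s.arr 6) v := by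
        intro v hv hv0
        simp only [hs3, Store.arr_setArr, if_true, Function.update_apply, a7]
        split_ifs with hvi
        · rw [hvi]
        · exact hI.1 v (by omega) hv0
      rw [e3]
      have g9 : s3.var 9 = deg n g (s.arr 6) i := by simp [hs3, e9]
      by_cases h2 : deg n g (s.arr 6) i < 2
      · rw [den_ite_ne (by simp only [Expr.eval, g9]; omega), den_seq, den_assign, den_assign]
        refine ⟨by simpa using hw, Or.inr ⟨i, hi, ?_⟩⟩
        refine ⟨?_, hd, h2, ?_⟩
        · simp [hs3, f7, Expr.eval]
        · simpa [hs3, f7, hd, Expr.eval] using e12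
      · rw [den_ite_eq (by simp only [Expr.eval, g9]; omega), den_skip]
        refine ⟨by simpa using hw, ?_⟩
        rcases hI.2 with ⟨h11, hall⟩ | ⟨d, hd1, hd2, hd3, hd4, hd5⟩
        · refine Or.inl ⟨by simp [hs3, f11, h11], fun v hv hv0 => ?_⟩
          rcases Nat.lt_succ_iff_lt_or_eq.1 hv with hv | rfl
          · exact hall v hv hv0
          · omega
        · exact Or.inr ⟨d, hd1, by simpa [hs3, f11] using hd2, hd3, hd4, by simpa [hs3, f13] using hd5⟩
    · have e : scanBody.den st = st := by
        simp [scanBody, LProg.den, Expr.eval, h7, h6, hd]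
      rw [e]
      refine ⟨fun v hv hv0 => ?_, ?_⟩
      · rcases Nat.lt_succ_iff_lt_or_eq.1 hv with hv | rfl
        · simpa using hI.1 v hv hv0
        · exact absurd hv0 hd
      · rcases hI.2 with ⟨h11, hall⟩ | ⟨d, hd1, hd2, hd3, hd4, hd5⟩
        · refine Or.inl ⟨by simp [h11], fun v hv hv0 => ?_⟩
          rcases Nat.lt_succ_iff_lt_or_eq.1 hv with hv | rfl
          · exact hall v hv hv0
          · exact absurd hv0 hd
        · exact Or.inr ⟨d, hd1, by simpa using hd2, hd3, hd4, by simpa using hd5⟩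

/-- Relax the arc given by registers 16 and 17; distances are in array 8, predecessors in array 9.
The arc from register 14 to register 15 is not used. -/
def relaxP : LProg :=
  .ite (.get 6 (.var 16)) .skip <| .ite (.get 6 (.var 17)) .skip <| .ite (adjE 16 17)
    (.ite (.add (neE (.var 16) (.var 14)) (neE (.var 17) (.var 15)))
      (.ite (.sub (.get 8 (.var 17)) (.add (.get 8 (.var 16)) (.get 7 (.var 17))))
        (.seq (.store 8 (.var 17) (.add (.get 8 (.var 16)) (.get 7 (.var 17))))
          (.store 9 (.var 17) (.var 16))) .skip) .skip) .skip

/-- The arcs that may be used in the search for a path from `u` to `v`. -/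
def Arc (n : ℕ) (g : ℕ → ℕ → Prop) (dead : ℕ → ℕ) (u v a b : ℕ) : Prop :=
  a < n ∧ b < n ∧ dead a = 0 ∧ dead b = 0 ∧ g a b ∧ ¬ (a = u ∧ b = v)

/-- The memory contains the input graph, the deletion times and the weights. -/
structure WCtx (n : ℕ) (g : ℕ → ℕ → Prop) (dead : ℕ → ℕ) (s : Store) : Prop
    extends Ctx n g s where
  dead_eq : s.arr 6 = dead
  weight_eq : ∀ v < n, dead v = 0 → s.arr 7 v = weight n g dead v

theorem WCtx.congr {n : ℕ} {g : ℕ → ℕ → Prop} {dead : ℕ → ℕ} {s s' : Store} (h : WCtx n g dead s)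
    (h0 : s'.var 0 = s.var 0) (ha : s'.arr 0 = s.arr 0) (hr : s'.arr 5 = s.arr 5)
    (hd : s'.arr 6 = s.arr 6) (hw : s'.arr 7 = s.arr 7) : WCtx n g dead s' :=
  ⟨h.toCtx.congr h0 ha hr, hd.trans h.dead_eq, by rw [hw]; exact h.weight_eq⟩

theorem WCtx.den {n : ℕ} {g : ℕ → ℕ → Prop} {dead : ℕ → ℕ} {s : Store} (h : WCtx n g dead s)
    {p : LProg} (h0 : 0 ∉ p.vars) (ha : 0 ∉ p.arrs) (hr : 5 ∉ p.arrs) (hd : 6 ∉ p.arrs)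
    (hw : 7 ∉ p.arrs) : WCtx n g dead (p.den s) :=
  h.congr (den_var h0 s) (den_arr ha s) (den_arr hr s) (den_arr hd s) (den_arr hw s)

theorem relaxP_den {n : ℕ} {g : ℕ → ℕ → Prop} {dead : ℕ → ℕ} {s : Store} (h : WCtx n g dead s)
    (ha : s.var 16 < n) (hb : s.var 17 < n) :
    relaxP.den s = if Arc n g dead (s.var 14) (s.var 15) (s.var 16) (s.var 17) ∧
      s.arr 8 (s.var 16) + weight n g dead (s.var 17) < s.arr 8 (s.var 17) then
      (s.setArr 8 (s.var 17) (s.arr 8 (s.var 16) + weight n g dead (s.var 17))).setArr 9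
        (s.var 17) (s.var 16) else s := by
  have hadj := h.eval_adjE ha hb
  have hne : (Expr.add (neE (.var 16) (.var 14)) (neE (.var 17) (.var 15))).eval s = 0 ↔
      (s.var 16 = s.var 14 ∧ s.var 17 = s.var 15) := by
    simp only [Expr.eval, Nat.add_eq_zero_iff, eval_neE]
  unfold relaxP
  by_cases h1 : dead (s.var 16) = 0
  swap
  · rw [den_ite_ne (by simpa [Expr.eval, h.dead_eq] using h1)]; simp [Arc, h1, den_skip]
  rw [den_ite_eq (by simpa [Expr.eval, h.dead_eq] using h1)]
  by_cases h2 : dead (s.var 17) = 0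
  swap
  · rw [den_ite_ne (by simpa [Expr.eval, h.dead_eq] using h2)]; simp [Arc, h2, den_skip]
  rw [den_ite_eq (by simpa [Expr.eval, h.dead_eq] using h2)]
  have hw := h.weight_eq _ hb h2
  by_cases h3 : g (s.var 16) (s.var 17)
  swap
  · rw [den_ite_eq (hadj.2 h3)]; simp [Arc, h3, den_skip]
  rw [den_ite_ne (fun h => hadj.1 h h3)]
  by_cases h4 : s.var 16 = s.var 14 ∧ s.var 17 = s.var 15
  · rw [den_ite_eq (hne.2 h4), if_neg (fun h => h.1.2.2.2.2.2 h4), den_skip]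
  rw [den_ite_ne (fun h => h4 (hne.1 h))]
  by_cases h5 : s.arr 8 (s.var 16) + weight n g dead (s.var 17) < s.arr 8 (s.var 17)
  · rw [den_ite_ne (by simp only [Expr.eval, hw]; omega), if_pos ⟨⟨ha, hb, h1, h2, h3, h4⟩, h5⟩,
      den_seq, den_store, den_store]
    simp only [Expr.eval, hw, Store.var_setArr]
  · rw [den_ite_eq (by simp only [Expr.eval, hw]; omega), if_neg (fun h => h5 h.2), den_skip]

end CycleFinder
end

/-! ### Lightest paths by repeated relaxation. -/

section

open scoped Classical

namespace CycleFinder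

open LProg

/-- Distances `δ` and predecessors `π` as they occur in the search for a path from `u` to `v`. -/
structure Sound (n : ℕ) (g : ℕ → ℕ → Prop) (dead : ℕ → ℕ) (u v inf : ℕ) (δ π : ℕ → ℕ) : Prop where
  start : δ u = weight n g dead u
  le_inf : ∀ b < n, δ b ≤ inf
  pred : ∀ b < n, δ b < inf → b ≠ u →
    Arc n g dead u v (π b) b ∧ δ (π b) + weight n g dead b ≤ δ b

/-- Distances only decrease, and the distance of a predecessor may decrease after it was used;
therefore `pred` asks for an inequality only. The start vertex is never relaxed, since its distance
is its own weight, which every path to it includes. -/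
theorem Sound.update {n : ℕ} {g : ℕ → ℕ → Prop} {dead : ℕ → ℕ} {u v inf : ℕ} {δ π : ℕ → ℕ}
    (h : Sound n g dead u v inf δ π) {a b : ℕ} (hab : Arc n g dead u v a b)
    (hlt : δ a + weight n g dead b < δ b) :
    Sound n g dead u v inf (Function.update δ b (δ a + weight n g dead b))
      (Function.update π b a) := by
  have hbu : b ≠ u := by
    rintro rfl
    rw [h.start] at hlt
    omega
  have hne : a ≠ b := by rintro rfl; omega
  refine ⟨?_, fun c hc => ?_, fun c hc hlt' hcu => ?_⟩
  · rw [Function.update_of_ne hbu.symm, h.start]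
  · have := h.le_inf c hc
    rw [Function.update_apply]
    split_ifs with e
    · subst e; omega
    · exact this
  · by_cases e : c = b
    · subst e
      simp only [Function.update_self, Function.update_of_ne hne]
      exact ⟨hab, le_rfl⟩
    · simp only [Function.update_of_ne e] at hlt' ⊢
      obtain ⟨h1, h2⟩ := h.pred c hc hlt' hcu
      refine ⟨h1, ?_⟩
      by_cases e' : π c = b
      · rw [e', Function.update_self]
        rw [e'] at h2
        omega
      · rw [Function.update_of_ne e']; exact h2

/-- `Steps j b c`: there is a walk of `j` arcs from `u` to `b` of weight `c`. -/
inductive Steps (n : ℕ) (g : ℕ → ℕ → Prop) (dead : ℕ → ℕ) (u v : ℕ) : ℕ → ℕ → ℕ → Prop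
  | zero : Steps n g dead u v 0 u (weight n g dead u)
  | succ {j a b c : ℕ} : Steps n g dead u v j a c → Arc n g dead u v a b →
      Steps n g dead u v (j + 1) b (c + weight n g dead b)

section

variable {n : ℕ} {g : ℕ → ℕ → Prop} {dead : ℕ → ℕ} {u v inf : ℕ}

theorem relaxRow_spec {s : Store} (h : WCtx n g dead s) (hu : s.var 14 = u) (hv : s.var 15 = v)
    (hS : Sound n g dead u v inf (s.arr 8) (s.arr 9)) (ha : s.var 16 < n) :
    Sound n g dead u v inf (((forN 17 relaxP).den s).arr 8) (((forN 17 relaxP).den s).arr 9) ∧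
    (∀ b, ((forN 17 relaxP).den s).arr 8 b ≤ s.arr 8 b) ∧
    ∀ b < n, Arc n g dead u v (s.var 16) b →
      ((forN 17 relaxP).den s).arr 8 b ≤ s.arr 8 (s.var 16) + weight n g dead b := by
  have key := den_forN (x := 17) (p := relaxP) s (fun i st =>
    Sound n g dead u v inf (st.arr 8) (st.arr 9) ∧ (∀ b, st.arr 8 b ≤ s.arr 8 b) ∧
    ∀ b < i, Arc n g dead u v (s.var 16) b →
      st.arr 8 b ≤ s.arr 8 (s.var 16) + weight n g dead b) ?_ ?_
  · rw [h.n_eq] at key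
    exact key
  · simpa using hS
  · intro i st hi h17 hvar harr ⟨hI1, hI2, hI3⟩
    rw [h.n_eq] at hi
    have hc : WCtx n g dead st := h.congr (hvar 0 (by decide) (by decide)) (harr 0 (by decide))
      (harr 5 (by decide)) (harr 6 (by decide)) (harr 7 (by decide))
    have h14 := (hvar 14 (by decide) (by decide)).trans hu
    have h15 := (hvar 15 (by decide) (by decide)).trans hv
    have h16 := hvar 16 (by decide) (by decide)
    rw [relaxP_den hc (by omega) (by omega), h14, h15, h16, h17]
    have h2 := hI2 (s.var 16)
    split_ifs with hcond
    · simp only [Store.arr_setVar, Store.arr_setArr, if_true, if_false, Nat.reduceEqDiff]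
      refine ⟨hI1.update hcond.1 hcond.2, fun b => ?_, fun b hb hab => ?_⟩
      · rw [Function.update_apply]
        split_ifs with e
        · have := hI2 b
          subst e; omega
        · exact hI2 b
      · rw [Function.update_apply]
        split_ifs with e
        · subst e; omega
        · exact hI3 b (by omega) hab
    · simp only [Store.arr_setVar]
      refine ⟨hI1, hI2, fun b hb hab => ?_⟩
      rcases Nat.lt_succ_iff_lt_or_eq.1 hb with hb | rfl
      · exact hI3 b hb hab
      · have : ¬ _ := fun h => hcond ⟨hab, h⟩
        omega

/-- One round of Bellman and Ford. The comparison is with the distances at the beginning of the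
round; distances that have decreased meanwhile only help. -/
theorem relaxAll_spec {s : Store} (h : WCtx n g dead s) (hu : s.var 14 = u) (hv : s.var 15 = v)
    (hS : Sound n g dead u v inf (s.arr 8) (s.arr 9)) :
    Sound n g dead u v inf (((forN 16 (forN 17 relaxP)).den s).arr 8)
      (((forN 16 (forN 17 relaxP)).den s).arr 9) ∧
    (∀ b, ((forN 16 (forN 17 relaxP)).den s).arr 8 b ≤ s.arr 8 b) ∧
    ∀ a < n, ∀ b < n, Arc n g dead u v a b →
      ((forN 16 (forN 17 relaxP)).den s).arr 8 b ≤ s.arr 8 a + weight n g dead b := by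
  have key := den_forN (x := 16) (p := forN 17 relaxP) s (fun i st =>
    Sound n g dead u v inf (st.arr 8) (st.arr 9) ∧ (∀ b, st.arr 8 b ≤ s.arr 8 b) ∧
    ∀ a < i, ∀ b < n, Arc n g dead u v a b → st.arr 8 b ≤ s.arr 8 a + weight n g dead b) ?_ ?_
  · rw [h.n_eq] at key
    exact key
  · simpa using hS
  · intro i st hi h16 hvar harr ⟨hI1, hI2, hI3⟩
    rw [h.n_eq] at hi
    have hc : WCtx n g dead st := h.congr (hvar 0 (by decide) (by decide)) (harr 0 (by decide))
      (harr 5 (by decide)) (harr 6 (by decide)) (harr 7 (by decide))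
    have h14 := (hvar 14 (by decide) (by decide)).trans hu
    have h15 := (hvar 15 (by decide) (by decide)).trans hv
    obtain ⟨k1, k2, k3⟩ := relaxRow_spec hc h14 h15 hI1 (by omega)
    simp only [Store.arr_setVar]
    refine ⟨k1, fun b => (k2 b).trans (hI2 b), fun a ha b hb hab => ?_⟩
    rcases Nat.lt_succ_iff_lt_or_eq.1 ha with ha | rfl
    · exact (k2 b).trans (hI3 a ha b hb hab)
    · rw [h16] at k3
      have := k3 b hb hab
      have := hI2 a
      omega

/-- Compute the weights of the lightest paths from the vertex in register 14 that do not use the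
arc to the vertex in register 15. -/
def distP : LProg :=
  .seq (.forN 8 (.store 8 (.var 8) (.var 19))) <|
  .seq (.store 8 (.var 14) (.get 7 (.var 14))) <| .forN 18 (.forN 16 (.forN 17 relaxP))

/-- After `i` rounds the distances are at most the weights of all walks with at most `i` arcs; `n`
rounds are enough for the walks that come from cycles. -/
theorem distP_spec {s : Store} (h : WCtx n g dead s) (hu : s.var 14 = u) (hv : s.var 15 = v)
    (hinf : s.var 19 = inf) (hun : u < n) (hdu : dead u = 0) (hlarge : weight n g dead u ≤ inf) :
    Sound n g dead u v inf ((distP.den s).arr 8) ((distP.den s).arr 9) ∧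
    ∀ j ≤ n, ∀ b c, Steps n g dead u v j b c → (distP.den s).arr 8 b ≤ c := by
  rw [distP, den_seq, den_seq]
  obtain ⟨s1, hs1⟩ : ∃ s1, s1 = (forN 8 (.store 8 (.var 8) (.var 19))).den s := ⟨_, rfl⟩
  have h8 : ∀ b < n, s1.arr 8 b = inf := by
    have key := den_forN (x := 8) (p := .store 8 (.var 8) (.var 19)) s
      (fun i st => ∀ b < i, st.arr 8 b = inf) (by simp) (by
        intro i st hi h8 hvar harr hI b hb
        have h19 := (hvar 19 (by decide) (by decide)).trans hinf
        simp only [den_store, Expr.eval, h8, h19, Store.arr_setVar, Store.arr_setArr, if_true,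
          Function.update_apply]
        split_ifs with e
        · rfl
        · exact hI b (by omega))
    rw [h.n_eq, ← hs1] at key
    exact key
  have hc1 : WCtx n g dead s1 := hs1 ▸ h.den (by decide) (by decide) (by decide) (by decide)
    (by decide)
  have h14 : s1.var 14 = u := by rw [hs1, den_var (by decide), hu]
  have h15 : s1.var 15 = v := by rw [hs1, den_var (by decide), hv]
  rw [← hs1]
  obtain ⟨s2, hs2⟩ : ∃ s2, s2 = (LProg.store 8 (.var 14) (.get 7 (.var 14))).den s1 := ⟨_, rfl⟩
  have hc2 : WCtx n g dead s2 := hs2 ▸ hc1.den (by decide) (by decide) (by decide) (by decide)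
    (by decide)
  have h14' : s2.var 14 = u := by rw [hs2, den_var (by decide), h14]
  have h15' : s2.var 15 = v := by rw [hs2, den_var (by decide), h15]
  have ha8 : ∀ b, s2.arr 8 b = if b = u then weight n g dead u else s1.arr 8 b := by
    intro b
    rw [hs2, den_store]
    simp [Expr.eval, h14, hc1.weight_eq u hun hdu, Function.update_apply]
  rw [← hs2]
  have hS : Sound n g dead u v inf (s2.arr 8) (s2.arr 9) := by
    refine ⟨by simp [ha8], fun b hb => ?_, fun b hb hlt hbu => ?_⟩
    · rw [ha8]
      split_ifs
      · exact hlarge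
      · exact (h8 b hb).le
    · rw [ha8, if_neg hbu, h8 b hb] at hlt
      omega
  have key := den_forN (x := 18) (p := forN 16 (forN 17 relaxP)) s2 (fun i st =>
    Sound n g dead u v inf (st.arr 8) (st.arr 9) ∧
    ∀ j ≤ i, ∀ b c, Steps n g dead u v j b c → st.arr 8 b ≤ c) ?_ ?_
  · rw [hc2.n_eq] at key
    exact key
  · refine ⟨by simpa using hS, ?_⟩
    rintro j hj b c hst
    obtain rfl : j = 0 := by omega
    cases hst
    simp [ha8]
  · intro i st hi h18 hvar harr ⟨hI1, hI2⟩
    have hc : WCtx n g dead st := hc2.congr (hvar 0 (by decide) (by decide)) (harr 0 (by decide))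
      (harr 5 (by decide)) (harr 6 (by decide)) (harr 7 (by decide))
    obtain ⟨k1, k2, k3⟩ := relaxAll_spec hc ((hvar 14 (by decide) (by decide)).trans h14')
      ((hvar 15 (by decide) (by decide)).trans h15') hI1
    simp only [Store.arr_setVar]
    refine ⟨k1, fun j hj b c hst => ?_⟩
    rcases Nat.lt_or_ge j (i + 1) with hj' | hj'
    · exact (k2 b).trans (hI2 j (by omega) b c hst)
    · cases hst with
      | zero => omega
      | succ hst hab =>
        have h1 := hI2 _ (by omega) _ _ hst
        have h2 := k3 _ hab.1 _ hab.2.1 hab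
        omega

end

end CycleFinder
end

/-! ### A remaining cycle of minimum weight. -/

section

open scoped Classical

namespace CycleFinder

open LProg

/-- `f 0, ..., f (L - 1)` are the successive vertices of a cycle of remaining vertices. -/
structure RowCycle (n : ℕ) (g : ℕ → ℕ → Prop) (dead : ℕ → ℕ) (f : ℕ → ℕ) (L : ℕ) : Prop where
  three_le : 3 ≤ L
  lt : ∀ j < L, f j < n
  dead_eq : ∀ j < L, dead (f j) = 0
  inj : ∀ i < L, ∀ j < L, f i = f j → i = j
  adj : ∀ j, j + 1 < L → g (f j) (f (j + 1))
  adj_last : g (f (L - 1)) (f 0)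

section

variable {n : ℕ} {g : ℕ → ℕ → Prop} {dead : ℕ → ℕ} {u v inf : ℕ}

theorem RowCycle.congr {f f' : ℕ → ℕ} {L : ℕ} (h : RowCycle n g dead f L)
    (hf : ∀ j < L, f' j = f j) : RowCycle n g dead f' L where
  three_le := h.three_le
  lt j hj := by rw [hf j hj]; exact h.lt j hj
  dead_eq j hj := by rw [hf j hj]; exact h.dead_eq j hj
  inj i hi j hj := by rw [hf i hi, hf j hj]; exact h.inj i hi j hj
  adj j hj := by rw [hf j (by omega), hf _ hj]; exact h.adj j hj
  adj_last := by
    have := h.three_le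
    rw [hf _ (by omega), hf 0 (by omega)]; exact h.adj_last

theorem RowCycle.le {f : ℕ → ℕ} {L : ℕ} (h : RowCycle n g dead f L) : L ≤ n := by
  have := Finset.card_le_card_of_injOn (s := Finset.range L) (t := Finset.range n) f
    (fun j hj => by simpa using h.lt j (by simpa using hj))
    (fun i hi j hj e => h.inj i (by simpa using hi) j (by simpa using hj) e)
  simpa using this

/-- The cycle is traversed backwards, from `f 0` over `f (L - 1)` to `f 1`, which avoids the arc
from `f 0` to `f 1`. As the weights sit on vertices, this path has the same weight as the cycle. -/
theorem RowCycle.steps {f : ℕ → ℕ} {L : ℕ} (h : RowCycle n g dead f L)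
    (hsymm : ∀ a b, g a b → g b a) :
    Steps n g dead (f 0) (f 1) (L - 1) (f 1) (∑ j ∈ Finset.range L, weight n g dead (f j)) := by
  have h3 := h.three_le
  have key : ∀ j, j + 1 ≤ L - 1 → Steps n g dead (f 0) (f 1) (j + 1) (f (L - 1 - j))
      (weight n g dead (f 0) + ∑ i ∈ Finset.range (j + 1), weight n g dead (f (L - 1 - i))) := by
    intro j
    induction j with
    | zero =>
      intro _
      simp only [zero_add, Finset.sum_range_one, Nat.sub_zero]
      refine Steps.succ Steps.zero ⟨h.lt _ (by omega), h.lt _ (by omega), h.dead_eq _ (by omega),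
        h.dead_eq _ (by omega), hsymm _ _ h.adj_last, fun hcon => ?_⟩
      have := h.inj _ (by omega) _ (by omega) hcon.2
      omega
    | succ j ih =>
      intro hj
      rw [Finset.sum_range_succ, ← add_assoc]
      have e : L - 1 - j = L - 1 - (j + 1) + 1 := by omega
      refine Steps.succ (ih (by omega)) ⟨h.lt _ (by omega), h.lt _ (by omega), h.dead_eq _ (by omega),
        h.dead_eq _ (by omega), ?_, fun hcon => ?_⟩
      · rw [e]
        exact hsymm _ _ (h.adj _ (by omega))
      · have := h.inj _ (by omega) _ (by omega) hcon.1
        omega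
  have h1 := key (L - 2) (by omega)
  have e1 : L - 2 + 1 = L - 1 := by omega
  have e2 : L - 1 - (L - 2) = 1 := by omega
  rw [e1, e2] at h1
  convert h1 using 1
  have e3 : L = (L - 1) + 1 := by omega
  conv_lhs => rw [e3]
  rw [Finset.sum_range_succ', add_comm, ← Finset.sum_range_reflect]
  congr 1
  refine Finset.sum_congr rfl fun i hi => ?_
  rw [Finset.mem_range] at hi
  congr 2
  omega

/-- The right side is the initial value `inf` of the search, `n * (n + 2) + 1`; so a search that
ends with this value has met no cycle. -/
theorem RowCycle.sum_lt {f : ℕ → ℕ} {L : ℕ} (h : RowCycle n g dead f L) :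
    ∑ j ∈ Finset.range L, weight n g dead (f j) < n * n + (n + (n + 1)) := by
  have h1 : ∑ j ∈ Finset.range L, weight n g dead (f j) ≤ L * (n + 2) := by
    simpa using Finset.sum_le_card_nsmul (Finset.range L) (fun j => weight n g dead (f j)) (n + 2)
      fun j _ => weight_le n g dead (f j)
  have h2 := Nat.mul_le_mul_right (n + 2) h.le
  rw [Nat.mul_add n] at h2
  omega

/-- Weights are positive, so distances drop strictly along predecessors. The chain therefore ends,
and it can end only at `u`. -/
theorem Sound.exists_chain {δ π : ℕ → ℕ} (h : Sound n g dead u v inf δ π) : ∀ d b, δ b = d → b < n →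
    δ b < inf → ∃ l, π^[l] b = u ∧ (∀ i < l, π^[i] b ≠ u ∧ Arc n g dead u v (π^[i + 1] b) (π^[i] b) ∧
      δ (π^[i + 1] b) < δ (π^[i] b)) ∧
      ∑ i ∈ Finset.range (l + 1), weight n g dead (π^[i] b) ≤ δ b := by
  intro d
  induction d using Nat.strong_induction_on with
  | _ d ih =>
  intro b hd hb hlt
  by_cases hbu : b = u
  · subst hbu
    exact ⟨0, rfl, by simp, by simp [h.start]⟩
  · obtain ⟨h1, h2⟩ := h.pred b hb hlt hbu
    have h3 := one_le_weight n g dead b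
    obtain ⟨l, l1, l2, l3⟩ := ih (δ (π b)) (by omega) (π b) rfl h1.1 (by omega)
    refine ⟨l + 1, by rw [Function.iterate_succ_apply]; exact l1, fun i hi => ?_, ?_⟩
    · cases i with
      | zero => exact ⟨hbu, h1, by simp only [Function.iterate_succ_apply, Function.iterate_zero_apply]; omega⟩
      | succ i =>
        have := l2 i (by omega)
        simpa only [Function.iterate_succ_apply] using this
    · rw [Finset.sum_range_succ']
      simp only [Function.iterate_succ_apply, Function.iterate_zero_apply] at l3 ⊢
      omega

/-- The cycle formed by a path found in the search and the arc closing it. -/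
def closeRow (u v : ℕ) (π : ℕ → ℕ) (j : ℕ) : ℕ := if j = 0 then u else π^[j - 1] v

theorem Sound.exists_rowCycle {δ π : ℕ → ℕ} (h : Sound n g dead u v inf δ π)
    (hsymm : ∀ a b, g a b → g b a) (huv : u ≠ v) (hg : g u v)
    (hu : u < n) (hv : v < n) (hdu : dead u = 0) (hlt : δ v < inf) :
    ∃ l, π^[l] v = u ∧ (∀ i < l, π^[i] v ≠ u) ∧
      RowCycle n g dead (closeRow u v π) (l + 1) ∧
      ∑ j ∈ Finset.range (l + 1), weight n g dead (closeRow u v π j) ≤ δ v := by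
  obtain ⟨l, l1, l2, l3⟩ := h.exists_chain _ v rfl hv hlt
  have hl0 : l ≠ 0 := by rintro rfl; exact huv l1.symm
  -- A chain with a single arc would be the excluded arc from `u` to `v`; hence closing the chain
  -- gives at least three vertices.
  have hl1 : l ≠ 1 := by
    rintro rfl
    exact (l2 0 (by omega)).2.1.2.2.2.2.2 ⟨l1, rfl⟩
  have hmono : ∀ i j, i < j → j ≤ l → δ (π^[j] v) < δ (π^[i] v) := by
    intro i j hij
    induction j with
    | zero => omega
    | succ j ih =>
      intro hj
      have := (l2 j (by omega)).2.2
      rcases Nat.lt_succ_iff_lt_or_eq.1 hij with h | rfl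
      · exact this.trans (ih h (by omega))
      · exact this
  have hinj : ∀ i < l, ∀ j < l, π^[i] v = π^[j] v → i = j := by
    intro i hi j hj e
    rcases lt_trichotomy i j with h | h | h
    · have := hmono i j h (by omega)
      rw [e] at this; omega
    · exact h
    · have := hmono j i h (by omega)
      rw [e] at this; omega
  have hc : ∀ j, closeRow u v π (j + 1) = π^[j] v := fun j => by simp [closeRow]
  have hc0 : closeRow u v π 0 = u := rfl
  refine ⟨l, l1, fun i hi => (l2 i hi).1, ⟨by omega, ?_, ?_, ?_, ?_, ?_⟩, ?_⟩
  · rintro (_ | j) hj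
    · exact hu
    · rw [hc]; exact (l2 j (by omega)).2.1.2.1
  · rintro (_ | j) hj
    · exact hdu
    · rw [hc]; exact (l2 j (by omega)).2.1.2.2.2.1
  · rintro (_ | i) hi (_ | j) hj e
    · rfl
    · rw [hc, hc0] at e
      exact absurd e.symm (l2 j (by omega)).1
    · rw [hc, hc0] at e
      exact absurd e (l2 i (by omega)).1
    · rw [hc, hc] at e
      rw [hinj i (by omega) j (by omega) e]
  · rintro (_ | j) hj
    · rw [hc]; exact hg
    · rw [hc, hc]
      exact hsymm _ _ (l2 j (by omega)).2.1.2.2.2.2.1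
  · have e : l + 1 - 1 = l - 1 + 1 := by omega
    have h1 := (l2 (l - 1) (by omega)).2.1.2.2.2.2.1
    have e' : l - 1 + 1 = l := by omega
    rw [e, hc, hc0]
    rw [e', l1] at h1
    exact hsymm _ _ h1
  · rw [Finset.sum_range_succ'] 
    rw [Finset.sum_range_succ, l1] at l3
    simpa only [hc, hc0] using l3

/-- Follow the predecessors from the vertex in register 15 to the vertex in register 14 and write
the cycle into the row of array 2 given by register 5, its length into array 1. -/
def extractP : LProg :=
  .seq (.store 2 (.get 5 (.var 5)) (.var 14)) <| .seq (.assign 20 (.const 1)) <|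
  .seq (.assign 21 (.var 15)) <|
  .seq (.forN 18 <| .ite (neE (.var 21) (.var 14))
    (.seq (.store 2 (.add (.get 5 (.var 5)) (.var 20)) (.var 21)) <|
      .seq (.assign 20 (.add (.var 20) (.const 1))) (.assign 21 (.get 9 (.var 21)))) .skip)
  (.store 1 (.var 5) (.var 20))

/-- The loop makes `n` iterations, but those after the arrival at `u` are idle; hence `min i l` in
the invariant. -/
theorem extractP_spec {s : Store} (h : Ctx n g s) (hu : s.var 14 = u) (hv : s.var 15 = v)
    (hcnt : s.var 5 ≤ n) {l : ℕ} (hl : l ≤ n) (hlu : (s.arr 9)^[l] v = u)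
    (hlne : ∀ i < l, (s.arr 9)^[i] v ≠ u) :
    (∀ j < l + 1, (extractP.den s).arr 2 (s.var 5 * n + j) = closeRow u v (s.arr 9) j) ∧
    (∀ i < s.var 5 * n, (extractP.den s).arr 2 i = s.arr 2 i) ∧
    (extractP.den s).arr 1 (s.var 5) = l + 1 ∧
    ∀ q, q ≠ s.var 5 → (extractP.den s).arr 1 q = s.arr 1 q := by
  obtain ⟨body, hbody⟩ : ∃ p, p = LProg.ite (neE (.var 21) (.var 14))
    (.seq (.store 2 (.add (.get 5 (.var 5)) (.var 20)) (.var 21)) <|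
      .seq (.assign 20 (.add (.var 20) (.const 1))) (.assign 21 (.get 9 (.var 21)))) .skip :=
    ⟨_, rfl⟩
  obtain ⟨s1, hs1⟩ : ∃ s1, s1 = ((s.setArr 2 (s.var 5 * n) u).setVar 20 1).setVar 21 v := ⟨_, rfl⟩
  have e : extractP.den s = (LProg.store 1 (.var 5) (.var 20)).den ((forN 18 body).den s1) := by
    rw [hs1, hbody]
    simp [extractP, den_seq, den_store, den_assign, Expr.eval, h.row _ hcnt, hu, hv]
  have hn : s1.var 0 = n := by simp [hs1, h.n_eq]
  have key := den_forN (x := 18) (p := body) s1 (fun i st =>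
    st.var 20 = min i l + 1 ∧ st.var 21 = (s.arr 9)^[min i l] v ∧
    (∀ j < min i l + 1, st.arr 2 (s.var 5 * n + j) = closeRow u v (s.arr 9) j) ∧
    (∀ i < s.var 5 * n, st.arr 2 i = s.arr 2 i)) ?_ ?_
  · rw [hn, Nat.min_eq_right hl] at key
    obtain ⟨k1, k2, k3, k4⟩ := key
    have h5 : ((forN 18 body).den s1).var 5 = s.var 5 := by
      rw [den_var (by rw [hbody]; decide)]; simp [hs1]
    have ha1 : ((forN 18 body).den s1).arr 1 = s.arr 1 := by
      rw [den_arr (by rw [hbody]; decide)]; simp [hs1]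
    rw [e, den_store]
    simp only [Expr.eval, h5, k1]
    refine ⟨by simpa using k3, by simpa using k4, by simp, fun q hq => ?_⟩
    simp [Function.update_of_ne hq, ha1]
  · refine ⟨by simp [hs1], by simp [hs1], ?_, fun i hi => ?_⟩
    · intro j hj
      obtain rfl : j = 0 := by omega
      simp [hs1, closeRow]
    · simp only [hs1, Store.arr_setVar, Store.arr_setArr, if_true]
      rw [Function.update_of_ne (by omega)]
  · intro i st hi h18 hvar harr ⟨hI1, hI2, hI3, hI4⟩
    have h14 : st.var 14 = u := by
      rw [hvar 14 (by decide) (by rw [hbody]; decide)]; simp [hs1, hu]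
    have h5 : st.var 5 = s.var 5 := by
      rw [hvar 5 (by decide) (by rw [hbody]; decide)]; simp [hs1]
    have h9 : st.arr 9 = s.arr 9 := by
      rw [harr 9 (by rw [hbody]; decide)]; simp [hs1]
    have hr : st.arr 5 (s.var 5) = s.var 5 * n := by
      rw [harr 5 (by rw [hbody]; decide)]; simp [hs1, h.row _ hcnt]
    by_cases hil : i < l
    · rw [Nat.min_eq_left hil.le] at hI1 hI2 hI3
      have hmin : min (i + 1) l = i + 1 := Nat.min_eq_left hil
      rw [hmin]
      have hne : (neE (.var 21) (.var 14)).eval st ≠ 0 := by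
        rw [Ne, eval_neE]
        simpa only [Expr.eval, hI2, h14] using hlne i hil
      rw [hbody, den_ite_ne hne, den_seq, den_seq, den_store, den_assign, den_assign]
      simp only [Expr.eval, Store.var_setVar, Store.var_setArr, Store.arr_setVar, Store.arr_setArr,
        if_true, if_false, Nat.reduceEqDiff, h5, hr, hI1, hI2, h9]
      refine ⟨trivial, ?_, fun j hj => ?_, fun m hm => ?_⟩
      · rw [Function.iterate_succ_apply']
      · rw [Function.update_apply]
        split_ifs with e
        · obtain rfl : j = i + 1 := by omega
          simp [closeRow]
        · exact hI3 j (by omega)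
      · rw [Function.update_of_ne (by omega)]
        exact hI4 m hm
    · have hmin : min i l = l := Nat.min_eq_right (by omega)
      have hmin' : min (i + 1) l = l := Nat.min_eq_right (by omega)
      rw [hmin] at hI1 hI2 hI3
      rw [hmin']
      have hne : (neE (.var 21) (.var 14)).eval st = 0 := by
        rw [eval_neE]
        simpa only [Expr.eval, hI2, h14] using hlu
      rw [hbody, den_ite_eq hne, den_skip]
      refine ⟨by simpa using hI1, by simpa using hI2, by simpa using hI3, by simpa using hI4⟩

/-- If the vertices in registers 14 and 15 are adjacent, look for a light cycle through this edge;
register 10 holds the weight of the lightest cycle found so far. -/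
def edgeP : LProg :=
  .ite (.get 6 (.var 14)) .skip <| .ite (.get 6 (.var 15)) .skip <| .ite (adjE 14 15)
    (.seq distP <| .ite (.sub (.var 10) (.get 8 (.var 15)))
      (.seq (.assign 10 (.get 8 (.var 15))) extractP) .skip) .skip

/-- The memory holds, in the row of arrays 1 and 2 given by `cnt`, a cycle whose weight is at most
the content of register 10, unless the latter is still `inf`. -/
structure Best (n : ℕ) (g : ℕ → ℕ → Prop) (dead : ℕ → ℕ) (cnt inf : ℕ) (s st : Store) : Prop where
  le_inf : st.var 10 ≤ inf
  cycle : st.var 10 < inf → RowCycle n g dead (fun j => st.arr 2 (cnt * n + j)) (st.arr 1 cnt) ∧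
    ∑ j ∈ Finset.range (st.arr 1 cnt), weight n g dead (st.arr 2 (cnt * n + j)) ≤ st.var 10
  rows : ∀ i < cnt * n, st.arr 2 i = s.arr 2 i
  lens : ∀ q, q ≠ cnt → st.arr 1 q = s.arr 1 q

theorem Best.congr {cnt : ℕ} {s st st' : Store} (h : Best n g dead cnt inf s st)
    (h10 : st'.var 10 = st.var 10) (h1 : st'.arr 1 = st.arr 1) (h2 : st'.arr 2 = st.arr 2) :
    Best n g dead cnt inf s st' :=
  ⟨h10 ▸ h.le_inf, by rw [h10, h1, h2]; exact h.cycle, by rw [h2]; exact h.rows,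
    by rw [h1]; exact h.lens⟩

/-- The distance is a lower bound for all cycles that start with the given arc, and whenever it
improves register 10, the predecessors provide a cycle that is no heavier. -/
theorem edgeP_spec {s st : Store} {cnt : ℕ} (h : WCtx n g dead st) (hsymm : ∀ a b, g a b → g b a)
    (hirr : ∀ a, ¬ g a a) (hu : st.var 14 < n) (hv : st.var 15 < n) (h5 : st.var 5 = cnt)
    (hcnt : cnt ≤ n) (h19 : st.var 19 = inf) (hinf : n + 2 ≤ inf)
    (hB : Best n g dead cnt inf s st) :
    Best n g dead cnt inf s (edgeP.den st) ∧ (edgeP.den st).var 10 ≤ st.var 10 ∧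
    ∀ f L, RowCycle n g dead f L → f 0 = st.var 14 → f 1 = st.var 15 →
      (edgeP.den st).var 10 ≤ ∑ j ∈ Finset.range L, weight n g dead (f j) := by
  have hadj := h.eval_adjE hu hv
  have key : ∀ f L, RowCycle n g dead f L → f 0 = st.var 14 → f 1 = st.var 15 →
      dead (st.var 14) = 0 ∧ dead (st.var 15) = 0 ∧ g (st.var 14) (st.var 15) := by
    intro f L hf h0 h1
    have h3 := hf.three_le
    rw [← h0, ← h1]
    exact ⟨hf.dead_eq 0 (by omega), hf.dead_eq 1 (by omega), hf.adj 0 (by omega)⟩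
  unfold edgeP
  by_cases h1 : dead (st.var 14) = 0
  swap
  · rw [den_ite_ne (by simpa [Expr.eval, h.dead_eq] using h1), den_skip]
    exact ⟨hB, le_rfl, fun f L hf h0 h1' => absurd (key f L hf h0 h1').1 h1⟩
  rw [den_ite_eq (by simpa [Expr.eval, h.dead_eq] using h1)]
  by_cases h2 : dead (st.var 15) = 0
  swap
  · rw [den_ite_ne (by simpa [Expr.eval, h.dead_eq] using h2), den_skip]
    exact ⟨hB, le_rfl, fun f L hf h0 h1' => absurd (key f L hf h0 h1').2.1 h2⟩
  rw [den_ite_eq (by simpa [Expr.eval, h.dead_eq] using h2)]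
  by_cases h3 : g (st.var 14) (st.var 15)
  swap
  · rw [den_ite_eq (hadj.2 h3), den_skip]
    exact ⟨hB, le_rfl, fun f L hf h0 h1' => absurd (key f L hf h0 h1').2.2 h3⟩
  rw [den_ite_ne (fun h => hadj.1 h h3), den_seq]
  obtain ⟨hS, hsteps⟩ := distP_spec h rfl rfl h19 hu h1 ((weight_le _ _ _ _).trans hinf)
  obtain ⟨s1, hs1⟩ : ∃ s1, s1 = distP.den st := ⟨_, rfl⟩
  rw [← hs1] at hS hsteps ⊢
  have g0 : s1.var 0 = st.var 0 := hs1 ▸ den_var (by decide) st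
  have g5 : s1.var 5 = st.var 5 := hs1 ▸ den_var (by decide) st
  have g10 : s1.var 10 = st.var 10 := hs1 ▸ den_var (by decide) st
  have g14 : s1.var 14 = st.var 14 := hs1 ▸ den_var (by decide) st
  have g15 : s1.var 15 = st.var 15 := hs1 ▸ den_var (by decide) st
  have b1 : s1.arr 1 = st.arr 1 := hs1 ▸ den_arr (by decide) st
  have b2 : s1.arr 2 = st.arr 2 := hs1 ▸ den_arr (by decide) st
  have hc1 : WCtx n g dead s1 := hs1 ▸ h.den (by decide) (by decide) (by decide) (by decide)
    (by decide)
  have hmin : ∀ f L, RowCycle n g dead f L → f 0 = st.var 14 → f 1 = st.var 15 →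
      s1.arr 8 (st.var 15) ≤ ∑ j ∈ Finset.range L, weight n g dead (f j) := by
    intro f L hf h0 h1'
    have h4 := hf.steps hsymm
    have h5 := hf.le
    rw [h0, h1'] at h4
    exact hsteps (L - 1) (by omega) (st.var 15) _ h4
  by_cases h4 : s1.arr 8 (st.var 15) < st.var 10
  · rw [den_ite_ne (by simp only [Expr.eval, g10, g15]; omega), den_seq, den_assign]
    have hlt := hB.le_inf
    obtain ⟨l, l1, l2, l3, l4⟩ := hS.exists_rowCycle hsymm (fun e => hirr _ (e ▸ h3)) h3 hu hv h1
      (by omega)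
    have hl := l3.le
    obtain ⟨s2, hs2⟩ : ∃ s2, s2 = s1.setVar 10 ((Expr.get 8 (.var 15)).eval s1) := ⟨_, rfl⟩
    rw [← hs2]
    have hc2 : Ctx n g s2 := hc1.toCtx.congr (by simp [hs2]) (by simp [hs2]) (by simp [hs2])
    have f5 : s2.var 5 = cnt := by simp [hs2, g5, h5]
    have f9 : s2.arr 9 = s1.arr 9 := by simp [hs2]
    obtain ⟨x1, x2, x3, x4⟩ := extractP_spec hc2 (u := st.var 14) (v := st.var 15)
      (by simp [hs2, g14]) (by simp [hs2, g15]) (f5 ▸ hcnt) (l := l) (by omega) (f9 ▸ l1) (f9 ▸ l2)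
    rw [f5, f9] at x1
    rw [f5] at x2 x3 x4
    have f10 : (extractP.den s2).var 10 = s1.arr 8 (st.var 15) := by
      rw [den_var (by decide)]; simp [hs2, Expr.eval, g15]
    refine ⟨⟨by omega, fun _ => ?_, fun i hi => ?_, fun q hq => ?_⟩, by omega, ?_⟩
    · rw [x3, f10]
      refine ⟨l3.congr fun j hj => x1 j hj, le_trans (le_of_eq ?_) l4⟩
      exact Finset.sum_congr rfl fun j hj => by rw [x1 j (Finset.mem_range.1 hj)]
    · rw [x2 i hi]; simp only [hs2, Store.arr_setVar, b2]; exact hB.rows i hi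
    · rw [x4 q hq]; simp only [hs2, Store.arr_setVar, b1]; exact hB.lens q hq
    · rw [f10]; exact hmin
  · rw [den_ite_eq (by simp only [Expr.eval, g10, g15]; omega), den_skip]
    refine ⟨hB.congr g10 b1 b2, g10.le, fun f L hf h0 h1' => ?_⟩
    have := hmin f L hf h0 h1'
    omega

/-- Find a remaining cycle of minimum weight. -/
def searchP : LProg :=
  .seq (.assign 19 (.add (.get 5 (.var 0)) (.add (.var 0) (.add (.var 0) (.const 1))))) <|
  .seq (.assign 10 (.var 19)) <| .forN 14 (.forN 15 edgeP)

theorem searchP_spec {s : Store} (h : WCtx n g dead s) (hsymm : ∀ a b, g a b → g b a)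
    (hirr : ∀ a, ¬ g a a) (hcnt : s.var 5 ≤ n) (hn : 0 < n) :
    (searchP.den s).var 19 = n * n + (n + (n + 1)) ∧
    Best n g dead (s.var 5) (n * n + (n + (n + 1))) s (searchP.den s) ∧
    ∀ f L, RowCycle n g dead f L →
      (searchP.den s).var 10 ≤ ∑ j ∈ Finset.range L, weight n g dead (f j) := by
  obtain ⟨inf, hinf⟩ : ∃ inf, inf = n * n + (n + (n + 1)) := ⟨_, rfl⟩
  rw [← hinf]
  -- With at least one vertex, `inf` is no less than any single weight, as needed for the start
  -- vertex of the search.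
  have hinf2 : n + 2 ≤ inf := by
    have := Nat.le_mul_self n
    omega
  obtain ⟨s1, hs1⟩ : ∃ s1, s1 = (s.setVar 19 inf).setVar 10 inf := ⟨_, rfl⟩
  have e : searchP.den s = (forN 14 (forN 15 edgeP)).den s1 := by
    rw [hs1, hinf]
    simp [searchP, den_seq, den_assign, Expr.eval, h.row n le_rfl, h.n_eq]
  have hc1 : WCtx n g dead s1 := h.congr (by simp [hs1]) (by simp [hs1]) (by simp [hs1])
    (by simp [hs1]) (by simp [hs1])
  have h5 : s1.var 5 = s.var 5 := by simp [hs1]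
  have h19 : s1.var 19 = inf := by simp [hs1]
  have hB1 : Best n g dead (s.var 5) inf s s1 :=
    ⟨by simp [hs1], fun h => absurd h (by simp [hs1]), by simp [hs1], by simp [hs1]⟩
  rw [e]
  refine ⟨by rw [den_var (by decide), h19], ?_⟩
  have key := den_forN (x := 14) (p := forN 15 edgeP) s1 (fun i st =>
    Best n g dead (s.var 5) inf s st ∧ ∀ f L, RowCycle n g dead f L → f 0 < i →
      st.var 10 ≤ ∑ j ∈ Finset.range L, weight n g dead (f j)) ?_ ?_
  · rw [hc1.n_eq] at key
    refine ⟨key.1, fun f L hf => key.2 f L hf (hf.lt 0 ?_)⟩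
    have := hf.three_le
    omega
  · exact ⟨hB1.congr (by simp) (by simp) (by simp), by simp⟩
  · intro i st hi h14 hvar harr ⟨hB, hmin⟩
    rw [hc1.n_eq] at hi
    have hc : WCtx n g dead st := hc1.congr (hvar 0 (by decide) (by decide)) (harr 0 (by decide))
      (harr 5 (by decide)) (harr 6 (by decide)) (harr 7 (by decide))
    have h5' := (hvar 5 (by decide) (by decide)).trans h5
    have h19' := (hvar 19 (by decide) (by decide)).trans h19
    have key := den_forN (x := 15) (p := edgeP) st (fun j st' =>
      Best n g dead (s.var 5) inf s st' ∧ st'.var 10 ≤ st.var 10 ∧ ∀ f L, RowCycle n g dead f L →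
        f 0 = i → f 1 < j → st'.var 10 ≤ ∑ j ∈ Finset.range L, weight n g dead (f j)) ?_ ?_
    · rw [hc.n_eq] at key
      obtain ⟨k1, k2, k3⟩ := key
      refine ⟨k1.congr (by simp) (by simp) (by simp), fun f L hf h0 => ?_⟩
      simp only [Store.var_setVar, Nat.reduceEqDiff, if_false]
      have := hf.three_le
      rcases Nat.lt_succ_iff_lt_or_eq.1 h0 with h0 | h0
      · exact k2.trans (hmin f L hf h0)
      · exact k3 f L hf h0 (hf.lt 1 (by omega))
    · exact ⟨hB.congr (by simp) (by simp) (by simp), by simp, by simp⟩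
    · intro j st' hj h15 hvar' harr' ⟨hB', hle', hmin'⟩
      rw [hc.n_eq] at hj
      have hc' : WCtx n g dead st' := hc.congr (hvar' 0 (by decide) (by decide))
        (harr' 0 (by decide)) (harr' 5 (by decide)) (harr' 6 (by decide)) (harr' 7 (by decide))
      have h14' := (hvar' 14 (by decide) (by decide)).trans h14
      obtain ⟨k1, k2, k3⟩ := edgeP_spec hc' hsymm hirr (by omega) (by omega)
        ((hvar' 5 (by decide) (by decide)).trans h5') hcnt
        ((hvar' 19 (by decide) (by decide)).trans h19') hinf2 hB'
      refine ⟨k1.congr (by simp) (by simp) (by simp), ?_, fun f L hf h0 h1 => ?_⟩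
      · simp only [Store.var_setVar, Nat.reduceEqDiff, if_false]; omega
      · simp only [Store.var_setVar, Nat.reduceEqDiff, if_false]
        rcases Nat.lt_succ_iff_lt_or_eq.1 h1 with h1 | h1
        · exact k2.trans (hmin' f L hf h0 h1)
        · exact k3 f L hf (by omega) (by omega)

end

end CycleFinder
end

/-! ### Deleting the neighbourhoods of the centres. -/

section

open scoped Classical

namespace CycleFinder

open LProg

/-- Delete the vertex in register 8. -/
def markP : LProg :=
  .seq (.store 6 (.var 8) (.add (.var 6) (.const 1))) (.store 10 (.var 8) (.const 1))

/-- Delete the remaining vertices among the vertex in register 22 and its neighbours. -/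
def killStarP : LProg :=
  .forN 8 <| .ite (.get 6 (.var 8)) .skip <|
    .ite (neE (.var 8) (.var 22)) (.ite (adjE 22 8) markP .skip) markP

theorem killStarP_spec {n : ℕ} {g : ℕ → ℕ → Prop} {s : Store} (h : Ctx n g s)
    (hc : s.var 22 < n) :
    (killStarP.den s).arr 6 = (fun w => if w < n ∧ s.arr 6 w = 0 ∧ (w = s.var 22 ∨ g (s.var 22) w)
      then s.var 6 + 1 else s.arr 6 w) ∧
    (killStarP.den s).arr 10 = (fun w => if w < n ∧ s.arr 6 w = 0 ∧ (w = s.var 22 ∨ g (s.var 22) w)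
      then 1 else s.arr 10 w) := by
  have key := den_forN (x := 8) (p := .ite (.get 6 (.var 8)) .skip <|
    .ite (neE (.var 8) (.var 22)) (.ite (adjE 22 8) markP .skip) markP) s (fun i st =>
      st.arr 6 = (fun w => if w < i ∧ s.arr 6 w = 0 ∧ (w = s.var 22 ∨ g (s.var 22) w)
        then s.var 6 + 1 else s.arr 6 w) ∧
      st.arr 10 = (fun w => if w < i ∧ s.arr 6 w = 0 ∧ (w = s.var 22 ∨ g (s.var 22) w)
        then 1 else s.arr 10 w)) ?_ ?_
  · rw [h.n_eq] at key
    exact key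
  · simp
  · intro i st hi h8 hvar harr ⟨hI6, hI10⟩
    rw [h.n_eq] at hi
    have hc' : Ctx n g st := h.congr (hvar 0 (by decide) (by decide)) (harr 0 (by decide))
      (harr 5 (by decide))
    have h22 : st.var 22 = s.var 22 := hvar 22 (by decide) (by decide)
    have h6 : st.var 6 = s.var 6 := hvar 6 (by decide) (by decide)
    have hadj := hc'.eval_adjE (a := 22) (b := 8) (by omega) (by omega)
    rw [h22, h8] at hadj
    have hi6 : st.arr 6 i = s.arr 6 i := by rw [hI6]; simp
    have hskip : ¬ (s.arr 6 i = 0 ∧ (i = s.var 22 ∨ g (s.var 22) i)) →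
        st.arr 6 = (fun w => if w < i + 1 ∧ s.arr 6 w = 0 ∧ (w = s.var 22 ∨ g (s.var 22) w)
          then s.var 6 + 1 else s.arr 6 w) ∧
        st.arr 10 = (fun w => if w < i + 1 ∧ s.arr 6 w = 0 ∧ (w = s.var 22 ∨ g (s.var 22) w)
          then 1 else s.arr 10 w) := by
      intro hn
      have key : ∀ w, (w < i + 1 ∧ s.arr 6 w = 0 ∧ (w = s.var 22 ∨ g (s.var 22) w)) ↔
          (w < i ∧ s.arr 6 w = 0 ∧ (w = s.var 22 ∨ g (s.var 22) w)) := by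
        intro w
        refine and_congr_left fun hw => ?_
        have : w ≠ i := by rintro rfl; exact hn hw
        omega
      simp only [key]
      exact ⟨hI6, hI10⟩
    have hmark : s.arr 6 i = 0 ∧ (i = s.var 22 ∨ g (s.var 22) i) →
        (markP.den st).arr 6 = (fun w => if w < i + 1 ∧ s.arr 6 w = 0 ∧
          (w = s.var 22 ∨ g (s.var 22) w) then s.var 6 + 1 else s.arr 6 w) ∧
        (markP.den st).arr 10 = (fun w => if w < i + 1 ∧ s.arr 6 w = 0 ∧
          (w = s.var 22 ∨ g (s.var 22) w) then 1 else s.arr 10 w) := by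
      intro hy
      have key : ∀ w, w ≠ i → ((w < i + 1 ∧ s.arr 6 w = 0 ∧ (w = s.var 22 ∨ g (s.var 22) w)) ↔
          (w < i ∧ s.arr 6 w = 0 ∧ (w = s.var 22 ∨ g (s.var 22) w))) := by
        intro w hw
        refine and_congr_left fun _ => ?_
        omega
      constructor
      · funext w
        simp only [markP, den_seq, den_store, Store.arr_setArr, Expr.eval, h8, h6,
          Store.var_setArr, Nat.reduceEqDiff, if_true, if_false, hI6, Function.update_apply]
        by_cases hw : w = i
        · subst hw
          rw [if_pos rfl, if_pos ⟨by omega, hy⟩]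
        · rw [if_neg hw]
          simp only [key w hw]
      · funext w
        simp only [markP, den_seq, den_store, Store.arr_setArr, Expr.eval, h8,
          Store.var_setArr, Nat.reduceEqDiff, if_true, if_false, hI10, Function.update_apply]
        by_cases hw : w = i
        · subst hw
          rw [if_pos rfl, if_pos ⟨by omega, hy⟩]
        · rw [if_neg hw]
          simp only [key w hw]
    rw [Store.arr_setVar, Store.arr_setVar]
    by_cases h1 : s.arr 6 i = 0
    swap
    · rw [den_ite_ne (by simpa [Expr.eval, h8, hi6] using h1), den_skip]
      exact hskip fun h => h1 h.1
    rw [den_ite_eq (by simpa [Expr.eval, h8, hi6] using h1)]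
    by_cases h2 : i = s.var 22
    · rw [den_ite_eq (by simp [Expr.eval, h8, h22, h2])]
      exact hmark ⟨h1, Or.inl h2⟩
    rw [den_ite_ne (by simpa [Expr.eval, h8, h22] using h2)]
    by_cases h3 : g (s.var 22) i
    · rw [den_ite_ne (fun h => hadj.1 h h3)]
      exact hmark ⟨h1, Or.inr h3⟩
    · rw [den_ite_eq (hadj.2 h3), den_skip]
      exact hskip fun h => h.2.elim h2 h3

/-- The vertex `w` is one of the vertices `f j`, `j < i`, that have at least three remaining
neighbours or satisfy `j = 0`, or it is a neighbour of one of these. -/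
def Near (n : ℕ) (g : ℕ → ℕ → Prop) (dead f : ℕ → ℕ) (i w : ℕ) : Prop :=
  ∃ j < i, (j = 0 ∨ 3 ≤ deg n g dead (f j)) ∧ (w = f j ∨ g (f j) w)

theorem near_succ {n : ℕ} {g : ℕ → ℕ → Prop} {dead f : ℕ → ℕ} {i w : ℕ} :
    Near n g dead f (i + 1) w ↔ Near n g dead f i w ∨
      (i = 0 ∨ 3 ≤ deg n g dead (f i)) ∧ (w = f i ∨ g (f i) w) := by
  constructor
  · rintro ⟨j, hj, h⟩
    rcases Nat.lt_succ_iff_lt_or_eq.1 hj with hj | rfl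
    · exact Or.inl ⟨j, hj, h⟩
    · exact Or.inr h
  · rintro (⟨j, hj, h⟩ | h)
    · exact ⟨j, by omega, h⟩
    · exact ⟨i, by omega, h⟩

/-- Delete the neighbourhoods of the vertices with at least three remaining neighbours, and of the
first vertex, on the last cycle found. -/
def killP : LProg :=
  .forN 18 <| .ite (.sub (.get 1 (.var 5)) (.var 18))
    (.seq (.assign 22 (.get 2 (.add (.get 5 (.var 5)) (.var 18))))
      (.ite (.add (.sub (.const 1) (.var 18)) (.sub (.get 7 (.var 22)) (.const 1))) killStarP .skip))
    .skip

/-- The centres are recognized by array 7, that is, by their degrees before the deletions of this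
round, and vertices already deleted are skipped. Thus deleting the stars one by one has the same
effect as deleting them all at once. -/
theorem killP_spec {n : ℕ} {g : ℕ → ℕ → Prop} {dead : ℕ → ℕ} {s : Store} (h : WCtx n g dead s)
    {f : ℕ → ℕ} (hcnt : s.var 5 ≤ n) (hf : ∀ j, s.arr 2 (s.var 5 * n + j) = f j)
    (hR : RowCycle n g dead f (s.arr 1 (s.var 5))) :
    (killP.den s).arr 6 = (fun w => if w < n ∧ dead w = 0 ∧ Near n g dead f (s.arr 1 (s.var 5)) w
      then s.var 6 + 1 else dead w) ∧
    (killP.den s).arr 10 = (fun w => if w < n ∧ dead w = 0 ∧ Near n g dead f (s.arr 1 (s.var 5)) w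
      then 1 else s.arr 10 w) := by
  obtain ⟨L, hL⟩ : ∃ L, L = s.arr 1 (s.var 5) := ⟨_, rfl⟩
  rw [← hL] at hR ⊢
  have key := den_forN (x := 18) (p := .ite (.sub (.get 1 (.var 5)) (.var 18))
    (.seq (.assign 22 (.get 2 (.add (.get 5 (.var 5)) (.var 18))))
      (.ite (.add (.sub (.const 1) (.var 18)) (.sub (.get 7 (.var 22)) (.const 1))) killStarP .skip))
    .skip) s (fun i st =>
      st.arr 6 = (fun w => if w < n ∧ dead w = 0 ∧ Near n g dead f (min i L) w
        then s.var 6 + 1 else dead w) ∧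
      st.arr 10 = (fun w => if w < n ∧ dead w = 0 ∧ Near n g dead f (min i L) w
        then 1 else s.arr 10 w)) ?_ ?_
  · rw [h.n_eq, min_eq_right hR.le] at key
    exact key
  · simp [Near, h.dead_eq]
  · intro i st hi h18 hvar harr hI
    rw [h.n_eq] at hi
    have h1 : st.arr 1 = s.arr 1 := harr 1 (by decide)
    have h2 : st.arr 2 = s.arr 2 := harr 2 (by decide)
    have h7 : st.arr 7 = s.arr 7 := harr 7 (by decide)
    have h5 : st.var 5 = s.var 5 := hvar 5 (by decide) (by decide)
    have h6 : st.var 6 = s.var 6 := hvar 6 (by decide) (by decide)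
    have hc : Ctx n g st := h.toCtx.congr (hvar 0 (by decide) (by decide)) (harr 0 (by decide))
      (harr 5 (by decide))
    simp only [Store.arr_setVar]
    by_cases hiL : i < L
    swap
    · rw [den_ite_eq (by simp only [Expr.eval, h1, h5, h18]; omega), den_skip]
      rwa [min_eq_right (by omega)] at hI ⊢
    rw [den_ite_ne (by simp only [Expr.eval, h1, h5, h18]; omega), den_seq, den_assign]
    rw [min_eq_left hiL.le] at hI
    rw [min_eq_left hiL]
    have e : (Expr.get 2 (.add (.get 5 (.var 5)) (.var 18))).eval st = f i := by
      simp only [Expr.eval, h5, h2, h18]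
      rw [hc.row _ hcnt, hf]
    rw [e]
    obtain ⟨s1, hs1⟩ : ∃ s1, s1 = st.setVar 22 (f i) := ⟨_, rfl⟩
    rw [← hs1]
    have f22 : s1.var 22 = f i := by simp [hs1]
    have f18 : s1.var 18 = i := by simp [hs1, h18]
    have f6 : s1.var 6 = s.var 6 := by simp [hs1, h6]
    have a6 : s1.arr 6 = st.arr 6 := by simp [hs1]
    have a7 : s1.arr 7 = s.arr 7 := by simp [hs1, h7]
    have a10 : s1.arr 10 = st.arr 10 := by simp [hs1]
    have hw := h.weight_eq (f i) (hR.lt i hiL) (hR.dead_eq i hiL)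
    have hcond : (Expr.add (.sub (.const 1) (.var 18)) (.sub (.get 7 (.var 22)) (.const 1))).eval s1
        = 0 ↔ ¬ (i = 0 ∨ 3 ≤ deg n g dead (f i)) := by
      simp only [Expr.eval, f18, f22, a7, hw, weight]
      split_ifs with h3
      · simp only [h3, or_true, not_true, iff_false]; omega
      · simp only [h3, or_false]; omega
    simp only [near_succ]
    by_cases hy : i = 0 ∨ 3 ≤ deg n g dead (f i)
    · rw [den_ite_ne fun h => hcond.1 h hy]
      have hc1 : Ctx n g s1 := hc.congr (by simp [hs1]) (by simp [hs1]) (by simp [hs1])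
      obtain ⟨k1, k2⟩ := killStarP_spec hc1 (f22 ▸ hR.lt i hiL)
      rw [k1, k2, f22, f6, a6, a10, hI.1, hI.2]
      constructor
      · funext w
        by_cases c1 : w < n <;> by_cases c2 : dead w = 0 <;>
          by_cases c3 : Near n g dead f i w <;> simp [c1, c2, c3, hy]
      · funext w
        by_cases c1 : w < n <;> by_cases c2 : dead w = 0 <;>
          by_cases c3 : Near n g dead f i w <;> simp [c1, c2, c3, hy]
    · rw [den_ite_eq (hcond.2 hy), den_skip, a6, a10]
      simp only [hy, false_and, or_false]
      exact hI

end CycleFinder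
end

/-! ### The invariant of the greedy algorithm. -/

section

open scoped Classical

namespace ShortCycles

/-- The deletion times `τ'` arise from `τ` by deleting vertices at time `i`; time `n` stands for
vertices that remain. -/
structure Advance {V : Type*} (n i : ℕ) (τ τ' : V → ℕ) : Prop where
  lt : i < n
  eq_or : ∀ v, τ' v = τ v ∨ τ v = n ∧ τ' v = i

section

variable {V : Type*} {G : SimpleGraph V} {n i j : ℕ} {τ τ' : V → ℕ}

/-- A deletion at time `i` lowers values from `n` to `i` only. Everything defined by thresholds up
to `i`, such as the remaining graphs, degrees and branch vertices of earlier times, is therefore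
final. -/
theorem Advance.le_iff (h : Advance n i τ τ') (hj : j ≤ i) (v : V) : j ≤ τ' v ↔ j ≤ τ v := by
  have := h.lt
  rcases h.eq_or v with e | ⟨e, e'⟩ <;> omega

theorem Advance.eq_of_lt (h : Advance n i τ τ') {v : V} (hv : τ v < i) : τ' v = τ v := by
  have := h.lt
  rcases h.eq_or v with e | ⟨e, e'⟩ <;> omega

theorem Advance.aliveGraph_eq (h : Advance n i τ τ') (hj : j ≤ i) :
    aliveGraph G τ' j = aliveGraph G τ j := by
  ext u v
  simp only [aliveGraph_adj, h.le_iff hj]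

variable [Fintype V]

theorem Advance.aliveNbrs_eq (h : Advance n i τ τ') (hj : j ≤ i) (v : V) :
    aliveNbrs G τ' j v = aliveNbrs G τ j v := by
  ext u
  simp only [mem_aliveNbrs, h.le_iff hj]

theorem Advance.aliveBranch_eq (h : Advance n i τ τ') (hj : j ≤ i) :
    aliveBranch G τ' j = aliveBranch G τ j := by
  ext u
  simp only [aliveBranch, Finset.mem_filter, h.le_iff hj, h.aliveNbrs_eq hj]

theorem Advance.chosenAt (h : Advance n i τ τ') (hj : j < i) {r : V} {c : G.Walk r r}
    (hc : ChosenAt G τ j c) : ChosenAt G τ' j c where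
  isCycle := hc.isCycle
  le v hv := (h.le_iff hj.le v).2 (hc.le v hv)
  deleted v hv := by
    rw [h.aliveNbrs_eq hj.le]
    intro hv'
    obtain ⟨h1, h2⟩ := hc.deleted v hv hv'
    refine ⟨(h.eq_of_lt (h1 ▸ hj)).trans h1, fun w hw hw' => ?_⟩
    have h3 := h2 w hw ((h.le_iff hj.le w).1 hw')
    exact (h.eq_of_lt (h3 ▸ hj)).trans h3

end

/-- The state of the greedy algorithm after `i` rounds. Vertices that remain have `τ v = n`. The
vertices in `Z` were deleted around the centres in `X`, and `E` records the neighbours that remained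
at the deletion of the others. So far `cnt` cycles were found, at the times `T`, with lengths `lens`
and vertices `rows`. -/
structure State {n : ℕ} (G : SimpleGraph (Fin n)) (i : ℕ) (τ : Fin n → ℕ) (X Z : Finset (Fin n))
    (E : Fin n → Fin (n + 1)) (cnt : ℕ) (T lens rows : ℕ → ℕ) : Prop where
  time : ∀ v, τ v < i ∨ τ v = n
  card : (Finset.univ.filter fun v => τ v = n).card + i ≤ n
  subset : X ⊆ Z
  lt_of_mem : ∀ z ∈ Z, τ z < i
  star : ∀ z ∈ Z, ∃ x ∈ X, τ x = τ z ∧ (z = x ∨ G.Adj z x)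
  degen : ∀ v ∉ Z, τ v < i → (aliveNbrs G τ (τ v) v).card ≤ 1
  inj : ∀ u ∉ Z, ∀ v ∉ Z, τ u < i → τ u = τ v → u = v
  degree : ∀ q < cnt, ∀ v, T q ≤ τ v → 2 ≤ (aliveNbrs G τ (T q) v).card
  short : ∀ x ∈ X, ∀ u, ∀ c : (aliveGraph G τ (τ x)).Walk u u, c.IsCycle →
    (X.filter fun y => τ y = τ x).card ≤ cost (aliveBranch G τ (τ x)) c + 1
  last : ∀ v, v ∈ Z ∨ τ v = n → E v = Fin.last n
  parent_lt : ∀ v u, E v = Fin.castSucc u → τ v < τ u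
  cover : ∀ v ∉ Z, τ v < i → ∀ u ∉ Z, G.Adj v u → τ v ≤ τ u → E v = Fin.castSucc u
  cnt_le : cnt ≤ i
  T_lt : ∀ q < cnt, T q < i
  T_mono : ∀ q q', q < q' → q' < cnt → T q < T q'
  exists_eq : ∀ x ∈ X, ∃ q < cnt, τ x = T q
  cycle : ∀ q < cnt, ∃ (r : Fin n) (c : G.Walk r r), ChosenAt G τ (T q) c ∧ c.length = lens q ∧
    lens q ≤ n ∧ ∀ j < c.length, rows (q * n + j) = c.getVert j

section

variable {n : ℕ} {G : SimpleGraph (Fin n)} {i : ℕ} {τ τ' : Fin n → ℕ} {X Z : Finset (Fin n)}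
  {E : Fin n → Fin (n + 1)} {cnt : ℕ} {T lens rows lens' rows' : ℕ → ℕ}

theorem State.card_lt (h : State G i τ X Z E cnt T lens rows) (ha : Advance n i τ τ') {d : Fin n}
    (hd : τ d = n) (hd' : τ' d = i) : (Finset.univ.filter fun v => τ' v = n).card + (i + 1) ≤ n := by
  have h1 := h.card
  have h2 : (Finset.univ.filter fun v => τ' v = n).card <
      (Finset.univ.filter fun v => τ v = n).card := by
    refine Finset.card_lt_card ⟨fun v hv => ?_, fun hcon => ?_⟩
    · simp only [Finset.mem_filter, Finset.mem_univ, true_and] at hv ⊢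
      have := ha.lt
      rcases ha.eq_or v with e | ⟨e, e'⟩ <;> omega
    · have := hcon (Finset.mem_filter.2 ⟨Finset.mem_univ d, hd⟩)
      rw [Finset.mem_filter] at this
      have := ha.lt
      omega
  omega

theorem State.cycle_advance (h : State G i τ X Z E cnt T lens rows) (ha : Advance n i τ τ')
    (hlens : ∀ q < cnt, lens' q = lens q) (hrows : ∀ j < cnt * n, rows' j = rows j) :
    ∀ q < cnt, ∃ (r : Fin n) (c : G.Walk r r), ChosenAt G τ' (T q) c ∧ c.length = lens' q ∧
      lens' q ≤ n ∧ ∀ j < c.length, rows' (q * n + j) = c.getVert j := by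
  intro q hq
  obtain ⟨r, c, h1, h2, h3, h4⟩ := h.cycle q hq
  rw [hlens q hq]
  refine ⟨r, c, ha.chosenAt (h.T_lt q hq) h1, h2, h3, fun j hj => ?_⟩
  rw [← h4 j hj, hrows]
  have := Nat.mul_le_mul_right n (Nat.succ_le_of_lt hq)
  rw [Nat.succ_mul] at this
  omega

/-- The deleted vertex receives its only remaining neighbour, if any, as its parent. All conditions
about earlier deletions involve thresholds up to `i` and persist by `Advance`. -/
theorem State.prune (h : State G i τ X Z E cnt T lens rows) (hi : i < n) {d : Fin n}
    {e : Fin (n + 1)} (hd : τ d = n) (hdeg : (aliveNbrs G τ i d).card ≤ 1)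
    (he : e = Fin.last n ∧ (aliveNbrs G τ i d).card = 0 ∨
      ∃ u, e = Fin.castSucc u ∧ τ u = n ∧ G.Adj d u)
    (hlens : ∀ q < cnt, lens' q = lens q) (hrows : ∀ j < cnt * n, rows' j = rows j) :
    State G (i + 1) (Function.update τ d i) X Z (Function.update E d e) cnt T lens' rows' := by
  obtain ⟨τ', hτ'⟩ : ∃ τ', τ' = Function.update τ d i := ⟨_, rfl⟩
  have hne : ∀ v, v ≠ d → τ' v = τ v := fun v hv => by rw [hτ', Function.update_of_ne hv]
  have hd' : τ' d = i := by rw [hτ', Function.update_self]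
  have ha : Advance n i τ τ' := ⟨hi, fun v => by
    by_cases hv : v = d
    · subst hv; exact Or.inr ⟨hd, hd'⟩
    · exact Or.inl (hne v hv)⟩
  have hZd : d ∉ Z := fun hz => by have := h.lt_of_mem d hz; omega
  have hZ : ∀ z ∈ Z, τ' z = τ z := fun z hz => hne z fun e => hZd (e ▸ hz)
  have hlt : ∀ v, τ' v < i + 1 → v = d ∨ τ v < i ∧ τ' v = τ v := fun v hv => by
    by_cases hvd : v = d
    · exact Or.inl hvd
    · rw [hne v hvd] at hv ⊢
      have := h.time v
      exact Or.inr ⟨by omega, rfl⟩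
  rw [← hτ']
  constructor
  · intro v
    by_cases hv : v = d
    · subst hv; left; omega
    · rw [hne v hv]
      exact (h.time v).imp_left fun _ => by omega
  · exact h.card_lt ha hd hd'
  · exact h.subset
  · intro z hz
    rw [hZ z hz]
    have := h.lt_of_mem z hz
    omega
  · intro z hz
    obtain ⟨x, hx, h1, h2⟩ := h.star z hz
    exact ⟨x, hx, by rw [hZ z hz, hZ x (h.subset hx), h1], h2⟩
  · intro v hv hvi
    rcases hlt v hvi with rfl | ⟨h1, h2⟩
    · rwa [hd', ha.aliveNbrs_eq le_rfl]
    · rw [h2, ha.aliveNbrs_eq h1.le]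
      exact h.degen v hv h1
  · intro u hu v hv hui huv
    rcases hlt u hui with rfl | ⟨h1, h2⟩
    · rcases hlt v (by omega) with rfl | ⟨h3, h4⟩
      · rfl
      · omega
    · rcases hlt v (by omega) with rfl | ⟨h3, h4⟩
      · omega
      · exact h.inj u hu v hv h1 (by omega)
  · intro q hq v hv
    have := h.T_lt q hq
    rw [ha.aliveNbrs_eq this.le]
    exact h.degree q hq v ((ha.le_iff this.le v).1 hv)
  · intro x hx
    have h1 := h.lt_of_mem x (h.subset hx)
    rw [hZ x (h.subset hx), ha.aliveGraph_eq h1.le, ha.aliveBranch_eq h1.le]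
    have : (X.filter fun y => τ' y = τ x) = X.filter fun y => τ y = τ x :=
      Finset.filter_congr fun y hy => by rw [hZ y (h.subset hy)]
    rw [this]
    exact h.short x hx
  · intro v hv
    have hvd : v ≠ d := by
      rintro rfl
      rcases hv with hv | hv
      · exact hZd hv
      · omega
    rw [Function.update_of_ne hvd]
    exact h.last v (hv.imp_right fun e => (hne v hvd).symm.trans e)
  · intro v u hu
    by_cases hvd : v = d
    · subst hvd
      rw [Function.update_self] at hu
      rcases he with ⟨h1, -⟩ | ⟨w, rfl, h2, h3⟩
      · exact absurd (h1.symm.trans hu) (Fin.castSucc_lt_last u).ne'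
      · obtain rfl := Fin.castSucc_injective n hu
        rw [hd', hne _ h3.ne']
        omega
    · rw [Function.update_of_ne hvd] at hu
      have h1 := h.parent_lt v u hu
      have h2 : τ v < i := by
        rcases h.time v with h2 | h2
        · exact h2
        · exact absurd ((h.last v (Or.inr h2)).symm.trans hu) (Fin.castSucc_lt_last u).ne'
      rw [hne v hvd]
      have := (ha.le_iff (j := τ v + 1) h2 u).2 h1
      omega
  · intro v hv hvi u hu huv hle
    by_cases hvd : v = d
    · subst hvd
      rw [Function.update_self]
      have hmem : u ∈ aliveNbrs G τ i v :=
        mem_aliveNbrs.2 ⟨huv, (ha.le_iff le_rfl u).1 (hd' ▸ hle)⟩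
      rcases he with ⟨-, h1⟩ | ⟨w, rfl, h2, h3⟩
      · rw [Finset.card_eq_zero] at h1
        rw [h1] at hmem
        simp at hmem
      · rw [Finset.card_le_one.1 hdeg w (mem_aliveNbrs.2 ⟨h3, by omega⟩) u hmem]
    · rcases hlt v hvi with e | ⟨h1, h2⟩
      · exact absurd e hvd
      · rw [Function.update_of_ne hvd]
        rw [h2] at hle
        exact h.cover v hv h1 u hu huv ((ha.le_iff h1.le u).1 hle)
  · exact h.cnt_le.trans (Nat.le_succ i)
  · exact fun q hq => (h.T_lt q hq).trans (Nat.lt_succ_self i)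
  · exact h.T_mono
  · intro x hx
    rw [hZ x (h.subset hx)]
    exact h.exists_eq x hx
  · exact h.cycle_advance ha hlens hrows

/-- The vertices of `Y` become the centres with time `i`, and older centres have smaller times, so
the new instance of `short` is just `hmin`. The new cycle is recorded with time `i`. -/
theorem State.delete (h : State G i τ X Z E cnt T lens rows) (hi : i < n) {r : Fin n}
    {c : G.Walk r r} (hc : c.IsCycle) (hc' : ∀ v ∈ c.support, τ v = n) {Y : Finset (Fin n)}
    (hY : ∀ v, v ∈ Y ↔ v ∈ c.support ∧ (v = r ∨ 3 ≤ (aliveNbrs G τ i v).card))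
    (hdeg : ∀ v, τ v = n → 2 ≤ (aliveNbrs G τ i v).card)
    (hmin : ∀ u, ∀ c' : (aliveGraph G τ i).Walk u u, c'.IsCycle →
      Y.card ≤ cost (aliveBranch G τ i) c' + 1)
    (hτ' : ∀ v, τ' v = if τ v = n ∧ ∃ x ∈ Y, v = x ∨ G.Adj v x then i else τ v)
    (hlens : ∀ q < cnt, lens' q = lens q) (hrows : ∀ j < cnt * n, rows' j = rows j)
    (hlens' : lens' cnt = c.length) (hlen : c.length ≤ n)
    (hrows' : ∀ j < c.length, rows' (cnt * n + j) = c.getVert j) :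
    State G (i + 1) τ' (X ∪ Y)
      (Z ∪ Finset.univ.filter fun v => τ v = n ∧ ∃ x ∈ Y, v = x ∨ G.Adj v x) E (cnt + 1)
      (Function.update T cnt i) lens' rows' := by
  obtain ⟨K, hK⟩ : ∃ K : Finset (Fin n), K = Finset.univ.filter fun v =>
    τ v = n ∧ ∃ x ∈ Y, v = x ∨ G.Adj v x := ⟨_, rfl⟩
  have hmK : ∀ v, v ∈ K ↔ τ v = n ∧ ∃ x ∈ Y, v = x ∨ G.Adj v x := fun v => by simp [hK]
  rw [← hK]
  have hKi : ∀ v ∈ K, τ' v = i := fun v hv => by rw [hτ', if_pos ((hmK v).1 hv)]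
  have hKn : ∀ v ∈ K, τ v = n := fun v hv => ((hmK v).1 hv).1
  have hne : ∀ v, v ∉ K → τ' v = τ v := fun v hv => by rw [hτ', if_neg fun h => hv ((hmK v).2 h)]
  have ha : Advance n i τ τ' := ⟨hi, fun v => by
    by_cases hv : v ∈ K
    · exact Or.inr ⟨hKn v hv, hKi v hv⟩
    · exact Or.inl (hne v hv)⟩
  have hYK : Y ⊆ K := fun v hv => (hmK v).2 ⟨hc' v ((hY v).1 hv).1, v, hv, Or.inl rfl⟩
  have hZ : ∀ z ∈ Z, τ' z = τ z := fun z hz => ha.eq_of_lt (h.lt_of_mem z hz)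
  have hX : ∀ x ∈ X, τ' x = τ x := fun x hx => hZ x (h.subset hx)
  have hXi : ∀ x ∈ X, τ x < i := fun x hx => h.lt_of_mem x (h.subset hx)
  have hrY : r ∈ Y := (hY r).2 ⟨c.start_mem_support, Or.inl rfl⟩
  have hT : ∀ q < cnt, Function.update T cnt i q = T q := fun q hq =>
    Function.update_of_ne hq.ne _ _
  have hlt : ∀ v ∉ Z ∪ K, τ' v < i + 1 → v ∉ Z ∧ τ v < i ∧ τ' v = τ v := fun v hv hvi => by
    rw [Finset.mem_union, not_or] at hv
    have h1 := hne v hv.2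
    have := h.time v
    exact ⟨hv.1, by omega, h1⟩
  have hnotZ : ∀ v ∉ Z ∪ K, v ∉ Z := fun v hv hz => hv (Finset.mem_union_left _ hz)
  constructor
  · intro v
    by_cases hv : v ∈ K
    · rw [hKi v hv]; left; omega
    · rw [hne v hv]
      exact (h.time v).imp_left fun _ => by omega
  · exact h.card_lt ha (hKn r (hYK hrY)) (hKi r (hYK hrY))
  · exact Finset.union_subset_union h.subset hYK
  · intro z hz
    rcases Finset.mem_union.1 hz with hz | hz
    · rw [hZ z hz]
      have := h.lt_of_mem z hz
      omega
    · rw [hKi z hz]; omega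
  · intro z hz
    rcases Finset.mem_union.1 hz with hz | hz
    · obtain ⟨x, hx, h1, h2⟩ := h.star z hz
      exact ⟨x, Finset.mem_union_left _ hx, by rw [hZ z hz, hX x hx, h1], h2⟩
    · obtain ⟨x, hx, h1⟩ := ((hmK z).1 hz).2
      exact ⟨x, Finset.mem_union_right _ hx, by rw [hKi z hz, hKi x (hYK hx)], h1⟩
  · intro v hv hvi
    obtain ⟨h0, h1, h2⟩ := hlt v hv hvi
    rw [h2, ha.aliveNbrs_eq h1.le]
    exact h.degen v h0 h1
  · intro u hu v hv hui huv
    obtain ⟨h0, h1, h2⟩ := hlt u hu hui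
    obtain ⟨h3, h4, h5⟩ := hlt v hv (by omega)
    exact h.inj u h0 v h3 h1 (by omega)
  · intro q hq v hv
    rcases Nat.lt_succ_iff_lt_or_eq.1 hq with hq | rfl
    · rw [hT q hq] at hv ⊢
      have := h.T_lt q hq
      rw [ha.aliveNbrs_eq this.le]
      exact h.degree q hq v ((ha.le_iff this.le v).1 hv)
    · rw [Function.update_self] at hv ⊢
      rw [ha.aliveNbrs_eq le_rfl]
      rw [ha.le_iff le_rfl] at hv
      have := h.time v
      exact hdeg v (by omega)
  · intro x hx
    rcases Finset.mem_union.1 hx with hx | hx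
    · have h1 := hXi x hx
      rw [hX x hx, ha.aliveGraph_eq h1.le, ha.aliveBranch_eq h1.le]
      have : ((X ∪ Y).filter fun y => τ' y = τ x) = X.filter fun y => τ y = τ x := by
        ext y
        simp only [Finset.mem_filter, Finset.mem_union]
        constructor
        · rintro ⟨hy | hy, e⟩
          · exact ⟨hy, (hX y hy).symm.trans e⟩
          · rw [hKi y (hYK hy)] at e
            omega
        · rintro ⟨hy, e⟩
          exact ⟨Or.inl hy, (hX y hy).trans e⟩
      rw [this]
      exact h.short x hx
    · rw [hKi x (hYK hx), ha.aliveGraph_eq le_rfl, ha.aliveBranch_eq le_rfl]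
      have : ((X ∪ Y).filter fun y => τ' y = i) ⊆ Y := by
        intro y hy
        rw [Finset.mem_filter, Finset.mem_union] at hy
        rcases hy.1 with h1 | h1
        · have := hX y h1
          have := hXi y h1
          omega
        · exact h1
      exact fun u c' hc' => (Finset.card_le_card this).trans (hmin u c' hc')
  · intro v hv
    rw [Finset.mem_union] at hv
    refine h.last v ?_
    rcases hv with (hv | hv) | hv
    · exact Or.inl hv
    · exact Or.inr (hKn v hv)
    · rcases ha.eq_or v with e | ⟨e, e'⟩
      · exact Or.inr (e ▸ hv)
      · exact Or.inr e
  · intro v u hu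
    have h1 := h.parent_lt v u hu
    have h2 : τ v < i := by
      rcases h.time v with h2 | h2
      · exact h2
      · exact absurd ((h.last v (Or.inr h2)).symm.trans hu) (Fin.castSucc_lt_last u).ne'
    rw [ha.eq_of_lt h2]
    have := (ha.le_iff (j := τ v + 1) h2 u).2 h1
    omega
  · intro v hv hvi u hu huv hle
    obtain ⟨h0, h1, h2⟩ := hlt v hv hvi
    rw [h2] at hle
    exact h.cover v h0 h1 u (hnotZ u hu) huv ((ha.le_iff h1.le u).1 hle)
  · exact Nat.succ_le_succ h.cnt_le
  · intro q hq
    rcases Nat.lt_succ_iff_lt_or_eq.1 hq with hq | rfl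
    · rw [hT q hq]
      exact (h.T_lt q hq).trans (Nat.lt_succ_self i)
    · rw [Function.update_self]; exact Nat.lt_succ_self i
  · intro q q' hqq hq
    rcases Nat.lt_succ_iff_lt_or_eq.1 hq with hq | rfl
    · rw [hT q (hqq.trans hq), hT q' hq]
      exact h.T_mono q q' hqq hq
    · rw [hT q hqq, Function.update_self]
      exact h.T_lt q hqq
  · intro x hx
    rcases Finset.mem_union.1 hx with hx | hx
    · obtain ⟨q, hq, e⟩ := h.exists_eq x hx
      exact ⟨q, hq.trans (Nat.lt_succ_self _), by rw [hX x hx, hT q hq, e]⟩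
    · exact ⟨cnt, Nat.lt_succ_self _, by rw [hKi x (hYK hx), Function.update_self]⟩
  · intro q hq
    rcases Nat.lt_succ_iff_lt_or_eq.1 hq with hq | rfl
    · rw [hT q hq]
      exact h.cycle_advance ha hlens hrows q hq
    · refine ⟨r, c, ?_, hlens'.symm, hlens'.trans_le hlen, hrows'⟩
      rw [Function.update_self]
      refine ⟨hc, fun v hv => ?_, fun v hv hv' => ?_⟩
      · rw [ha.le_iff le_rfl, hc' v hv]; exact hi.le
      · rw [ha.aliveNbrs_eq le_rfl] at hv'
        have hvY := (hY v).2 ⟨hv, hv'⟩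
        refine ⟨hKi v (hYK hvY), fun w hw hwi => hKi w ((hmK w).2 ⟨?_, v, hvY, Or.inr hw.symm⟩)⟩
        rw [ha.le_iff le_rfl] at hwi
        have := h.time w
        omega

/-- The number of rounds is fixed to `n`; once no vertex remains, the other rounds change nothing.
-/
theorem State.idle (h : State G i τ X Z E cnt T lens rows) (hn : ∀ v, τ v ≠ n) (hi : i < n)
    (hlens : ∀ q < cnt, lens' q = lens q) (hrows : ∀ j < cnt * n, rows' j = rows j) :
    State G (i + 1) τ X Z E cnt T lens' rows' where
  time v := (h.time v).imp_left fun _ => by omega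
  card := by
    rw [Finset.filter_false_of_mem fun v _ => hn v]
    simpa using hi
  subset := h.subset
  lt_of_mem z hz := (h.lt_of_mem z hz).trans (Nat.lt_succ_self i)
  star := h.star
  degen v hv _ := h.degen v hv ((h.time v).resolve_right (hn v))
  inj u hu v hv _ := h.inj u hu v hv ((h.time u).resolve_right (hn u))
  degree := h.degree
  short := h.short
  last := h.last
  parent_lt := h.parent_lt
  cover v hv _ := h.cover v hv ((h.time v).resolve_right (hn v))
  cnt_le := h.cnt_le.trans (Nat.le_succ i)
  T_lt q hq := (h.T_lt q hq).trans (Nat.lt_succ_self i)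
  T_mono := h.T_mono
  exists_eq := h.exists_eq
  cycle := h.cycle_advance ⟨hi, fun _ => Or.inl rfl⟩ hlens hrows

/-- By `card` at most `n - i` vertices remain after `i` rounds, hence none after `n` rounds. -/
theorem State.lt_of_last (h : State G n τ X Z E cnt T lens rows) (v : Fin n) : τ v < n := by
  refine (h.time v).resolve_right fun hv => ?_
  have h1 := h.card
  have h2 : 0 < (Finset.univ.filter fun v => τ v = n).card :=
    Finset.card_pos.2 ⟨v, by simpa using hv⟩
  omega

theorem State.isDismantling (h : State G n τ X Z E cnt T lens rows) : IsDismantling G τ X Z where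
  subset := h.subset
  star := h.star
  degen v hv := h.degen v hv (h.lt_of_last v)
  inj u hu v hv := h.inj u hu v hv (h.lt_of_last u)
  degree x hx := by
    obtain ⟨q, hq, e⟩ := h.exists_eq x hx
    rw [e]
    exact h.degree q hq
  short := h.short

theorem State.isParent (h : State G n τ X Z E cnt T lens rows) : IsParent G τ Z E where
  lt := h.parent_lt
  cover v hv := h.cover v hv (h.lt_of_last v)

theorem State.card_image_le (h : State G n τ X Z E cnt T lens rows) : (X.image τ).card ≤ cnt := by
  have : X.image τ ⊆ (Finset.range cnt).image T := by
    intro y hy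
    obtain ⟨x, hx, rfl⟩ := Finset.mem_image.1 hy
    obtain ⟨q, hq, e⟩ := h.exists_eq x hx
    exact Finset.mem_image.2 ⟨q, Finset.mem_range.2 hq, e.symm⟩
  simpa using (Finset.card_le_card this).trans Finset.card_image_le

theorem State.exists_packing (h : State G n τ X Z E cnt T lens rows) {k : ℕ} (hk : k ≤ cnt) :
    ∃ (root : Fin k → Fin n) (cyc : ∀ i, G.Walk (root i) (root i)),
      IsInducedCyclePacking G root cyc ∧ ∀ i : Fin k, lens i = (cyc i).length ∧
        ∀ j < (cyc i).length, rows (i * n + j) = (cyc i).getVert j := by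
  choose root cyc h1 h2 h3 h4 using fun i : Fin k => h.cycle i (i.2.trans_le hk)
  exact ⟨root, cyc, isInducedCyclePacking_of_chosenAt (T := fun i => T i)
    (fun i j hij => h.T_mono i j hij (j.2.trans_le hk)) h1 (fun i => h.degree i (i.2.trans_le hk)),
    fun i => ⟨(h2 i).symm, h4 i⟩⟩

end

end ShortCycles
end

/-! ### Cycles as sequences of numbers and as walks. -/

section

open scoped Classical

namespace CycleFinder

open ShortCycles

/-- The walk through a sequence of successively adjacent vertices. -/
theorem exists_walk_getVert {V : Type*} {G : SimpleGraph V} (m : ℕ) (F : ℕ → V)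
    (h : ∀ j < m, G.Adj (F j) (F (j + 1))) :
    ∃ p : G.Walk (F 0) (F m), p.length = m ∧ ∀ j ≤ m, p.getVert j = F j := by
  induction m generalizing F with
  | zero => exact ⟨.nil, rfl, fun j hj => by obtain rfl : j = 0 := by omega
                                             rfl⟩
  | succ m ih =>
    obtain ⟨p, h1, h2⟩ := ih (fun j => F (j + 1)) fun j hj => h (j + 1) (by omega)
    refine ⟨.cons (h 0 (by omega)) p, by simp [h1], fun j hj => ?_⟩
    rcases j with _ | j
    · simp
    · rw [SimpleGraph.Walk.getVert_cons_succ]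
      exact h2 j (by omega)

/-- Adjacency of natural numbers standing for vertices. -/
def natAdj {n : ℕ} (G : SimpleGraph (Fin n)) (u v : ℕ) : Prop :=
  ∃ (hu : u < n) (hv : v < n), G.Adj ⟨u, hu⟩ ⟨v, hv⟩

section

variable {n : ℕ} {G : SimpleGraph (Fin n)}

@[simp] theorem natAdj_val {u v : Fin n} : natAdj G u v ↔ G.Adj u v :=
  ⟨fun ⟨_, _, h⟩ => h, fun h => ⟨u.2, v.2, h⟩⟩

theorem natAdj_symm (u v : ℕ) : natAdj G u v → natAdj G v u := fun ⟨hu, hv, h⟩ => ⟨hv, hu, h.symm⟩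

theorem not_natAdj_self (u : ℕ) : ¬ natAdj G u u := fun ⟨_, _, h⟩ => h.ne rfl

variable {i : ℕ} {dead : ℕ → ℕ} {τ : Fin n → ℕ}

theorem deg_eq_card_aliveNbrs (hτ : ∀ v : Fin n, i ≤ τ v ↔ dead v = 0) (v : Fin n) :
    deg n (natAdj G) dead v = (aliveNbrs G τ i v).card := by
  rw [← Finset.card_map Fin.valEmbedding, deg]
  congr 1
  ext w
  simp only [Finset.mem_filter, Finset.mem_range, Finset.mem_map, mem_aliveNbrs,
    Fin.valEmbedding_apply]
  constructor
  · rintro ⟨hw, h1, h2⟩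
    exact ⟨⟨w, hw⟩, ⟨natAdj_val.1 h2, (hτ ⟨w, hw⟩).2 h1⟩, rfl⟩
  · rintro ⟨w, ⟨h1, h2⟩, rfl⟩
    exact ⟨w.2, (hτ w).1 h2, natAdj_val.2 h1⟩

theorem rowCycle_of_isCycle (hτ : ∀ v : Fin n, i ≤ τ v ↔ dead v = 0) {u : Fin n}
    {c : (aliveGraph G τ i).Walk u u} (hc : c.IsCycle) :
    RowCycle n (natAdj G) dead (fun j => c.getVert j) c.length := by
  have h3 := hc.three_le_length
  have hadj : ∀ j < c.length, G.Adj (c.getVert j) (c.getVert (j + 1)) ∧ i ≤ τ (c.getVert j) :=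
    fun j hj => by
      have := aliveGraph_adj.1 (c.adj_getVert_succ hj)
      exact ⟨this.1, this.2.1⟩
  refine ⟨h3, fun j _ => (c.getVert j).2, fun j hj => (hτ _).1 (hadj j hj).2, fun a ha b hb e => ?_,
    fun j hj => natAdj_val.2 (hadj j (by omega)).1, ?_⟩
  · exact hc.getVert_injOn' (show a ≤ c.length - 1 by omega) (show b ≤ c.length - 1 by omega)
      (Fin.ext e)
  · have h1 := (hadj (c.length - 1) (by omega)).1
    rw [show c.length - 1 + 1 = c.length by omega, c.getVert_length] at h1
    rw [c.getVert_zero]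
    exact natAdj_val.2 h1

theorem exists_isCycle_of_rowCycle {f : ℕ → ℕ} {L : ℕ} (h : RowCycle n (natAdj G) dead f L) :
    ∃ (r : Fin n) (c : G.Walk r r), c.IsCycle ∧ c.length = L ∧ ∀ j < L, f j = c.getVert j := by
  have h3 := h.three_le
  -- `F` continues the sequence by its first vertex at index `L`, which makes the walk through it
  -- closed.
  obtain ⟨F, hF, hFL⟩ : ∃ F : ℕ → Fin n, (∀ j < L, (F j : ℕ) = f j) ∧ F L = F 0 :=
    ⟨fun j => if hj : j < L then ⟨f j, h.lt j hj⟩ else ⟨f 0, h.lt 0 (by omega)⟩,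
      fun j hj => by simp [hj], by simp [show 0 < L by omega]⟩
  have hwalk := exists_walk_getVert (G := G) L F fun j hj => by
    rw [← natAdj_val, hF j hj]
    rcases Nat.lt_or_ge (j + 1) L with hj' | hj'
    · rw [hF _ hj']; exact h.adj j hj'
    · obtain rfl : j = L - 1 := by omega
      rw [show L - 1 + 1 = L by omega, hFL, hF 0 (by omega)]
      exact h.adj_last
  rw [hFL] at hwalk
  obtain ⟨p, h1, h2⟩ := hwalk
  refine ⟨F 0, p, ?_, h1, fun j hj => by rw [h2 j hj.le, hF j hj]⟩
  rw [SimpleGraph.Walk.isCycle_iff_isPath_tail_and_le_length]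
  refine ⟨?_, by omega⟩
  rw [← SimpleGraph.Walk.IsPath.getVert_injOn_iff]
  have hlen : p.tail.length + 1 = L := by
    rw [SimpleGraph.Walk.length_tail_add_one, h1]
    rw [SimpleGraph.Walk.not_nil_iff_lt_length]; omega
  have hcase : ∀ a, a + 1 ≤ L → (p.getVert (a + 1) : ℕ) = f (if a + 1 < L then a + 1 else 0) := by
    intro a ha
    rw [h2 _ ha]
    split_ifs with ha'
    · exact hF _ ha'
    · rw [show a + 1 = L by omega, hFL]; exact hF 0 (by omega)
  intro a ha b hb hab
  simp only [Set.mem_ofPred_eq] at ha hb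
  rw [SimpleGraph.Walk.getVert_tail, SimpleGraph.Walk.getVert_tail] at hab
  have e := congrArg Fin.val hab
  rw [hcase a (by omega), hcase b (by omega)] at e
  have := h.inj _ (by split_ifs <;> omega) _ (by split_ifs <;> omega) e
  split_ifs at this <;> omega

/-- As a cycle has at most `n` vertices, the factor `n + 1` makes the comparison of weights
lexicographic: first the number of branch vertices, then the length. -/
theorem sum_weight (f : ℕ → ℕ) (L : ℕ) (g : ℕ → ℕ → Prop) :
    ∑ j ∈ Finset.range L, weight n g dead (f j) =
      L + (n + 1) * ((Finset.range L).filter fun j => 3 ≤ deg n g dead (f j)).card := by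
  have : ∀ j, weight n g dead (f j) = 1 + if 3 ≤ deg n g dead (f j) then n + 1 else 0 := fun j => by
    unfold weight
    split_ifs <;> omega
  simp only [this, Finset.sum_add_distrib, ← Finset.sum_filter, Finset.sum_const, smul_eq_mul,
    Finset.card_range, mul_one]
  ring

/-- The centres on a cycle of minimum weight. -/
theorem card_le_cost_of_min (hτ : ∀ v : Fin n, i ≤ τ v ↔ dead v = 0) {f : ℕ → ℕ}
    {r : Fin n} {c : G.Walk r r} (hf : ∀ j < c.length, f j = c.getVert j) {Y : Finset (Fin n)}
    (hY : ∀ v, v ∈ Y → v ∈ c.support ∧ (v = r ∨ 3 ≤ (aliveNbrs G τ i v).card))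
    (hmin : ∀ f' L', RowCycle n (natAdj G) dead f' L' →
      ∑ j ∈ Finset.range c.length, weight n (natAdj G) dead (f j) ≤
        ∑ j ∈ Finset.range L', weight n (natAdj G) dead (f' j))
    {u : Fin n} {c' : (aliveGraph G τ i).Walk u u} (hc' : c'.IsCycle) :
    Y.card ≤ cost (aliveBranch G τ i) c' + 1 := by
  have hR := rowCycle_of_isCycle hτ hc'
  have h1 := hmin _ _ hR
  rw [sum_weight, sum_weight] at h1
  obtain ⟨A, hA⟩ : ∃ A, A = (Finset.range c.length).filter
    fun j => 3 ≤ deg n (natAdj G) dead (f j) := ⟨_, rfl⟩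
  obtain ⟨B, hB⟩ : ∃ B, B = (Finset.range c'.length).filter
    fun j => 3 ≤ deg n (natAdj G) dead (c'.getVert j) := ⟨_, rfl⟩
  rw [← hA, ← hB] at h1
  -- One more branch vertex costs `n + 1`, which no difference in length can make up for.
  have h2 : A.card ≤ B.card := by
    by_contra hlt
    have h4 := Nat.mul_le_mul_left (n + 1) (Nat.succ_le_of_lt (not_le.1 hlt))
    rw [Nat.succ_eq_add_one, Nat.mul_add] at h4
    have := hR.le
    omega
  have h3 : B.card ≤ cost (aliveBranch G τ i) c' := by
    refine Finset.card_le_card_of_injOn c'.getVert (fun j hj => ?_) fun a ha b hb e => ?_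
    · have hj := hB ▸ hj
      simp only [Finset.coe_filter, Finset.mem_range, Set.mem_ofPred_eq] at hj
      simp only [Finset.coe_inter, Set.mem_inter_iff, Finset.mem_coe, List.mem_toFinset,
        aliveBranch, Finset.mem_filter, Finset.mem_univ, true_and]
      refine ⟨c'.getVert_mem_support j, (hτ _).2 (hR.dead_eq j hj.1), ?_⟩
      rw [← deg_eq_card_aliveNbrs hτ]
      exact hj.2
    · rw [hB] at ha hb
      simp only [Finset.coe_filter, Finset.mem_range, Set.mem_ofPred_eq] at ha hb
      exact hc'.getVert_injOn' (show a ≤ c'.length - 1 by omega)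
        (show b ≤ c'.length - 1 by omega) e
  -- The root is a centre even if it is no branch vertex; this accounts for the summand 1.
  have h4 : Y ⊆ insert r (A.image c.getVert) := by
    intro v hv
    obtain ⟨hs, hv⟩ := hY v hv
    rw [Finset.mem_insert, or_iff_not_imp_left]
    intro hvr
    obtain ⟨j, rfl, hj⟩ := SimpleGraph.Walk.mem_support_iff_exists_getVert.1 hs
    have hj' : j < c.length := by
      rcases hj.lt_or_eq with hj | rfl
      · exact hj
      · exact absurd c.getVert_length hvr
    refine Finset.mem_image_of_mem _ ?_
    rw [hA, Finset.mem_filter, Finset.mem_range, hf j hj', deg_eq_card_aliveNbrs hτ]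
    exact ⟨hj', hv.resolve_left hvr⟩
  have h5 := (Finset.card_le_card h4).trans (Finset.card_insert_le _ _)
  have h6 := Finset.card_image_le (s := A) (f := c.getVert)
  omega

end

end CycleFinder
end

/-! ### One round of the algorithm on the machine. -/

section

open scoped Classical

namespace CycleFinder

open LProg ShortCycles

/-- The deletion time of a vertex: the array stores its successor, or zero for the vertices that
remain. -/
def time (n : ℕ) (dead : ℕ → ℕ) (v : Fin n) : ℕ := if dead v = 0 then n else dead v - 1

/-- The arrays hold the state of the greedy algorithm after `i` rounds. -/
structure Data {n : ℕ} (G : SimpleGraph (Fin n)) (i : ℕ) (dead zed par : ℕ → ℕ) (cnt : ℕ)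
    (lens rows : ℕ → ℕ) : Prop where
  dead_le : ∀ v : Fin n, dead v ≤ i
  state : ∃ (X Z : Finset (Fin n)) (E : Fin n → Fin (n + 1)) (T : ℕ → ℕ),
    State G i (time n dead) X Z E cnt T lens rows ∧
    (∀ v : Fin n, zed v = if v ∈ Z then 1 else 0) ∧ ∀ v : Fin n, par v = E v

section

variable {n : ℕ} {G : SimpleGraph (Fin n)} {i : ℕ} {dead zed par : ℕ → ℕ} {cnt : ℕ}
  {lens rows lens' rows' : ℕ → ℕ}

theorem Data.time_eq_iff (h : Data G i dead zed par cnt lens rows) (hi : i ≤ n) (v : Fin n) :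
    time n dead v = n ↔ dead v = 0 := by
  have := h.dead_le v
  unfold time
  split_ifs <;> omega

theorem Data.le_time_iff (h : Data G i dead zed par cnt lens rows) (hi : i ≤ n) (v : Fin n) :
    i ≤ time n dead v ↔ dead v = 0 := by
  have := h.dead_le v
  unfold time
  split_ifs <;> omega

theorem Data.prune (h : Data G i dead zed par cnt lens rows) (hi : i < n) {d e : ℕ} (hd : d < n)
    (h0 : dead d = 0) (hdeg : deg n (natAdj G) dead d < 2)
    (he : e = n ∧ deg n (natAdj G) dead d = 0 ∨ e < n ∧ dead e = 0 ∧ natAdj G d e)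
    (hlens : ∀ q < cnt, lens' q = lens q) (hrows : ∀ j < cnt * n, rows' j = rows j) :
    Data G (i + 1) (Function.update dead d (i + 1)) zed (Function.update par d e) cnt
      lens' rows' := by
  obtain ⟨X, Z, E, T, hS, hz, hE⟩ := h.state
  lift d to Fin n using hd
  have hdeg' := deg_eq_card_aliveNbrs (G := G) (h.le_time_iff hi.le) d
  rw [hdeg'] at hdeg he
  refine ⟨fun v => ?_, X, Z, Function.update E d (if he : e < n then Fin.castSucc ⟨e, he⟩ else
    Fin.last n), T, ?_, hz, fun v => ?_⟩
  · rw [Function.update_apply]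
    have := h.dead_le v
    split_ifs <;> omega
  · have ht : time n (Function.update dead d (i + 1)) = Function.update (time n dead) d i := by
      funext v
      by_cases hv : v = d
      · subst hv; simp [time]
      · have : (v : ℕ) ≠ d := fun e => hv (Fin.ext e)
        simp [time, hv, this]
    rw [ht]
    refine hS.prune hi ((h.time_eq_iff hi.le d).2 h0) (by omega) ?_ hlens hrows
    rcases he with ⟨rfl, h1⟩ | ⟨h1, h2, h3⟩
    · exact Or.inl ⟨dif_neg (lt_irrefl _), h1⟩
    · rw [dif_pos h1]
      exact Or.inr ⟨⟨e, h1⟩, rfl, (h.time_eq_iff hi.le _).2 h2, natAdj_val.1 h3⟩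
  · by_cases hv : v = d
    · subst hv
      rw [Function.update_self, Function.update_self]
      split_ifs with h1
      · rfl
      · rcases he with ⟨rfl, -⟩ | ⟨h2, -⟩
        · rfl
        · exact absurd h2 h1
    · rw [Function.update_of_ne hv, Function.update_of_ne fun e => hv (Fin.ext e), hE]

theorem Data.delete (h : Data G i dead zed par cnt lens rows) (hi : i < n) {f : ℕ → ℕ} {L : ℕ}
    (hf : RowCycle n (natAdj G) dead f L) (hdeg : ∀ v < n, dead v = 0 → 2 ≤ deg n (natAdj G) dead v)
    (hmin : ∀ f' L', RowCycle n (natAdj G) dead f' L' →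
      ∑ j ∈ Finset.range L, weight n (natAdj G) dead (f j) ≤
        ∑ j ∈ Finset.range L', weight n (natAdj G) dead (f' j))
    (hlens : ∀ q < cnt, lens' q = lens q) (hrows : ∀ j < cnt * n, rows' j = rows j)
    (hL : lens' cnt = L) (hrow : ∀ j < L, rows' (cnt * n + j) = f j) :
    Data G (i + 1)
      (fun w => if w < n ∧ dead w = 0 ∧ Near n (natAdj G) dead f L w then i + 1 else dead w)
      (fun w => if w < n ∧ dead w = 0 ∧ Near n (natAdj G) dead f L w then 1 else zed w) par
      (cnt + 1) lens' rows' := by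
  obtain ⟨X, Z, E, T, hS, hz, hE⟩ := h.state
  obtain ⟨r, c, hc, hlen, hget⟩ := exists_isCycle_of_rowCycle hf
  have hτ := h.le_time_iff hi.le
  have hτn := h.time_eq_iff hi.le
  have h3 := hf.three_le
  have hsupp : ∀ v ∈ c.support, ∃ j < L, v = c.getVert j := by
    intro v hv
    obtain ⟨j, rfl, hj⟩ := SimpleGraph.Walk.mem_support_iff_exists_getVert.1 hv
    rcases hj.lt_or_eq with hj | rfl
    · exact ⟨j, by omega, rfl⟩
    · exact ⟨0, by omega, by rw [c.getVert_length, c.getVert_zero]⟩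
  obtain ⟨Y, hY⟩ : ∃ Y : Finset (Fin n), ∀ v, v ∈ Y ↔ v ∈ c.support ∧
      (v = r ∨ 3 ≤ (aliveNbrs G (time n dead) i v).card) :=
    ⟨Finset.univ.filter fun v => v ∈ c.support ∧
      (v = r ∨ 3 ≤ (aliveNbrs G (time n dead) i v).card), fun v => by simp⟩
  -- Position 0 of the row is the root of the cycle, and the positions below `L` already exhaust the
  -- support, since the walk ends where it starts.
  have hnear : ∀ v : Fin n, Near n (natAdj G) dead f L v ↔ ∃ x ∈ Y, v = x ∨ G.Adj v x := by
    intro v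
    constructor
    · rintro ⟨j, hj, h1, h2⟩
      rw [hget j hj, deg_eq_card_aliveNbrs hτ] at h1
      rw [hget j hj, natAdj_val] at h2
      refine ⟨c.getVert j, (hY _).2 ⟨c.getVert_mem_support j, h1.imp_left ?_⟩,
        h2.imp Fin.ext fun h => h.symm⟩
      rintro rfl
      exact c.getVert_zero
    · rintro ⟨x, hx, h2⟩
      obtain ⟨h1, h4⟩ := (hY x).1 hx
      obtain ⟨j, hj, hjx⟩ : ∃ j < L, x = c.getVert j ∧
          (j = 0 ∨ 3 ≤ (aliveNbrs G (time n dead) i (c.getVert j)).card) := by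
        rcases h4 with rfl | h4
        · exact ⟨0, by omega, c.getVert_zero.symm, Or.inl rfl⟩
        · obtain ⟨j, hj, rfl⟩ := hsupp x h1
          exact ⟨j, hj, rfl, Or.inr h4⟩
      refine ⟨j, hj, ?_, ?_⟩
      · rw [hget j hj, deg_eq_card_aliveNbrs hτ]
        exact hjx.2
      · rw [hget j hj, natAdj_val, ← hjx.1]
        exact h2.imp (congrArg _) fun h => h.symm
  have hiff : ∀ v : Fin n, ((v : ℕ) < n ∧ dead v = 0 ∧ Near n (natAdj G) dead f L v) ↔
      (time n dead v = n ∧ ∃ x ∈ Y, v = x ∨ G.Adj v x) := fun v => by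
    rw [hnear, hτn]
    simp
  refine ⟨fun v => ?_, X ∪ Y, _, E, Function.update T cnt i, hS.delete hi hc (fun v hv => ?_) hY
    (fun v hv => ?_) (fun u c' hc' => ?_) (fun v => ?_) hlens hrows (hL.trans hlen.symm)
    (hlen.trans_le hf.le) fun j hj => ?_, fun v => ?_, hE⟩
  · have := h.dead_le v
    split_ifs <;> omega
  · obtain ⟨j, hj, rfl⟩ := hsupp v hv
    rw [hτn, ← hget j hj]
    exact hf.dead_eq j hj
  · rw [← deg_eq_card_aliveNbrs hτ]
    exact hdeg v v.2 ((hτn v).1 hv)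
  · subst hlen
    exact card_le_cost_of_min hτ hget (fun v => (hY v).1) hmin hc'
  · rw [time]
    simp only [hiff]
    by_cases hv : time n dead v = n ∧ ∃ x ∈ Y, v = x ∨ G.Adj v x
    · simp [if_pos hv]
    · simp only [if_neg hv]
      rfl
  · rw [hrow j (by omega), hget j (by omega)]
  · rw [hz]
    simp only [hiff, Finset.mem_union, Finset.mem_filter, Finset.mem_univ, true_and]
    by_cases hv : time n dead v = n ∧ ∃ x ∈ Y, v = x ∨ G.Adj v x <;> simp [hv]

/-- If a vertex remained, minimum degree two would force a remaining cycle, contrary to `hno`. -/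
theorem Data.idle (h : Data G i dead zed par cnt lens rows) (hi : i < n)
    (hdeg : ∀ v < n, dead v = 0 → 2 ≤ deg n (natAdj G) dead v)
    (hno : ∀ f L, ¬ RowCycle n (natAdj G) dead f L)
    (hlens : ∀ q < cnt, lens' q = lens q) (hrows : ∀ j < cnt * n, rows' j = rows j) :
    Data G (i + 1) dead zed par cnt lens' rows' := by
  obtain ⟨X, Z, E, T, hS, hz, hE⟩ := h.state
  refine ⟨fun v => (h.dead_le v).trans (Nat.le_succ i), X, Z, E, T, hS.idle (fun v hv => ?_) hi hlens
    hrows, hz, hE⟩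
  have hτ := h.le_time_iff hi.le
  obtain ⟨u, c, hc⟩ := exists_isCycle_of_degree (G := G) (hi.le.trans hv.ge) fun w hw => by
    rw [← deg_eq_card_aliveNbrs hτ]
    exact hdeg w w.2 ((hτ w).1 hw)
  exact hno _ _ (rowCycle_of_isCycle hτ hc)

/-- The memory holds the state of the greedy algorithm after `i` rounds. -/
structure Inv (G : SimpleGraph (Fin n)) (i : ℕ) (s : Store) : Prop extends
    Ctx n (natAdj G) s where
  data : Data G i (s.arr 6) (s.arr 10) (s.arr 14) (s.var 5) (s.arr 1) (s.arr 2)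

end

/-- Delete the vertex found by `scanP`. -/
def pruneP : LProg :=
  .seq (.store 6 (.sub (.var 11) (.const 1)) (.add (.var 6) (.const 1)))
    (.store 14 (.sub (.var 11) (.const 1)) (.var 13))

/-- One round of the greedy algorithm. -/
def roundP : LProg :=
  .seq scanP <| .ite (.var 11) pruneP <| .seq searchP <|
    .ite (.sub (.var 19) (.var 10)) (.seq killP (.assign 5 (.add (.var 5) (.const 1)))) .skip

theorem roundP_spec {n : ℕ} {G : SimpleGraph (Fin n)} {i : ℕ} {s : Store} (h : Inv G i s)
    (hi : i < n) (h6 : s.var 6 = i) : Inv G (i + 1) (roundP.den s) := by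
  refine ⟨h.toCtx.den (by decide) (by decide) (by decide), ?_⟩
  have hd := h.data
  obtain ⟨hw, hlow⟩ := scanP_spec h.toCtx
  rw [roundP, den_seq]
  obtain ⟨s1, hs1⟩ : ∃ s1, s1 = scanP.den s := ⟨_, rfl⟩
  rw [← hs1] at hw hlow ⊢
  have hc1 : Ctx n (natAdj G) s1 := hs1 ▸ h.toCtx.den (by decide) (by decide) (by decide)
  have f5 : s1.var 5 = s.var 5 := hs1 ▸ den_var (by decide) s
  have f6 : s1.var 6 = i := (hs1 ▸ den_var (by decide) s : s1.var 6 = s.var 6).trans h6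
  have a1 : s1.arr 1 = s.arr 1 := hs1 ▸ den_arr (by decide) s
  have a2 : s1.arr 2 = s.arr 2 := hs1 ▸ den_arr (by decide) s
  have a6 : s1.arr 6 = s.arr 6 := hs1 ▸ den_arr (by decide) s
  have a10 : s1.arr 10 = s.arr 10 := hs1 ▸ den_arr (by decide) s
  have a14 : s1.arr 14 = s.arr 14 := hs1 ▸ den_arr (by decide) s
  rcases hlow with ⟨h11, hdeg⟩ | ⟨d, hdn, h11, hd0, hddeg, h13⟩
  swap
  · rw [den_ite_ne (by simp [Expr.eval, h11]), pruneP, den_seq, den_store, den_store]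
    simp only [Store.arr_setArr, Store.var_setArr, Expr.eval, h11, f5, f6, a1, a2, a6, a10, a14,
      Nat.reduceEqDiff, if_true, if_false, Nat.add_sub_cancel]
    exact hd.prune hi hdn hd0 hddeg h13 (fun _ _ => rfl) fun _ _ => rfl
  rw [den_ite_eq (by simp [Expr.eval, h11]), den_seq]
  have hW : WCtx n (natAdj G) (s.arr 6) s1 := ⟨hc1, a6, hw⟩
  obtain ⟨X, Z, E, T, hS, -⟩ := hd.state
  have hcnt : s1.var 5 ≤ n := by rw [f5]; exact hS.cnt_le.trans hi.le
  obtain ⟨h19, hB, hmin⟩ := searchP_spec hW natAdj_symm not_natAdj_self hcnt (by omega)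
  obtain ⟨s2, hs2⟩ : ∃ s2, s2 = searchP.den s1 := ⟨_, rfl⟩
  rw [← hs2] at h19 hB hmin ⊢
  have hW2 : WCtx n (natAdj G) (s.arr 6) s2 := hs2 ▸ hW.den (by decide) (by decide) (by decide)
    (by decide) (by decide)
  have g5 : s2.var 5 = s.var 5 := (hs2 ▸ den_var (by decide) s1 : s2.var 5 = s1.var 5).trans f5
  have g6 : s2.var 6 = i := (hs2 ▸ den_var (by decide) s1 : s2.var 6 = s1.var 6).trans f6
  have b10 : s2.arr 10 = s.arr 10 :=
    (hs2 ▸ den_arr (by decide) s1 : s2.arr 10 = s1.arr 10).trans a10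
  have b14 : s2.arr 14 = s.arr 14 :=
    (hs2 ▸ den_arr (by decide) s1 : s2.arr 14 = s1.arr 14).trans a14
  have b6 : s2.arr 6 = s.arr 6 := hW2.dead_eq
  rw [f5] at hB
  have hlens : ∀ q < s.var 5, s2.arr 1 q = s.arr 1 q := fun q hq => by
    rw [hB.lens q hq.ne, a1]
  have hrows : ∀ j < s.var 5 * n, s2.arr 2 j = s.arr 2 j := fun j hj => by
    rw [hB.rows j hj, a2]
  -- If register 10 still holds the initial value, no cycle remains, because every cycle is lighter.
  by_cases hfound : s2.var 10 < n * n + (n + (n + 1))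
  · rw [den_ite_ne (by simp only [Expr.eval, h19]; omega), den_seq, den_assign]
    obtain ⟨hR, hsum⟩ := hB.cycle hfound
    obtain ⟨k6, k10⟩ := killP_spec hW2 (f := fun j => s2.arr 2 (s.var 5 * n + j)) (by omega)
      (by simp [g5]) (g5 ▸ hR)
    obtain ⟨s3, hs3⟩ : ∃ s3, s3 = killP.den s2 := ⟨_, rfl⟩
    rw [← hs3] at k6 k10 ⊢
    have e5 : s3.var 5 = s.var 5 := (hs3 ▸ den_var (by decide) s2 : s3.var 5 = s2.var 5).trans g5
    have c1 : s3.arr 1 = s2.arr 1 := hs3 ▸ den_arr (by decide) s2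
    have c2 : s3.arr 2 = s2.arr 2 := hs3 ▸ den_arr (by decide) s2
    have c14 : s3.arr 14 = s.arr 14 :=
      (hs3 ▸ den_arr (by decide) s2 : s3.arr 14 = s2.arr 14).trans b14
    simp only [Store.arr_setVar, Store.var_setVar, if_true, Expr.eval, e5, c1, c2, c14, k6, k10, g5,
      g6, b10]
    exact hd.delete hi hR hdeg (fun f' L' hf' => hsum.trans (hmin f' L' hf')) hlens hrows rfl
      fun _ _ => rfl
  · rw [den_ite_eq (by simp only [Expr.eval, h19]; omega), den_skip, b6, b10, b14, g5]
    exact hd.idle hi hdeg (fun f L hf => by have := hmin f L hf; have := hf.sum_lt; omega)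
      hlens hrows

end CycleFinder
end

/-! ### The greedy loop and the output of the tree-decomposition. -/

section

open scoped Classical

namespace CycleFinder

open LProg ShortCycles

theorem index_inj {m u v u' v' : ℕ} (hv : v < m) (hv' : v' < m) (h : u * m + v = u' * m + v') :
    u = u' ∧ v = v' := by
  have h1 := congrArg (· % m) h
  simp only [Nat.mul_add_mod_self_right, Nat.mod_eq_of_lt hv, Nat.mod_eq_of_lt hv'] at h1
  subst h1
  exact ⟨Nat.eq_of_mul_eq_mul_right (by omega) (Nat.add_right_cancel h), rfl⟩

theorem ite_eq_ite_of_iff_or {α : Type*} {P Q R : Prop} [Decidable P] [Decidable Q] [Decidable R]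
    {a b : α} (h : R ↔ P ∨ Q) : (if P then a else if Q then a else b) = if R then a else b := by
  by_cases hP : P <;> by_cases hQ : Q <;> simp [h, hP, hQ]

/-- Store the multiples of `n` in array 5 and fill array 14 with `n`. -/
def initP : LProg :=
  .forN 6 (.seq (.store 5 (.add (.var 6) (.const 1)) (.add (.get 5 (.var 6)) (.var 0)))
    (.store 14 (.var 6) (.var 0)))

/-- The machine cannot multiply, so the row offsets are tabulated by repeated addition. The value
`n` in array 14 makes the root node the default parent. -/
theorem initP_spec {s : Store} {n : ℕ} (h0 : s.var 0 = n) (h5 : s.arr 5 0 = 0) :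
    (∀ i ≤ n, (initP.den s).arr 5 i = i * n) ∧ ∀ i < n, (initP.den s).arr 14 i = n := by
  have key := den_forN (x := 6) (p := .seq (.store 5 (.add (.var 6) (.const 1))
    (.add (.get 5 (.var 6)) (.var 0))) (.store 14 (.var 6) (.var 0))) s (fun m st =>
      (∀ i ≤ m, st.arr 5 i = i * n) ∧ ∀ i < m, st.arr 14 i = n) ?_ ?_
  · rw [h0] at key
    exact key
  · simp [h5]
  · intro m st hm h6 hvar harr ⟨k1, k2⟩
    have g0 : st.var 0 = n := (hvar 0 (by decide) (by decide)).trans h0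
    rw [den_seq, den_store, den_store]
    simp only [Store.arr_setVar, Store.arr_setArr, Store.var_setArr, Expr.eval, h6, g0,
      Nat.reduceEqDiff, if_true, if_false, Function.update_apply]
    refine ⟨fun i hi => ?_, fun i hi => ?_⟩
    · split_ifs with e
      · rw [k1 m le_rfl, e, Nat.succ_mul]
      · exact k1 i (by omega)
    · split_ifs with e
      · rfl
      · exact k2 i (by omega)

/-- The greedy algorithm. -/
def greedyP : LProg := .seq initP (.forN 6 roundP)

theorem data_zero {n : ℕ} {G : SimpleGraph (Fin n)} {dead zed par lens rows : ℕ → ℕ}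
    (hd : ∀ v < n, dead v = 0) (hz : ∀ v < n, zed v = 0) (hp : ∀ v < n, par v = n) :
    Data G 0 dead zed par 0 lens rows := by
  have hτ : ∀ v : Fin n, time n dead v = n := fun v => by simp [time, hd v v.2]
  refine ⟨fun v => (hd v v.2).le, ∅, ∅, fun _ => Fin.last n, fun _ => 0, ?_,
    fun v => by simp [hz v v.2], fun v => by simp [hp v v.2]⟩
  constructor
  case time => exact fun v => Or.inr (hτ v)
  case card => simpa using Finset.card_le_univ (Finset.univ.filter fun v => time n dead v = n)
  case parent_lt => exact fun v u hu => absurd hu (Fin.castSucc_lt_last u).ne'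
  all_goals simp

theorem greedyP_spec {n : ℕ} {G : SimpleGraph (Fin n)} {s : Store} (h0 : s.var 0 = n)
    (hadj : ∀ u < n, ∀ v < n, s.arr 0 (u * n + v) = 0 ↔ ¬ natAdj G u v) (h5 : s.var 5 = 0)
    (harr : ∀ a i, a ≠ 0 → s.arr a i = 0) : Inv G n (greedyP.den s) := by
  rw [greedyP, den_seq]
  obtain ⟨k1, k2⟩ := initP_spec h0 (harr 5 0 (by decide))
  obtain ⟨s1, hs1⟩ : ∃ s1, s1 = initP.den s := ⟨_, rfl⟩
  rw [← hs1] at k1 k2 ⊢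
  have f0 : s1.var 0 = n := (hs1 ▸ den_var (by decide) s : s1.var 0 = s.var 0).trans h0
  have f5 : s1.var 5 = 0 := (hs1 ▸ den_var (by decide) s : s1.var 5 = s.var 5).trans h5
  have a0 : s1.arr 0 = s.arr 0 := hs1 ▸ den_arr (by decide) s
  have a6 : s1.arr 6 = s.arr 6 := hs1 ▸ den_arr (by decide) s
  have a10 : s1.arr 10 = s.arr 10 := hs1 ▸ den_arr (by decide) s
  have hI : Inv G 0 s1 := ⟨⟨f0, by rw [a0]; exact hadj, k1⟩, by
    rw [f5, a6, a10]
    exact data_zero (fun v _ => harr 6 v (by decide)) (fun v _ => harr 10 v (by decide)) k2⟩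
  have hset : ∀ i j st, Inv G i st → Inv G i (st.setVar 6 j) := fun i j st h =>
    ⟨h.toCtx.congr (by simp) rfl rfl, by simpa using h.data⟩
  have key := den_forN (x := 6) (p := roundP) s1 (fun i st => Inv G i st) (hset _ _ _ hI)
    fun i st hi h6 _ _ hst => hset _ _ _ (roundP_spec hst (f0 ▸ hi) h6)
  rwa [f0] at key

/-- Write the adjacencies between the node in register 7 and its parent. -/
def treeEdgeP : LProg :=
  .seq (.store 3 (.add (.add (.get 5 (.var 7)) (.var 7)) (.get 14 (.var 7))) (.const 1))
    (.store 3 (.add (.add (.get 5 (.get 14 (.var 7))) (.get 14 (.var 7))) (.var 7)) (.const 1))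

/-- The rows of the tree have width `n + 1`, and `a * (n + 1)` is computed as the tabulated `a * n`
plus `a`. -/
theorem forN_treeEdgeP_spec {n : ℕ} {s : Store} {p : ℕ → ℕ} (h0 : s.var 0 = n)
    (h5 : ∀ i ≤ n, s.arr 5 i = i * n) (h14 : s.arr 14 = p) (hp : ∀ a < n, p a ≤ n)
    (h3 : ∀ x, s.arr 3 x = 0) :
    ((forN 7 treeEdgeP).den s).arr 3 = fun x =>
      if ∃ a < n, x = a * (n + 1) + p a ∨ x = p a * (n + 1) + a then 1 else 0 := by
  have key := den_forN (x := 7) (p := treeEdgeP) s (fun i st => st.arr 3 = fun x =>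
      if ∃ a < i, x = a * (n + 1) + p a ∨ x = p a * (n + 1) + a then 1 else 0) ?_ ?_
  · rwa [h0] at key
  · funext x
    simp [h3]
  · intro i st hi h7 hvar harr hI
    rw [h0] at hi
    have g5 : st.arr 5 = s.arr 5 := harr 5 (by decide)
    have g14 : st.arr 14 = p := (harr 14 (by decide)).trans h14
    funext x
    rw [treeEdgeP, den_seq, den_store, den_store]
    simp only [Store.arr_setVar, Store.arr_setArr, Store.var_setArr, Expr.eval, h7, g5, g14,
      Nat.reduceEqDiff, if_true, if_false, Function.update_apply, h5 i hi.le, h5 _ (hp i hi), hI]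
    have e : (∃ a < i + 1, x = a * (n + 1) + p a ∨ x = p a * (n + 1) + a) ↔
        x = p i * n + p i + i ∨ x = i * n + i + p i ∨
          ∃ a < i, x = a * (n + 1) + p a ∨ x = p a * (n + 1) + a := by
      constructor
      · rintro ⟨a, ha, h⟩
        rcases Nat.lt_succ_iff_lt_or_eq.1 ha with ha | rfl
        · exact Or.inr (Or.inr ⟨a, ha, h⟩)
        · rcases h with h | h
          · right; left; rw [h]; ring
          · left; rw [h]; ring
      · rintro (h | h | ⟨a, ha, h⟩)
        · exact ⟨i, by omega, Or.inr (by rw [h]; ring)⟩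
        · exact ⟨i, by omega, Or.inl (by rw [h]; ring)⟩
        · exact ⟨a, by omega, h⟩
    exact (ite_congr rfl (fun _ => rfl) fun _ => ite_eq_ite_of_iff_or Iff.rfl).trans
      (ite_eq_ite_of_iff_or e)

/-- Write the bag of the node in register 7. -/
def bagP : LProg :=
  .forN 8 <| .ite (.add (.get 10 (.var 8)) (.add (.sub (.const 1) (neE (.var 8) (.var 7)))
      (.sub (.const 1) (neE (.var 8) (.get 14 (.var 7))))))
    (.store 4 (.add (.get 5 (.var 7)) (.var 8)) (.const 1)) .skip

theorem bagP_spec {n : ℕ} {s : Store} (h0 : s.var 0 = n) (h5 : ∀ i ≤ n, s.arr 5 i = i * n)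
    (h7 : s.var 7 ≤ n) :
    (bagP.den s).arr 4 = fun x => if ∃ v < n, x = s.var 7 * n + v ∧
      (s.arr 10 v ≠ 0 ∨ v = s.var 7 ∨ v = s.arr 14 (s.var 7)) then 1 else s.arr 4 x := by
  have key := den_forN (x := 8) (p := .ite (.add (.get 10 (.var 8)) (.add (.sub (.const 1)
      (neE (.var 8) (.var 7))) (.sub (.const 1) (neE (.var 8) (.get 14 (.var 7))))))
    (.store 4 (.add (.get 5 (.var 7)) (.var 8)) (.const 1)) .skip) s (fun i st =>
      st.arr 4 = fun x => if ∃ v < i, x = s.var 7 * n + v ∧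
        (s.arr 10 v ≠ 0 ∨ v = s.var 7 ∨ v = s.arr 14 (s.var 7)) then 1 else s.arr 4 x) ?_ ?_
  · rwa [h0] at key
  · funext x
    simp
  · intro i st hi h8 hvar harr hI
    have g7 : st.var 7 = s.var 7 := hvar 7 (by decide) (by decide)
    have g5 : st.arr 5 = s.arr 5 := harr 5 (by decide)
    have g10 : st.arr 10 = s.arr 10 := harr 10 (by decide)
    have g14 : st.arr 14 = s.arr 14 := harr 14 (by decide)
    have hcond : (Expr.add (.get 10 (.var 8)) (.add (.sub (.const 1) (neE (.var 8) (.var 7)))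
        (.sub (.const 1) (neE (.var 8) (.get 14 (.var 7)))))).eval st = 0 ↔
        ¬ (s.arr 10 i ≠ 0 ∨ i = s.var 7 ∨ i = s.arr 14 (s.var 7)) := by
      simp only [neE, Expr.eval, h8, g7, g10, g14]
      omega
    rw [Store.arr_setVar]
    have e : ∀ x, (∃ v < i + 1, x = s.var 7 * n + v ∧
        (s.arr 10 v ≠ 0 ∨ v = s.var 7 ∨ v = s.arr 14 (s.var 7))) ↔
        (x = s.var 7 * n + i ∧ (s.arr 10 i ≠ 0 ∨ i = s.var 7 ∨ i = s.arr 14 (s.var 7))) ∨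
        ∃ v < i, x = s.var 7 * n + v ∧
          (s.arr 10 v ≠ 0 ∨ v = s.var 7 ∨ v = s.arr 14 (s.var 7)) := by
      intro x
      constructor
      · rintro ⟨v, hv, h⟩
        rcases Nat.lt_succ_iff_lt_or_eq.1 hv with hv | rfl
        · exact Or.inr ⟨v, hv, h⟩
        · exact Or.inl h
      · rintro (h | ⟨v, hv, h⟩)
        · exact ⟨i, by omega, h⟩
        · exact ⟨v, by omega, h⟩
    by_cases hB : s.arr 10 i ≠ 0 ∨ i = s.var 7 ∨ i = s.arr 14 (s.var 7)
    · rw [den_ite_ne fun h => hcond.1 h hB, den_store]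
      funext x
      simp only [Store.arr_setArr, Expr.eval, if_true, g5, g7, h8, h5 _ h7, Function.update_apply,
        hI]
      exact ite_eq_ite_of_iff_or ((e x).trans (or_congr_left (and_iff_left hB)))
    · rw [den_ite_eq (hcond.2 hB), den_skip, hI]
      simp only [e, hB, and_false, false_or]

/-- Write the tree-decomposition given by the parents in array 14 and the marks in array 10. -/
def treeP : LProg :=
  .seq (.store 14 (.var 0) (.var 0)) <| .seq (.assign 3 (.const 2)) <|
  .seq (.assign 4 (.add (.var 0) (.const 1))) <| .seq (.forN 7 treeEdgeP) <|
  .seq (.forN 7 bagP) <| .seq (.assign 7 (.var 0)) bagP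

/-- Loops stop at `n - 1`, so the bag of the root node `n` is written separately. Cell `n` of array
14 makes the root its own parent, so its bag contains the marked vertices only. -/
theorem treeP_spec {n : ℕ} {s : Store} {p : ℕ → ℕ} (h0 : s.var 0 = n)
    (h5 : ∀ i ≤ n, s.arr 5 i = i * n) (h14 : ∀ a < n, s.arr 14 a = p a) (hpn : p n = n)
    (hp : ∀ a < n, p a ≤ n) (h3 : ∀ x, s.arr 3 x = 0) (h4 : ∀ x, s.arr 4 x = 0) :
    (treeP.den s).var 3 = 2 ∧ (treeP.den s).var 4 = n + 1 ∧
    (∀ x, (treeP.den s).arr 3 x =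
      if ∃ a < n, x = a * (n + 1) + p a ∨ x = p a * (n + 1) + a then 1 else 0) ∧
    ∀ x, (treeP.den s).arr 4 x = if ∃ a ≤ n, ∃ v < n, x = a * n + v ∧
      (s.arr 10 v ≠ 0 ∨ v = a ∨ v = p a) then 1 else 0 := by
  obtain ⟨s1, hs1⟩ : ∃ s1, s1 = ((s.setArr 14 n n).setVar 3 2).setVar 4 (n + 1) := ⟨_, rfl⟩
  have e : treeP.den s = bagP.den ((Expr.var 0).eval ((forN 7 bagP).den ((forN 7 treeEdgeP).den s1))
      |> ((forN 7 bagP).den ((forN 7 treeEdgeP).den s1)).setVar 7) := by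
    rw [hs1]
    simp [treeP, den_seq, den_assign, den_store, Expr.eval, h0]
  have hp' : ∀ a ≤ n, p a ≤ n := fun a ha => ha.lt_or_eq.elim (hp a) fun e => by rw [e, hpn]
  have f0 : s1.var 0 = n := by simp [hs1, h0]
  have f14 : ∀ a ≤ n, s1.arr 14 a = p a := fun a ha => by
    simp only [hs1, Store.arr_setVar, Store.arr_setArr, if_true, Function.update_apply]
    split_ifs with h
    · rw [h, hpn]
    · exact h14 a (by omega)
  have f5 : ∀ i ≤ n, s1.arr 5 i = i * n := by simpa [hs1] using h5
  have k3 := forN_treeEdgeP_spec f0 f5 rfl (fun a ha => by rw [f14 a ha.le]; exact hp a ha)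
    (by simpa [hs1] using h3)
  obtain ⟨s2, hs2⟩ : ∃ s2, s2 = (forN 7 treeEdgeP).den s1 := ⟨_, rfl⟩
  rw [← hs2] at e k3
  have g0 : s2.var 0 = n := (hs2 ▸ den_var (by decide) s1 : s2.var 0 = s1.var 0).trans f0
  have g5 : ∀ i ≤ n, s2.arr 5 i = i * n := (hs2 ▸ den_arr (by decide) s1 : s2.arr 5 = s1.arr 5) ▸ f5
  have g14 : ∀ a ≤ n, s2.arr 14 a = p a :=
    (hs2 ▸ den_arr (by decide) s1 : s2.arr 14 = s1.arr 14) ▸ f14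
  have g10 : s2.arr 10 = s.arr 10 := by
    rw [hs2, den_arr (by decide)]; simp [hs1]
  have g4 : ∀ x, s2.arr 4 x = 0 := fun x => by
    rw [hs2, den_arr (by decide)]; simp [hs1, h4]
  have hstep : ∀ (m : ℕ) (st : Store), m ≤ n → st.var 0 = n → st.arr 5 = s2.arr 5 →
      st.arr 14 = s2.arr 14 → st.arr 10 = s2.arr 10 → st.var 7 = m →
      (st.arr 4 = fun x => if ∃ a < m, ∃ v < n, x = a * n + v ∧
        (s.arr 10 v ≠ 0 ∨ v = a ∨ v = p a) then 1 else 0) →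
      (bagP.den st).arr 4 = fun x => if ∃ a < m + 1, ∃ v < n, x = a * n + v ∧
        (s.arr 10 v ≠ 0 ∨ v = a ∨ v = p a) then 1 else 0 := by
    intro m st hm i0 i5 i14 i10 i7 i4
    rw [bagP_spec i0 (i5 ▸ g5) (by omega), i10, i7, i14, g10, g14 m hm, i4]
    funext x
    have : (∃ a < m + 1, ∃ v < n, x = a * n + v ∧ (s.arr 10 v ≠ 0 ∨ v = a ∨ v = p a)) ↔
        (∃ v < n, x = m * n + v ∧ (s.arr 10 v ≠ 0 ∨ v = m ∨ v = p m)) ∨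
        ∃ a < m, ∃ v < n, x = a * n + v ∧ (s.arr 10 v ≠ 0 ∨ v = a ∨ v = p a) := by
      constructor
      · rintro ⟨a, ha, h⟩
        rcases Nat.lt_succ_iff_lt_or_eq.1 ha with ha | rfl
        · exact Or.inr ⟨a, ha, h⟩
        · exact Or.inl h
      · rintro (h | ⟨a, ha, h⟩)
        · exact ⟨m, by omega, h⟩
        · exact ⟨a, by omega, h⟩
    exact ite_eq_ite_of_iff_or this
  have k4 := den_forN (x := 7) (p := bagP) s2 (fun m st => st.arr 4 = fun x =>
    if ∃ a < m, ∃ v < n, x = a * n + v ∧ (s.arr 10 v ≠ 0 ∨ v = a ∨ v = p a) then 1 else 0)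
    (by funext x; simp [g4]) fun m st hm h7 hvar harr hI => by
      rw [Store.arr_setVar]
      exact hstep m st (by omega) ((hvar 0 (by decide) (by decide)).trans g0)
        (harr 5 (by decide)) (harr 14 (by decide)) (harr 10 (by decide)) h7 hI
  rw [g0] at k4
  obtain ⟨s3, hs3⟩ : ∃ s3, s3 = (forN 7 bagP).den s2 := ⟨_, rfl⟩
  rw [← hs3] at e k4
  have j0 : s3.var 0 = n := (hs3 ▸ den_var (by decide) s2 : s3.var 0 = s2.var 0).trans g0
  have k5 := hstep n (s3.setVar 7 n) le_rfl (by simp [j0])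
    (by rw [Store.arr_setVar, hs3]; exact den_arr (by decide) s2)
    (by rw [Store.arr_setVar, hs3]; exact den_arr (by decide) s2)
    (by rw [Store.arr_setVar, hs3]; exact den_arr (by decide) s2) (by simp) (by simpa using k4)
  simp only [Expr.eval, j0] at e
  rw [e]
  refine ⟨?_, ?_, fun x => ?_, fun x => ?_⟩
  · rw [den_var (by decide), Store.var_setVar, if_neg (by decide), hs3, den_var (by decide), hs2,
      den_var (by decide), hs1]
    simp
  · rw [den_var (by decide), Store.var_setVar, if_neg (by decide), hs3, den_var (by decide), hs2,
      den_var (by decide), hs1]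
    simp
  · rw [den_arr (by decide), Store.arr_setVar, hs3, den_arr (by decide), k3]
    have : (∃ a < n, x = a * (n + 1) + s1.arr 14 a ∨ x = s1.arr 14 a * (n + 1) + a) ↔
        ∃ a < n, x = a * (n + 1) + p a ∨ x = p a * (n + 1) + a :=
      exists_congr fun a => and_congr_right fun ha => by rw [f14 a ha.le]
    simp only [this]
  · rw [k5]
    simp only [Nat.lt_succ_iff]

/-- The whole program. -/
def mainP : LProg :=
  .seq greedyP <| .ite (.sub (.var 2) (.var 5)) treeP (.assign 3 (.const 1))

end CycleFinder
end

/-! ### Correctness of the whole program. -/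

section

open scoped Classical

namespace CycleFinder

open LProg ShortCycles

theorem inputStore_arr_zero {n : ℕ} (G : SimpleGraph (Fin n)) (t k : ℕ) {u v : ℕ} (hu : u < n)
    (hv : v < n) : (inputStore G t k).arr 0 (u * n + v) = 0 ↔ ¬ natAdj G u v := by
  have : (∃ a b : Fin n, u * n + v = a * n + b ∧ G.Adj a b) ↔ natAdj G u v := by
    constructor
    · rintro ⟨a, b, h, hab⟩
      obtain ⟨rfl, rfl⟩ := index_inj hv b.2 h
      exact natAdj_val.2 hab
    · rintro ⟨hu, hv, h⟩
      exact ⟨⟨u, hu⟩, ⟨v, hv⟩, rfl, h⟩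
  simp [inputStore, this]

theorem nodeParent_val {n : ℕ} (E : Fin n → Fin (n + 1)) (a : Fin (n + 1)) {p : ℕ → ℕ}
    (hp : ∀ v : Fin n, p v = E v) (hpn : p n = n) : (nodeParent E a : ℕ) = p a := by
  induction a using Fin.lastCases with
  | last => rw [nodeParent_last, Fin.val_last, hpn]
  | cast v => rw [nodeParent_castSucc, Fin.val_castSucc, hp]

theorem presentsTreeDecomposition {n : ℕ} {G : SimpleGraph (Fin n)} {τ : Fin n → ℕ}
    {Z : Finset (Fin n)} {E : Fin n → Fin (n + 1)} (h : IsParent G τ Z E) {s : Store} {p z : ℕ → ℕ}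
    (hp : ∀ v : Fin n, p v = E v) (hpn : p n = n) (hz : ∀ v : Fin n, z v = if v ∈ Z then 1 else 0)
    (h3 : s.var 3 = 2) (h4 : s.var 4 = n + 1)
    (htree : ∀ x, s.arr 3 x =
      if ∃ a < n, x = a * (n + 1) + p a ∨ x = p a * (n + 1) + a then 1 else 0)
    (hbag : ∀ x, s.arr 4 x = if ∃ a ≤ n, ∃ v < n, x = a * n + v ∧
      (z v ≠ 0 ∨ v = a ∨ v = p a) then 1 else 0) :
    s.PresentsTreeDecomposition h.treeDecomposition := by
  have hlt : ∀ a < n, p a < n + 1 := fun a ha => by rw [hp ⟨a, ha⟩]; exact (E ⟨a, ha⟩).2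
  -- Parents are deleted strictly later, so no node other than the root is its own parent, and the
  -- diagonal of the matrix stays zero.
  have hne : ∀ a < n, p a ≠ a := fun a ha e => by
    have := h.lt ⟨a, ha⟩ ⟨a, ha⟩ (Fin.ext (by rw [← hp]; exact e))
    omega
  refine ⟨h3, h4, fun a b => ?_, fun a v => ?_⟩
  · rw [htree]
    refine if_congr ?_ rfl rfl
    change _ ↔ (parentGraph (nodeParent E)).Adj a b
    rw [parentGraph_adj, Fin.ext_iff, Fin.ext_iff, nodeParent_val E a hp hpn,
      nodeParent_val E b hp hpn, Ne, Fin.ext_iff]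
    constructor
    · rintro ⟨c, hc, hx | hx⟩
      · obtain ⟨e1, e2⟩ := index_inj b.2 (hlt c hc) hx
        rw [e1, e2]
        exact ⟨(hne c hc).symm, Or.inl rfl⟩
      · obtain ⟨e1, e2⟩ := index_inj b.2 (by omega) hx
        rw [e1, e2]
        exact ⟨hne c hc, Or.inr rfl⟩
    · rintro ⟨hab, e | e⟩
      · have : (a : ℕ) ≠ n := fun ha => hab (by rw [← e, ha, hpn])
        exact ⟨a, by omega, Or.inl (by rw [e])⟩
      · have : (b : ℕ) ≠ n := fun hb => hab (by rw [← e, hb, hpn])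
        exact ⟨b, by omega, Or.inr (by rw [e])⟩
  · rw [hbag]
    refine if_congr ?_ rfl rfl
    change _ ↔ v ∈ Z ∨ v.castSucc = a ∨ v.castSucc = nodeParent E a
    rw [Fin.ext_iff, Fin.ext_iff, nodeParent_val E a hp hpn, Fin.val_castSucc]
    have hzv : z v ≠ 0 ↔ v ∈ Z := by rw [hz]; split_ifs with hv <;> simp [hv]
    constructor
    · rintro ⟨b, hb, w, hw, hx, hB⟩
      obtain ⟨e1, e2⟩ := index_inj v.2 hw hx
      rwa [← e1, ← e2, hzv] at hB
    · exact fun hB => ⟨a, by omega, v, v.2, rfl, by rwa [hzv]⟩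

theorem mainP_spec {n t k : ℕ} (G : SimpleGraph (Fin n)) (ht : 0 < t) (hk : 0 < k)
    (hG : ¬ (completeBipartiteGraph (Fin 1) (Fin t)).IsIndContained G) :
    (∃ (root : Fin k → Fin n) (cyc : ∀ i, G.Walk (root i) (root i)),
      IsInducedCyclePacking G root cyc ∧ (mainP.den (inputStore G t k)).PresentsCycles cyc) ∨
    ∃ (m : ℕ) (D : TreeDecomposition G (Fin m)),
      (D.independenceNumber : ℝ) ≤ 11004 * t * k * Real.log (k + 1) ∧
      (mainP.den (inputStore G t k)).PresentsTreeDecomposition D := by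
  have hI := greedyP_spec (G := G) (s := inputStore G t k) rfl
    (fun u hu v hv => inputStore_arr_zero G t k hu hv) rfl (fun a i ha => by simp [inputStore, ha])
  rw [mainP, den_seq]
  obtain ⟨s, hs⟩ : ∃ s, s = greedyP.den (inputStore G t k) := ⟨_, rfl⟩
  rw [← hs] at hI ⊢
  have f2 : s.var 2 = k := by rw [hs, den_var (by decide)]; simp [inputStore]
  have a3 : ∀ x, s.arr 3 x = 0 := fun x => by rw [hs, den_arr (by decide)]; simp [inputStore]
  have a4 : ∀ x, s.arr 4 x = 0 := fun x => by rw [hs, den_arr (by decide)]; simp [inputStore]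
  obtain ⟨X, Z, E, T, hS, hz, hE⟩ := hI.data.state
  by_cases hcnt : k ≤ s.var 5
  · left
    rw [den_ite_eq (by simp only [Expr.eval, f2]; omega), den_assign]
    obtain ⟨root, cyc, h1, h2⟩ := hS.exists_packing hcnt
    exact ⟨root, cyc, h1, by simp [Expr.eval], by simpa using h2⟩
  · right
    rw [den_ite_ne (by simp only [Expr.eval, f2]; omega)]
    obtain ⟨p, hp⟩ : ∃ p, p = Function.update (s.arr 14) n n := ⟨_, rfl⟩
    have hpn : p n = n := by rw [hp, Function.update_self]
    have hpa : ∀ a < n, s.arr 14 a = p a := fun a ha => by rw [hp, Function.update_of_ne ha.ne]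
    have hpE : ∀ v : Fin n, p v = E v := fun v => by rw [← hpa v v.2, hE]
    obtain ⟨k1, k2, k3, k4⟩ := treeP_spec hI.n_eq hI.row hpa hpn
      (fun a ha => by rw [hpE ⟨a, ha⟩]; exact Nat.lt_succ_iff.1 (E ⟨a, ha⟩).2) a3 a4
    refine ⟨n + 1, hS.isParent.treeDecomposition, ?_,
      presentsTreeDecomposition hS.isParent hpE hpn hz k1 k2 k3 k4⟩
    have h1 : (hS.isParent.treeDecomposition.independenceNumber : ℝ) ≤ X.card * t + 2 := by
      exact_mod_cast hS.isParent.independenceNumber_le hS.isDismantling ht hG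
    have h2 := hS.isDismantling.card_le_log hk (hS.card_image_le.trans (by omega))
    have htR : (1 : ℝ) ≤ t := by exact_mod_cast ht
    have hkR : (1 : ℝ) ≤ k := by exact_mod_cast hk
    -- This bounds the summand 2 in the independence number by `4 * t * k * log (k + 1)`, whence
    -- 11004 instead of 11000.
    have hlog : (1 : ℝ) / 2 ≤ Real.log (k + 1) := by
      have := Real.log_two_gt_d9
      have := Real.log_le_log (by norm_num : (0 : ℝ) < 2) (by linarith : (2 : ℝ) ≤ k + 1)
      linarith
    have h3 : (1 : ℝ) ≤ t * k := by nlinarith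
    have h4 : (1 : ℝ) / 2 ≤ t * k * Real.log (k + 1) := by nlinarith
    have h5 := mul_le_mul_of_nonneg_right h2 (by linarith : (0 : ℝ) ≤ t)
    nlinarith

end CycleFinder

end

theorem corollary1p2 :
    ∃ (A : Prog) (P : Polynomial ℕ) (C : ℝ),
      ∀ (n t k : ℕ) (G : SimpleGraph (Fin n)), 0 < t → 0 < k →
        ¬ (completeBipartiteGraph (Fin 1) (Fin t)).IsIndContained G →
        ∃ (time : ℕ) (s : Store),
          A.Exec (inputStore G t k) time s ∧
          time ≤ P.eval (inputSize n t k) ∧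
          ((∃ (root : Fin k → Fin n) (cyc : ∀ i, G.Walk (root i) (root i)),
              IsInducedCyclePacking G root cyc ∧ s.PresentsCycles cyc) ∨
            (∃ (m : ℕ) (D : TreeDecomposition G (Fin m)),
              (D.independenceNumber : ℝ) ≤ C * t * k * Real.log (k + 1) ∧
              s.PresentsTreeDecomposition D)) := by
  obtain ⟨P, hP⟩ := LProg.bound_le_polynomial CycleFinder.mainP
  refine ⟨CycleFinder.mainP.toProg, P, 11004, fun n t k G ht hk hG => ?_⟩
  obtain ⟨c, hc, hle⟩ := LProg.exec (p := CycleFinder.mainP) (by decide) (inputStore G t k)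
  refine ⟨c, _, hc, (hle.trans (hP _)).trans (LProg.eval_mono P ?_),
    CycleFinder.mainP_spec G ht hk hG⟩
  -- The bound on the number of steps depends on `n` alone.
  change n ≤ n + Nat.size t + Nat.size k
  omega
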